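/- **Setting.** Let $k$ be an algebraically closed field and let $\mathcal C$ be a $k$-linear triangulated category with shift $M\mapsto M[1]$ which is Krull–Schmidt (every object is a finite direct sum of indecomposable objects with local endomorphism rings) and Hom-finite (all $\operatorname{Hom}_{\mathcal C}(M,N)$ are finite dimensional), and such that for all objects $M,N$ we have $\operatorname{Hom}_{\mathcal C}(M,N[i])\neq 0$ for only finitely many $i\in\mathbb Z$. Let $A(\mathcal C)$ be the free abelian group on the isomorphism classes of indecomposable objects; an object has as its class in $A(\mathcal C)$ the sum of the classes of its indecomposable summands. Put $$A(\mathcal C)^t=(\mathbb Z[t,t^{-1}]\otimes_{\mathbb Z}A(\mathcal C))/I,\qquad A_{\mathbb Q}(\mathcal C)^t=\mathbb Q(t)\otimes_{\mathbb Z[t,t^{-1}]}A(\mathcal C)^t,$$ where $I$ is the $\mathbb Z[t,t^{-1}]$-submodule generated by the elements $1\otimes M[i]-t^i\otimes M$ for all objects $M$ and all $i\in\mathbb Z$. Objects also denote their classes in these modules. Let $\overline{\phantom{x}}$ be the automorphism $t\mapsto t^{-1}$ of $\mathbb Z[t,t^{-1}]$ and of $\mathbb Q(t)$. A sesquilinear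 form is linear in the first variable and semilinear with respect to $\overline{\phantom{x}}$ in the second. **Theorem 4.3.** (1) There is exactly one sesquilinear form $\langle\ ,\ \rangle^t$ on $A(\mathcal C)^t$ with values in $\mathbb Z[t,t^{-1}]$, and exactly one on $A_{\mathbb Q}(\mathcal C)^t$ with values in $\mathbb Q(t)$, such that for all indecomposable $M,N$ $$\langle M,N\rangle^t=\sum_{i\in\mathbb Z}t^i\dim_k\operatorname{Hom}_{\mathcal C}(M,N[i]).$$ On $A(\mathcal C)^t$ the formula then holds for all objects $M,N$, and the form on $A_{\mathbb Q}(\mathcal C)^t$ extends the one on $A(\mathcal C)^t$. (2) Let $X\to Y\to Z\to X[1]$ be an Auslander–Reiten triangle in $\mathcal C$: a distinguished triangle with $X$ and $Z$ indecomposable, with $Z\to X[1]$ nonzero, and such that every morphism to $Z$ that is not a split epimorphism factors through $Y\to Z$. Put $\hat Z=X+Z-Y$ and let $M$ be indecomposable. Then $$\langle M,\hat Z\rangle^t=\begin{cases}0&\text{unless }M\cong Z[i]\text{ for some }i,\\ 1+t&\text{if }M\cong Z,\end{cases}\qquad \langle \hat Z,M\rangle^t=\begin{cases}0&\text{unless }M\cong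 X[i]\text{ for some }i,\\ 1+t&\text{if }M\cong X.\end{cases}$$ Hence in $A_{\mathbb Q}(\mathcal C)^t$ the element $\frac{1}{1+t^{-1}}\hat Z$ is dual on the right to $Z$, that is, $\langle M,\frac1{1+t^{-1}}\hat Z\rangle^t$ is $1$ if $M\cong Z$ and $0$ if $M$ is not isomorphic to a shift of $Z$; and $\frac{1}{1+t}\hat Z$ is dual on the left to $X$, that is, $\langle \frac1{1+t}\hat Z,M\rangle^t$ is $1$ if $M\cong X$ and $0$ if $M$ is not isomorphic to a shift of $X$. (3) Let $\Lambda$ be a finite dimensional symmetric $k$-algebra (one with a linear form $\lambda:\Lambda\to k$ such that $\lambda(ab)=\lambda(ba)$ for all $a,b$, and such that $\lambda(a\Lambda)=0$ only for $a=0$). The category $D^b(\Lambda\text{-proj})$ of perfect complexes, that is, the homotopy category of finite complexes of finitely generated projective $\Lambda$-modules, satisfies the assumptions made on $\mathcal C$, and for it both forms are Hermitian: $\langle a,b\rangle^t=\overline{\langle b,a\rangle^t}$ for all elements $a,b$. (4) Let $G$ be a finite group. The category $D^b(kG\text{-proj})$ satisfies the assumptions made on $\mathcal C$. Let $M,N$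 be finite complexes of finitely generated projective $kG$-modules and $U$ a finite complex of finite dimensional $kG$-modules, and let $U^*,M^*,N^*$ be the dual complexes of $kG$-modules. Then $M\otimes_kU$, $U^*\otimes_kN$ (with diagonal $G$-action), $M^*$ and $N^*$ are perfect, and $$\langle M\otimes_kU,N\rangle^t=\langle M,U^*\otimes_kN\rangle^t,\qquad \langle M,N\rangle^t=\langle N^*,M^*\rangle^t=\overline{\langle M^*,N^*\rangle^t}.$$ -/

import Mathlib

open CategoryTheory CategoryTheory.Limits CategoryTheory.Pretriangulated
open scoped TensorProduct LaurentPolynomial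

universe u v v' w x y

noncomputable section

namespace ARForm

/-! ### The coefficient rings `ℤ[t, t⁻¹]` and `ℚ(t)` with the automorphism `t ↦ t⁻¹` -/

/-- The ring of Laurent polynomials with integer coefficients. -/
abbrev Zt : Type := ℤ[T;T⁻¹]

/-- The field of rational functions over the rationals. -/
abbrev Qt : Type := RatFunc ℚ

/-- The indeterminate `t` of `ℤ[t, t⁻¹]`. -/
abbrev tZ : Zt := LaurentPolynomial.T 1

/-- The indeterminate `t` of `ℚ(t)`. -/
abbrev tQ : Qt := RatFunc.X

/-- `t` as a unit of `ℚ(t)`. -/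
def tUnit : Qtˣ := Units.mk0 tQ RatFunc.X_ne_zero

/-- The inclusion of `ℤ[t, t⁻¹]` in `ℚ(t)`, sending `t` to `t`. -/
instance algebraZtQt : Algebra Zt Qt :=
  (LaurentPolynomial.eval₂ (Int.castRingHom Qt) tUnit).toAlgebra

/-- The ring automorphism `t ↦ t⁻¹` of `ℤ[t, t⁻¹]`. -/
def barZ : Zt →+* Zt :=
  (LaurentPolynomial.invert (R := ℤ) : Zt ≃ₐ[ℤ] Zt).toRingEquiv.toRingHom

theorem eval₂_inv_X_ne_zero (p : Polynomial ℚ) (hp : p ≠ 0) :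
    Polynomial.eval₂ (RatFunc.C (K := ℚ)) (tQ⁻¹) p ≠ 0 := by
  let _ : Algebra ℚ Qt := RatFunc.instAlgebraOfPolynomial ℚ ℚ
  intro h
  have h1 : IsAlgebraic ℚ (tQ⁻¹) := ⟨p, hp, h⟩
  have h2 : IsAlgebraic ℚ tQ := inv_inv tQ ▸ h1.inv
  exact RatFunc.transcendental_X h2

/-- The ring automorphism `t ↦ t⁻¹` of `ℚ(t)` (identity on constants). -/
def barQ : Qt →+* Qt :=
  RatFunc.liftRingHom (Polynomial.eval₂RingHom (RatFunc.C (K := ℚ)) (tQ⁻¹)) (by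
    intro p hp
    rw [Submonoid.mem_comap, mem_nonZeroDivisors_iff_ne_zero]
    exact eval₂_inv_X_ne_zero p (nonZeroDivisors.ne_zero hp))

theorem barQ_t : barQ tQ = tQ⁻¹ := by
  have h : barQ (algebraMap (Polynomial ℚ) Qt Polynomial.X) = tQ⁻¹ := by
    rw [barQ, RatFunc.liftRingHom_algebraMap]
    simp
  rwa [RatFunc.algebraMap_X] at h

theorem algebraMap_t : algebraMap Zt Qt tZ = tQ := by
  change LaurentPolynomial.eval₂ (Int.castRingHom Qt) tUnit (LaurentPolynomial.T 1) = tQ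
  simp [tUnit]

theorem barZ_t (n : ℤ) : barZ (LaurentPolynomial.T n) = LaurentPolynomial.T (-n) :=
  LaurentPolynomial.invert_T n

/-! ### The Grothendieck groups attached to a triangulated category -/

section Triangulated

variable (k : Type*) [Field k]
variable (C : Type*) [Category* C] [Preadditive C] [HasZeroObject C] [HasShift C ℤ]
  [∀ n : ℤ, (shiftFunctor C n).Additive] [Pretriangulated C] [Linear k C]

/-- Isomorphism of indecomposable objects. -/
def indecSetoid : Setoid {X : C // Indecomposable X} where
  r X Y := Nonempty (X.1 ≅ Y.1)
  iseqv := ⟨fun _ => ⟨Iso.refl _⟩, fun ⟨e⟩ => ⟨e.symm⟩, fun ⟨e⟩ ⟨f⟩ => ⟨e.trans f⟩⟩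

/-- The type of isomorphism classes of indecomposable objects. -/
def IndecClass : Type _ := Quotient (indecSetoid C)

/-- `A(C)`: the free abelian group on the isomorphism classes of indecomposable objects. -/
abbrev A : Type _ := IndecClass C →₀ ℤ

variable {C}

/-- A decomposition of an object as a finite direct sum of indecomposable objects. -/
structure Decomposition (X : C) where
  n : ℕ
  summand : Fin n → C
  indec : ∀ i, Indecomposable (summand i)
  iso : X ≅ ⨁ summand

open Classical in
/-- The class in `A(C)` of an object: the sum of the classes of its indecomposable summands. (In a
Krull-Schmidt category a decomposition exists, and the sum does not depend on it.) -/
def cls (X : C) : A C :=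
  if h : Nonempty (Decomposition X) then
    ∑ i, Finsupp.single
      (Quotient.mk (indecSetoid C) ⟨h.some.summand i, h.some.indec i⟩) (1 : ℤ)
  else 0

variable (C)

/-- The submodule of `ℤ[t, t⁻¹] ⊗ A(C)` generated by the `1 ⊗ M[i] - tⁱ ⊗ M`. -/
def shiftRelations : Submodule Zt (Zt ⊗[ℤ] A C) :=
  Submodule.span Zt
    {x | ∃ (M : C) (i : ℤ),
      x = (1 : Zt) ⊗ₜ[ℤ] cls (M⟦i⟧) - (LaurentPolynomial.T i : Zt) ⊗ₜ[ℤ] cls M}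

/-- `A(C)^t`, a module over `ℤ[t, t⁻¹]` in which `t` acts as the shift. -/
abbrev At : Type _ := (Zt ⊗[ℤ] A C) ⧸ shiftRelations C

/-- `A_ℚ(C)^t`, the extension of scalars of `A(C)^t` to `ℚ(t)`. -/
abbrev AQt : Type _ := Qt ⊗[Zt] At C

variable {C}

/-- The class of an object in `A(C)^t`. -/
def clsT (X : C) : At C := (shiftRelations C).mkQ ((1 : Zt) ⊗ₜ[ℤ] cls X)

/-- The class of an object in `A_ℚ(C)^t`. -/
def clsQ (X : C) : AQt C := (1 : Qt) ⊗ₜ[Zt] clsT X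

/-- The Laurent polynomial `∑ tⁱ dim Hom(M, N[i])`. -/
def homPoly (M N : C) : Zt :=
  ∑ᶠ i : ℤ, (Module.finrank k (M ⟶ N⟦i⟧) : ℤ) • (LaurentPolynomial.T i : Zt)

variable (C)

/-- Every object is a finite direct sum of indecomposable objects with local endomorphism rings. -/
def IsKrullSchmidt : Prop :=
  ∀ X : C, ∃ d : Decomposition X, ∀ i, IsLocalRing (End (d.summand i))

/-- `C` is Krull-Schmidt, Hom-finite, and for all objects `M`, `N` there are only finitely many `i`
with `Hom(M, N[i]) ≠ 0`. -/
structure FormHypothesis : Prop where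
  krullSchmidt : IsKrullSchmidt C
  homFinite : ∀ M N : C, FiniteDimensional k (M ⟶ N)
  finite_shifts : ∀ M N : C, {i : ℤ | Nontrivial (M ⟶ N⟦i⟧)}.Finite

/-- Maps `A(C)^t × A(C)^t → ℤ[t, t⁻¹]` that are linear in the first and semilinear (with respect to
`t ↦ t⁻¹`) in the second variable. -/
abbrev SesqT : Type _ := At C →ₗ[Zt] At C →ₛₗ[barZ] Zt

/-- Maps `A_ℚ(C)^t × A_ℚ(C)^t → ℚ(t)` that are linear in the first and semilinear (with respect to
`t ↦ t⁻¹`) in the second variable. -/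
abbrev SesqQ : Type _ := AQt C →ₗ[Qt] AQt C →ₛₗ[barQ] Qt

variable {C}

/-- The sesquilinear form `B` is given on indecomposable objects by `∑ tⁱ dim Hom(M, N[i])`. -/
def IsFormT (B : SesqT C) : Prop :=
  ∀ M N : C, Indecomposable M → Indecomposable N → B (clsT M) (clsT N) = homPoly k M N

/-- The same for a form on `A_ℚ(C)^t`. -/
def IsFormQ (B : SesqQ C) : Prop :=
  ∀ M N : C, Indecomposable M → Indecomposable N →
    B (clsQ M) (clsQ N) = algebraMap Zt Qt (homPoly k M N)

/-- Auslander-Reiten triangles `X → Y → Z → X[1]`: distinguished triangles with `X` and `Z`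
indecomposable, nonzero last map, and such that every morphism to `Z` that is not a split
epimorphism factors through `Y → Z`. -/
structure IsARTriangle (T : Triangle C) : Prop where
  distinguished : T ∈ distTriang C
  indec₁ : Indecomposable T.obj₁
  indec₃ : Indecomposable T.obj₃
  mor₃_ne_zero : T.mor₃ ≠ 0
  factors : ∀ (W : C) (f : W ⟶ T.obj₃), ¬ IsSplitEpi f → ∃ g : W ⟶ T.obj₂, g ≫ T.mor₂ = f

/-- The element `Ẑ = X + Z - Y` of `A(C)^t`. -/
def hatT (T : Triangle C) : At C := clsT T.obj₁ + clsT T.obj₃ - clsT T.obj₂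

/-- The element `Ẑ = X + Z - Y` of `A_ℚ(C)^t`. -/
def hatQ (T : Triangle C) : AQt C := clsQ T.obj₁ + clsQ T.obj₃ - clsQ T.obj₂

end Triangulated

/-! ### Perfect complexes -/

section Perfect

open scoped ZeroObject

variable (Λ : Type*) [Ring Λ]

/-- Finite complexes of finitely generated projective modules. -/
structure IsPerfectComplex (K : CochainComplex (ModuleCat.{w} Λ) ℤ) : Prop where
  finite : ∀ n, Module.Finite Λ (K.X n)
  projective : ∀ n, Module.Projective Λ (K.X n)
  bounded : ∃ a b : ℤ, ∀ n, (n < a ∨ b < n) → IsZero (K.X n)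

/-- The objects of the homotopy category given by perfect complexes. -/
def perfectProp : ObjectProperty (HomotopyCategory (ModuleCat.{w} Λ) (ComplexShape.up ℤ)) :=
  fun X => IsPerfectComplex Λ X.as

variable {Λ}

theorem IsPerfectComplex.shift {K : CochainComplex (ModuleCat.{w} Λ) ℤ}
    (h : IsPerfectComplex Λ K) (n : ℤ) : IsPerfectComplex Λ (K⟦n⟧) := by
  obtain ⟨a, b, hab⟩ := h.bounded
  exact ⟨fun i => h.finite (i + n), fun i => h.projective (i + n),
    a - n, b - n, fun i hi => hab (i + n) (by omega)⟩

theorem IsPerfectComplex.mappingCone {K L : CochainComplex (ModuleCat.{w} Λ) ℤ} (f : K ⟶ L)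
    (hK : IsPerfectComplex Λ K) (hL : IsPerfectComplex Λ L) :
    IsPerfectComplex Λ (CochainComplex.mappingCone f) := by
  have e : ∀ n : ℤ, Nonempty ((CochainComplex.mappingCone f).X n ≅
      ModuleCat.of Λ (K.X (n + 1) × L.X n)) := fun n =>
    ⟨(HomologicalComplex.homotopyCofiber.XIsoBiprod f n (n + 1) (by simp)) ≪≫
      ModuleCat.biprodIsoProd _ _⟩
  obtain ⟨a, b, hab⟩ := hK.bounded
  obtain ⟨a', b', hab'⟩ := hL.bounded
  refine ⟨fun n => ?_, fun n => ?_, min (a - 1) a', max b b', fun n hn => ?_⟩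
  · have := hK.finite (n + 1)
    have := hL.finite n
    exact Module.Finite.equiv (e n).some.toLinearEquiv.symm
  · have := hK.projective (n + 1)
    have := hL.projective n
    exact Module.Projective.of_equiv (e n).some.toLinearEquiv.symm
  · rw [CochainComplex.mappingCone.isZero_X_iff]
    exact ⟨hab _ (by omega), hab' _ (by omega)⟩

variable (Λ)

instance : (perfectProp.{w} Λ).ContainsZero where
  exists_zero :=
    ⟨(HomotopyCategory.quotient _ _).obj 0, Functor.map_isZero _ (isZero_zero _), by
      have hz : ∀ n, IsZero ((0 : CochainComplex (ModuleCat.{w} Λ) ℤ).X n) := fun n =>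
        (HomologicalComplex.eval (ModuleCat.{w} Λ) (ComplexShape.up ℤ) n).map_isZero (isZero_zero _)
      have hs : ∀ n, Subsingleton ((0 : CochainComplex (ModuleCat.{w} Λ) ℤ).X n) := fun n =>
        ModuleCat.subsingleton_of_isZero (hz n)
      have hP : IsPerfectComplex Λ (0 : CochainComplex (ModuleCat.{w} Λ) ℤ) :=
        ⟨fun n => by have := hs n; infer_instance, fun n => by have := hs n; infer_instance,
          0, 0, fun n _ => hz n⟩
      exact hP⟩

instance : (perfectProp.{w} Λ).IsStableUnderShift ℤ where
  isStableUnderShiftBy n :=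
    { le_shift := fun X hK => by
        obtain ⟨K : CochainComplex _ _, rfl⟩ := X.quotient_obj_surjective
        rw [ObjectProperty.prop_shift_iff, HomotopyCategory.shift_quotient_obj]
        exact IsPerfectComplex.shift hK n }

instance : (perfectProp.{w} Λ).IsTriangulatedClosed₃ where
  ext₃' T hT h₁ h₂ := by
    obtain ⟨f : T.obj₁.as ⟶ T.obj₂.as, hf⟩ :=
      (HomotopyCategory.quotient _ _).map_surjective T.mor₁
    refine ⟨_, IsPerfectComplex.mappingCone f h₁ h₂,
      ⟨Triangle.π₃.mapIso (isoTriangleOfIso₁₂ T _ hT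
        (HomotopyCategory.mappingCone_triangleh_distinguished f)
        (Iso.refl _) (Iso.refl _) ?_)⟩⟩
    erw [Category.comp_id, Category.id_comp]
    exact hf.symm

instance : (perfectProp.{w} Λ).IsTriangulated where
  toIsTriangulatedClosed₂ := .of_isTriangulatedClosed₃

/-- `D^b(Λ-proj)`: the homotopy category of finite complexes of finitely generated projective
`Λ`-modules, as a full triangulated subcategory of the homotopy category of all complexes. -/
abbrev Perf : Type _ := (perfectProp.{w} Λ).FullSubcategory

instance (k : Type*) [Field k] [Algebra k Λ] (n : ℤ) :
    (shiftFunctor (Perf.{w} Λ) n).Linear k where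
  map_smul f r := by
    have : ((perfectProp.{w} Λ).ι ⋙ shiftFunctor (HomotopyCategory _ _) n).Linear k :=
      inferInstance
    have : (shiftFunctor (Perf.{w} Λ) n ⋙ (perfectProp.{w} Λ).ι).Linear k :=
      Functor.linear_of_iso k ((perfectProp.{w} Λ).ι.commShiftIso n).symm
    exact (perfectProp.{w} Λ).ι.map_injective
      ((Functor.map_smul (shiftFunctor (Perf.{w} Λ) n ⋙ (perfectProp.{w} Λ).ι) r f).trans
        (Functor.map_smul (perfectProp.{w} Λ).ι r _).symm)

variable {Λ}

/-- A perfect complex as an object of `D^b(Λ-proj)`. -/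
def Perf.of (K : CochainComplex (ModuleCat.{w} Λ) ℤ) (h : IsPerfectComplex Λ K) : Perf.{w} Λ :=
  ⟨(HomotopyCategory.quotient _ _).obj K, h⟩

end Perfect

/-- Symmetric algebras: finite dimensional algebras with a nondegenerate symmetrizing form. -/
structure IsSymmetricAlgebra (k Λ : Type*) [Field k] [Ring Λ] [Algebra k Λ] : Prop where
  finiteDimensional : FiniteDimensional k Λ
  exists_form : ∃ l : Λ →ₗ[k] k, (∀ a b, l (a * b) = l (b * a)) ∧
    ∀ a, (∀ b, l (a * b) = 0) → a = 0

/-! ### Complexes of representations of a finite group -/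

section Group

variable {k : Type u} [Field k] {G : Type v} [Group G]

instance : (Rep.toModuleMonoidAlgebra.{u} (k := k) (G := G)).Additive where
  map_add := rfl

/-- A complex of representations of `G`, viewed as a complex of modules over `kG`. -/
def toModuleComplex (K : CochainComplex (Rep.{u} k G) ℤ) :
    CochainComplex (ModuleCat.{u} (MonoidAlgebra k G)) ℤ :=
  ((Rep.toModuleMonoidAlgebra.{u} (k := k) (G := G)).mapHomologicalComplex _).obj K

/-- Finite complexes of finite dimensional representations. -/
structure IsFiniteRepComplex (K : CochainComplex (Rep.{u} k G) ℤ) : Prop where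
  finite : ∀ n, FiniteDimensional k (K.X n)
  bounded : ∃ a b : ℤ, ∀ n, (n < a ∨ b < n) → IsZero (K.X n)

/-- Finite complexes of finitely generated projective modules for `kG`, given as complexes of
representations. -/
def IsPerfectRepComplex (K : CochainComplex (Rep.{u} k G) ℤ) : Prop :=
  IsPerfectComplex (MonoidAlgebra k G) (toModuleComplex K)

/-- The object of `D^b(kG-proj)` given by a perfect complex of representations. -/
def perfOfRep (K : CochainComplex (Rep.{u} k G) ℤ) (h : IsPerfectRepComplex K) :
    Perf.{u} (MonoidAlgebra k G) :=
  Perf.of (toModuleComplex K) h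

/-- The transpose of a morphism of representations, between the contragredient representations. -/
def dualMap {V W : Rep.{u} k G} (f : V ⟶ W) :
    Rep.of (Representation.dual W.ρ) ⟶ Rep.of (Representation.dual V.ρ) :=
  Rep.ofHom ⟨f.hom.toLinearMap.dualMap, by
    intro g
    ext φ x
    exact congrArg φ (Rep.hom_comm_apply f g⁻¹ x).symm⟩

theorem dualMap_zero (V W : Rep.{u} k G) : dualMap (0 : V ⟶ W) = 0 := by
  ext φ x
  exact map_zero φ

theorem dualMap_comp {V W Z : Rep.{u} k G} (f : V ⟶ W) (g : W ⟶ Z) :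
    dualMap (f ≫ g) = dualMap g ≫ dualMap f := rfl

/-- The dual complex `U*`: in degree `n` it is the contragredient of the degree `-n` part of `U`,
and its differential `dⁿ` is `(-1)ⁿ⁺¹` times the transpose of `d⁻ⁿ⁻¹`. -/
def dualComplex (U : CochainComplex (Rep.{u} k G) ℤ) : CochainComplex (Rep.{u} k G) ℤ where
  X n := Rep.of (Representation.dual (U.X (-n)).ρ)
  d i j := (i + 1).negOnePow • dualMap (U.d (-j) (-i))
  shape i j hij := by
    rw [U.shape _ _ (fun h => hij (by simp only [ComplexShape.up_Rel] at h ⊢; omega)),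
      dualMap_zero, smul_zero]
  d_comp_d' i j l _ _ := by
    rw [Linear.units_smul_comp, Linear.comp_units_smul, ← dualMap_comp, U.d_comp_d, dualMap_zero,
      smul_zero, smul_zero]

/-- The tensor product over `k` of complexes of representations, with diagonal action of `G`. -/
def tensorComplex (K L : CochainComplex (Rep.{u} k G) ℤ) : CochainComplex (Rep.{u} k G) ℤ :=
  HomologicalComplex.tensorObj K L

end Group

end ARForm

end

open ARForm

set_option linter.unusedSectionVars false

noncomputable section

namespace ARForm

/-! Write h(M, N) for `homPoly k M N`. It depends only on isomorphism classes, is additive in both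
variables, and a shift multiplies it by a power of t in the first variable and by the inverse power
in the second. The matrix of h on indecomposables therefore defines a sesquilinear form that kills
the shift relations. Uniqueness holds because indecomposables span, and the form over ℚ(t) is the
base change.

For an Auslander–Reiten triangle, the long exact sequence of Hom(W, -) shows that the dimensions for
X and Z minus that for Y equal the ranks of the connecting maps Hom(W, Z) → Hom(W, X[1]) for W and
for W[1]. Such a map kills everything that is not a split epimorphism. For indecomposable W it is
thus zero unless W ≅ Z; then its rank is 1, since End(Z) is local with residue field k. An
indecomposable is not isomorphic to a nontrivial shift of itself, so only two coefficients survive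
and give 1 + t. The other variable is dual, once the triangle is known to have the lifting property
on the left as well (`FormHypothesis.connectingFrom_eq_zero`).

For perfect complexes everything is read off the Hom complex: dim Hom(K, L[i]) is the dimension of
the i-cochains minus the ranks of the outgoing and incoming differentials
(`Perf.finrank_hom_shift`). Over a symmetric algebra the alternating trace of compositions pairs the
i-cochains K → L perfectly with the (-i)-cochains L → K and makes the differentials adjoint up to
sign. Dimensions and ranks then match, and h is Hermitian. Krull–Schmidt comes from splitting
idempotent chain maps.

For kG the symmetrizing form is the coefficient of 1. Higman's criterion shows that tensor products
and duals of perfect complexes are perfect. Transposition and tensor-hom adjunction are isomorphisms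
of Hom complexes (`dualCochain_δ`, `tensorHomCochain_δ`), so they preserve h; the last identity then
follows from the Hermitian property. -/

/-! ### Coefficient rings and general sesquilinear forms. -/

theorem barZ_barZ (p : Zt) : barZ (barZ p) = p :=
  LaurentPolynomial.involutive_invert p

theorem barQ_algebraMap (p : Zt) : barQ (algebraMap Zt Qt p) = algebraMap Zt Qt (barZ p) := by
  have h : barQ.comp (algebraMap Zt Qt) = (algebraMap Zt Qt).comp barZ := by
    have hT : ∀ n : ℤ, algebraMap Zt Qt (LaurentPolynomial.T n) = tQ ^ n := by
      intro n
      change LaurentPolynomial.eval₂ (Int.castRingHom Qt) tUnit (LaurentPolynomial.T n) = _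
      simp [tUnit]
    refine RingHom.ext fun q => ?_
    induction q using LaurentPolynomial.induction_on' with
    | add a b ha hb => rw [map_add, map_add, ha, hb]
    | C_mul_T n a =>
      rw [map_mul, map_mul, eq_intCast LaurentPolynomial.C a, map_intCast, map_intCast]
      simp only [RingHom.comp_apply, barZ_t, hT, map_zpow₀, barQ_t, zpow_neg, inv_zpow]
  exact RingHom.congr_fun h p

/-- A ring homomorphism out of ℚ(t) is determined on ℚ[t], hence by its value at t, because
homomorphisms out of ℚ are unique. -/
theorem barQ_barQ (q : Qt) : barQ (barQ q) = q := by
  have h : barQ.comp barQ = RingHom.id Qt := by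
    refine IsFractionRing.ringHom_ext (A := Polynomial ℚ) fun p => ?_
    have : (barQ.comp barQ).comp (algebraMap (Polynomial ℚ) Qt) =
        (RingHom.id Qt).comp (algebraMap (Polynomial ℚ) Qt) := by
      refine Polynomial.ringHom_ext (fun a => ?_) ?_
      · exact RingHom.congr_fun (RingHom.ext_rat ((((barQ.comp barQ).comp
          (algebraMap (Polynomial ℚ) Qt))).comp Polynomial.C) (((RingHom.id Qt).comp
          (algebraMap (Polynomial ℚ) Qt)).comp Polynomial.C)) a
      · simp [RatFunc.algebraMap_X, barQ_t]
    exact RingHom.congr_fun this p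
  exact RingHom.congr_fun h q

/-- `t ↦ t⁻¹` as a semilinear map. -/
def barSemiZ : Zt →ₛₗ[barZ] Zt where
  toFun := barZ
  map_add' := map_add _
  map_smul' _ _ := map_mul _ _ _

/-- `t ↦ t⁻¹` on `ℚ(t)` as a semilinear map. -/
def barSemiQ : Qt →ₛₗ[barQ] Qt where
  toFun := barQ
  map_add' := map_add _
  map_smul' _ _ := map_mul _ _ _

/-- Descent of a sesquilinear map to a quotient module. -/
def sesqDescend {R M : Type*} [CommRing R] {σ : R →+* R} [AddCommGroup M] [Module R M]
    (p : Submodule R M) (Ψ : M →ₗ[R] M →ₛₗ[σ] R)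
    (h₁ : ∀ x ∈ p, ∀ y, Ψ x y = 0) (h₂ : ∀ x, ∀ y ∈ p, Ψ x y = 0) :
    (M ⧸ p) →ₗ[R] (M ⧸ p) →ₛₗ[σ] R :=
  p.liftQ
    { toFun := fun x => p.liftQ (Ψ x) (fun y hy => h₂ x y hy)
      map_add' := fun x y => by
        refine LinearMap.ext fun z => ?_
        obtain ⟨z, rfl⟩ := p.mkQ_surjective z
        exact congrArg (fun f : M →ₛₗ[σ] R => f z) (map_add Ψ x y)
      map_smul' := fun a x => by
        refine LinearMap.ext fun z => ?_
        obtain ⟨z, rfl⟩ := p.mkQ_surjective z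
        exact congrArg (fun f : M →ₛₗ[σ] R => f z) (map_smul Ψ a x) }
    (fun x hx => by
      refine LinearMap.ext fun y => ?_
      obtain ⟨y, rfl⟩ := p.mkQ_surjective y
      exact h₁ x hx y)

/-- The sesquilinear form on `ℤ[t, t⁻¹] ⊗ ℤ^(S)` with a given matrix. -/
def sesqOfMatrix {S : Type*} (h : S → S → Zt) :
    (Zt ⊗[ℤ] (S →₀ ℤ)) →ₗ[Zt] (Zt ⊗[ℤ] (S →₀ ℤ)) →ₛₗ[barZ] Zt :=
  LinearMap.liftBaseChange Zt (Finsupp.linearCombination ℤ fun c =>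
    -- A linear map with barred entries followed by bar is semilinear with the entries `h c d`
    -- themselves.
    barSemiZ.comp (LinearMap.liftBaseChange Zt
      (Finsupp.linearCombination ℤ fun d => barZ (h c d))))

theorem sesqOfMatrix_single {S : Type*} (h : S → S → Zt) (c d : S) :
    sesqOfMatrix h (1 ⊗ₜ Finsupp.single c 1) (1 ⊗ₜ Finsupp.single d 1) = h c d := by
  simp [sesqOfMatrix, barSemiZ, barZ_barZ]

/-- Extension of scalars of a sesquilinear form from `ℤ[t, t⁻¹]` to `ℚ(t)`. -/
def sesqBaseChange {M : Type*} [AddCommGroup M] [Module Zt M] (B : M →ₗ[Zt] M →ₛₗ[barZ] Zt) :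
    (Qt ⊗[Zt] M) →ₗ[Qt] (Qt ⊗[Zt] M) →ₛₗ[barQ] Qt :=
  LinearMap.liftBaseChange Qt
    { toFun := fun a => barSemiQ.comp (LinearMap.liftBaseChange Qt
        { toFun := fun b => barQ (algebraMap Zt Qt (B a b))
          map_add' := fun x y => by simp
          map_smul' := fun p x => by
            simp [barQ_algebraMap, barZ_barZ, Algebra.smul_def] } )
      map_add' := fun x y => by
        refine LinearMap.ext fun z => ?_
        induction z with
        | zero => simp
        | add u v hu hv => rw [map_add, hu, hv, map_add]
        | tmul q m => simp [barSemiQ, barQ_algebraMap, barZ_barZ, mul_add]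
      map_smul' := fun p x => by
        refine LinearMap.ext fun z => ?_
        induction z with
        | zero => simp
        | add u v hu hv => rw [map_add, hu, hv, map_add]
        | tmul q m =>
          simp [barSemiQ, barQ_algebraMap, barZ_barZ, Algebra.smul_def]
          ring }

theorem sesqBaseChange_tmul {M : Type*} [AddCommGroup M] [Module Zt M]
    (B : M →ₗ[Zt] M →ₛₗ[barZ] Zt) (x y : M) :
    sesqBaseChange B (1 ⊗ₜ x) (1 ⊗ₜ y) = algebraMap Zt Qt (B x y) := by
  simp [sesqBaseChange, barSemiQ, barQ_barQ]

/-- Sesquilinear forms over `ℚ(t)` agree if they agree on a `ℤ[t, t⁻¹]`-form of the module. -/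
theorem sesqQ_ext {M : Type*} [AddCommGroup M] [Module Zt M]
    {B B' : (Qt ⊗[Zt] M) →ₗ[Qt] (Qt ⊗[Zt] M) →ₛₗ[barQ] Qt}
    (h : ∀ x y : M, B (1 ⊗ₜ x) (1 ⊗ₜ y) = B' (1 ⊗ₜ x) (1 ⊗ₜ y)) : B = B' := by
  have key : ∀ (q : Qt) (m : M), q ⊗ₜ[Zt] m = q • ((1 : Qt) ⊗ₜ[Zt] m) := fun q m => by
    simp [TensorProduct.smul_tmul']
  refine LinearMap.ext fun a => LinearMap.ext fun b => ?_
  induction a with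
  | zero => simp
  | add u v hu hv => simp [hu, hv]
  | tmul q m =>
    induction b with
    | zero => simp
    | add u v hu hv => simp [hu, hv]
    | tmul q' m' =>
      rw [key q m, key q' m', LinearMap.map_smul, LinearMap.map_smul, LinearMap.smul_apply,
        LinearMap.smul_apply, LinearMap.map_smulₛₗ, LinearMap.map_smulₛₗ, h]

/-! ### Biproducts, indecomposable objects and local endomorphism rings. -/

section Biproducts

variable {C : Type*} [Category* C] [Preadditive C]

/-- Two complementary retracts of an object give a biproduct decomposition. -/
def isoBiprodOfTotal [HasBinaryBiproducts C] {X Y Z : C} (i₁ : Y ⟶ X) (p₁ : X ⟶ Y) (i₂ : Z ⟶ X)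
    (p₂ : X ⟶ Z) (h₁ : i₁ ≫ p₁ = 𝟙 Y) (h₂ : i₂ ≫ p₂ = 𝟙 Z) (h : p₁ ≫ i₁ + p₂ ≫ i₂ = 𝟙 X) :
    X ≅ Y ⊞ Z where
  hom := biprod.lift p₁ p₂
  inv := biprod.desc i₁ i₂
  hom_inv_id := by simpa using h
  inv_hom_id := by
    -- Sandwiching the total relation between `i₁` and `p₂` gives twice the cross term on one side
    -- and once on the other.
    have h₁₂ : i₁ ≫ p₂ = 0 := by
      have := congrArg (fun f => i₁ ≫ f ≫ p₂) h
      simp only [Preadditive.add_comp, Preadditive.comp_add, Category.assoc, h₂,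
        Category.comp_id, Category.id_comp] at this
      simpa [reassoc_of% h₁] using this
    have h₂₁ : i₂ ≫ p₁ = 0 := by
      have := congrArg (fun f => i₂ ≫ f ≫ p₁) h
      simp only [Preadditive.add_comp, Preadditive.comp_add, Category.assoc, h₁,
        Category.comp_id, Category.id_comp] at this
      simpa [reassoc_of% h₂] using this
    ext <;> simp [h₁, h₂, h₁₂, h₂₁]

/-- Conjugation by an isomorphism, as an isomorphism of endomorphism rings. -/
def endRingEquiv {X Y : C} (e : X ≅ Y) : End X ≃+* End Y :=
  { e.conj with
    map_add' := fun f g => by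
      change e.inv ≫ (show X ⟶ X from f + g) ≫ e.hom = e.inv ≫ f ≫ e.hom + e.inv ≫ g ≫ e.hom
      rw [← Preadditive.comp_add, ← Preadditive.add_comp] }

theorem isLocalRing_of_ringEquiv {R S : Type*} [Ring R] [Ring S] (e : R ≃+* S)
    (h : IsLocalRing R) : IsLocalRing S where
  exists_pair_ne := e.symm.toEquiv.nontrivial.exists_pair_ne
  isUnit_or_isUnit_of_add_one {a b} hab := by
    have := h.isUnit_or_isUnit_of_add_one (a := e.symm a) (b := e.symm b)
      (by rw [← map_add, hab, map_one])
    simpa using this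

theorem isLocalRing_end_of_iso {X Y : C} (e : X ≅ Y) (h : IsLocalRing (End X)) :
    IsLocalRing (End Y) :=
  isLocalRing_of_ringEquiv (endRingEquiv e) h

theorem isZero_iff_subsingleton_end {X : C} : IsZero X ↔ Subsingleton (End X) :=
  ⟨fun h => ⟨fun f g => h.eq_of_src f g⟩,
    fun h => (IsZero.iff_id_eq_zero X).2 (h.elim (𝟙 X : End X) (0 : X ⟶ X))⟩

/-- An idempotent of a local ring is trivial. -/
theorem eq_zero_or_eq_one_of_isIdempotentElem {R : Type*} [Ring R] [IsLocalRing R] {e : R}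
    (he : IsIdempotentElem e) : e = 0 ∨ e = 1 := by
  rcases IsLocalRing.isUnit_or_isUnit_of_add_one (a := e) (b := 1 - e) (by simp) with h | h
  · right
    exact h.mul_left_cancel (by rw [he.eq, mul_one])
  · left
    have : (1 - e) * e = (1 - e) * 0 := by rw [sub_mul, he.eq]; simp
    exact h.mul_left_cancel this

/-- A decomposition gives the idempotent projecting to the first summand; in a local ring it is 0 or
1, so one summand vanishes. -/
theorem indecomposable_of_isLocalRing_end [HasBinaryBiproducts C] {X : C}
    (h : IsLocalRing (End X)) : Indecomposable X := by
  refine ⟨fun hX => ?_, fun Y Z e => ?_⟩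
  · have := isZero_iff_subsingleton_end.1 hX
    exact not_subsingleton (End X) this
  · have := isLocalRing_end_of_iso e h
    have hi : IsIdempotentElem (M := End (Y ⊞ Z)) (biprod.fst ≫ biprod.inl) := by
      change (biprod.fst ≫ biprod.inl) ≫ (biprod.fst ≫ biprod.inl) = _
      simp
    rcases eq_zero_or_eq_one_of_isIdempotentElem hi with h0 | h1
    · left
      rw [IsZero.iff_id_eq_zero]
      have h0 : (biprod.fst ≫ biprod.inl : Y ⊞ Z ⟶ Y ⊞ Z) = 0 := h0
      simpa using congrArg (fun f => biprod.inl ≫ f ≫ biprod.fst) h0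
    · right
      rw [IsZero.iff_id_eq_zero]
      have h1 : (biprod.fst ≫ biprod.inl : Y ⊞ Z ⟶ Y ⊞ Z) = 𝟙 _ := h1
      simpa using (congrArg (fun f => biprod.inr ≫ f ≫ biprod.snd) h1).symm

/-- Splitting off the first summand of a finite biproduct. -/
def biproductFinSuccIso [HasBinaryBiproducts C] [HasFiniteBiproducts C] {n : ℕ} (f : Fin (n + 1) → C) :
    ⨁ f ≅ f 0 ⊞ ⨁ fun j : Fin n => f j.succ :=
  isoBiprodOfTotal (biproduct.ι f 0) (biproduct.π f 0)
    (biproduct.desc fun j => biproduct.ι f j.succ) (biproduct.lift fun j => biproduct.π f j.succ)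
    (by simp)
    (by
      ext i j
      by_cases h : j = i
      · subst h; simp
      · simp [biproduct.ι_π_ne _ h, biproduct.ι_π_ne f (fun h' => h (Fin.succ_injective _ h'))])
    (by
      rw [← biproduct.total, Fin.sum_univ_succ, biproduct.lift_desc])

/-- The first summand is nonzero, so indecomposability forces the remaining ones to vanish and X is
that summand. -/
theorem isLocalRing_end_of_biproduct [HasBinaryBiproducts C] [HasFiniteBiproducts C] {n : ℕ} {X : C}
    (hX : Indecomposable X) (f : Fin n → C) (hf : ∀ i, IsLocalRing (End (f i)))
    (e : X ≅ ⨁ f) : IsLocalRing (End X) := by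
  cases n with
  | zero =>
    refine (hX.1 (IsZero.of_iso ?_ e)).elim
    rw [IsZero.iff_id_eq_zero]
    exact biproduct.hom_ext _ _ fun j => j.elim0
  | succ n =>
    have e' := e ≪≫ biproductFinSuccIso f
    rcases hX.2 _ _ e' with h | h
    · exact ((indecomposable_of_isLocalRing_end (hf 0)).1 h).elim
    · refine isLocalRing_end_of_iso (e' ≪≫ ?_).symm (hf 0)
      exact
        { hom := biprod.fst
          inv := biprod.inl
          hom_inv_id := by
            refine biprod.hom_ext' _ _ (by simp) (h.eq_of_src _ _)
          inv_hom_id := by simp }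

end Biproducts

/-! ### The Hom polynomial and the two sesquilinear forms. -/

section HomPoly

variable {k : Type*} [Field k]
variable {C : Type*} [Category* C] [Preadditive C] [HasZeroObject C] [HasShift C ℤ]
  [∀ n : ℤ, (shiftFunctor C n).Additive] [Pretriangulated C] [Linear k C]

theorem FormHypothesis.isLocalRing_end (h : FormHypothesis k C) {X : C} (hX : Indecomposable X) :
    IsLocalRing (End X) := by
  obtain ⟨d, hd⟩ := h.krullSchmidt X
  exact isLocalRing_end_of_biproduct hX d.summand hd d.iso

/-- Hom spaces vanish for all but finitely many shifts, in terms of dimensions. -/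
theorem FormHypothesis.finite_support (h : FormHypothesis k C) (M N : C) :
    (Function.support fun i : ℤ => Module.finrank k (M ⟶ N⟦i⟧)).Finite := by
  refine (h.finite_shifts M N).subset fun i hi => ?_
  have := h.homFinite M (N⟦i⟧)
  exact Module.finrank_pos_iff.1 (Nat.pos_of_ne_zero hi)

theorem FormHypothesis.coeff_homPoly (h : FormHypothesis k C) (M N : C) (i : ℤ) :
    (homPoly k M N).coeff i = Module.finrank k (M ⟶ N⟦i⟧) := by
  -- Finiteness of the support matters: otherwise the `finsum` would have its default value 0.
  have hs : (Function.support fun i : ℤ =>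
      (Module.finrank k (M ⟶ N⟦i⟧) : ℤ) • (LaurentPolynomial.T i : Zt)).Finite := by
    refine (h.finite_support M N).subset fun i hi => ?_
    rw [Function.mem_support] at hi ⊢
    exact fun h0 => hi (by simp [h0])
  rw [homPoly, finsum_eq_sum _ hs]
  simp only [AddMonoidAlgebra.coeff_sum, Finsupp.finsetSum_apply, AddMonoidAlgebra.coeff_smul,
    Finsupp.smul_apply, LaurentPolynomial.T_apply, smul_eq_mul, mul_ite, mul_one, mul_zero,
    Finset.sum_ite_eq', Set.Finite.mem_toFinset, Function.mem_support]
  split_ifs with hi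
  · rfl
  · by_contra h0
    refine hi fun h1 => h0 ?_
    have := congrArg (fun p : Zt => p.coeff i) h1
    rw [AddMonoidAlgebra.coeff_smul] at this
    simpa using this.symm

end HomPoly

section HomPoly

variable {k : Type*} [Field k]
variable {C : Type*} [Category* C] [Preadditive C] [HasZeroObject C] [HasShift C ℤ]
  [∀ n : ℤ, (shiftFunctor C n).Additive] [Pretriangulated C] [Linear k C]

theorem homPoly_congr {M M' N N' : C} (e : M ≅ M') (e' : N ≅ N') :
    homPoly k M N = homPoly k M' N' := by
  refine finsum_congr fun i => ?_
  rw [(Linear.homCongr k e ((shiftFunctor C i).mapIso e')).finrank_eq]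

/-- Morphisms from a finite biproduct are families of morphisms. -/
def fromBiproductEquiv {n : ℕ} (f : Fin n → C) (N : C) : (⨁ f ⟶ N) ≃ₗ[k] ∀ j, f j ⟶ N where
  toFun g j := biproduct.ι f j ≫ g
  map_add' g h := by ext; simp
  map_smul' a g := by ext; simp
  invFun g := biproduct.desc g
  left_inv g := by ext; simp
  right_inv g := by ext; simp

/-- Morphisms to a shift of a finite biproduct are families of morphisms. -/
def toShiftBiproductEquiv {n : ℕ} (f : Fin n → C) (M : C) (i : ℤ) :
    (M ⟶ (⨁ f)⟦i⟧) ≃ₗ[k] ∀ j, M ⟶ (f j)⟦i⟧ where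
  toFun g j := g ≫ (biproduct.π f j)⟦i⟧'
  map_add' g h := by ext; simp
  map_smul' a g := by ext; simp
  invFun g := ∑ j, g j ≫ (biproduct.ι f j)⟦i⟧'
  left_inv g := by
    simp only [Category.assoc, ← Functor.map_comp, ← Preadditive.comp_sum, ← Functor.map_sum]
    rw [biproduct.total]
    simp
  right_inv g := by
    ext j
    change (∑ j, g j ≫ (biproduct.ι f j)⟦i⟧') ≫ (biproduct.π f j)⟦i⟧' = g j
    rw [Preadditive.sum_comp, Finset.sum_eq_single j]
    · simp [← Functor.map_comp]
    · intro l _ hl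
      rw [Category.assoc, ← Functor.map_comp, biproduct.ι_π_ne _ hl]
      simp
    · simp

theorem isZero_biproduct_fin_zero (f : Fin 0 → C) : IsZero (⨁ f) := by
  rw [IsZero.iff_id_eq_zero]
  exact biproduct.hom_ext _ _ fun j => j.elim0

theorem isZero_of_isZero_biproduct {n : ℕ} {f : Fin n → C} (hf : IsZero (⨁ f)) (j : Fin n) :
    IsZero (f j) := by
  rw [IsZero.iff_id_eq_zero, ← biproduct.ι_π_self, hf.eq_zero_of_src (biproduct.π f j), comp_zero]

theorem FormHypothesis.homPoly_biproduct_left (h : FormHypothesis k C) {n : ℕ} (f : Fin n → C)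
    (N : C) :
    homPoly k (⨁ f) N = ∑ j, homPoly k (f j) N := by
  ext i
  have := fun M : C => h.homFinite M (N⟦i⟧)
  simp only [AddMonoidAlgebra.coeff_sum, Finsupp.finsetSum_apply, h.coeff_homPoly]
  rw [(fromBiproductEquiv (k := k) f (N⟦i⟧)).finrank_eq, Module.finrank_pi_fintype]
  simp

theorem FormHypothesis.homPoly_biproduct_right (h : FormHypothesis k C) {n : ℕ} (f : Fin n → C)
    (M : C) :
    homPoly k M (⨁ f) = ∑ j, homPoly k M (f j) := by
  ext i
  have := fun N : C => h.homFinite M (N⟦i⟧)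
  simp only [AddMonoidAlgebra.coeff_sum, Finsupp.finsetSum_apply, h.coeff_homPoly]
  rw [(toShiftBiproductEquiv (k := k) f M i).finrank_eq, Module.finrank_pi_fintype]
  simp

theorem coeff_T_mul (p : Zt) (a i : ℤ) : (LaurentPolynomial.T a * p).coeff i = p.coeff (i - a) := by
  rw [LaurentPolynomial.T, AddMonoidAlgebra.coeff_single_mul_eq_mul_coeff (i - a)
    (fun m _ => by omega), one_mul]

variable [∀ n : ℤ, (shiftFunctor C n).Linear k]

theorem finrank_shift_left (M N : C) (a i : ℤ) :
    Module.finrank k (M⟦a⟧ ⟶ N⟦i⟧) = Module.finrank k (M ⟶ N⟦i - a⟧) := by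
  rw [(Linear.homCongr k (Iso.refl (M⟦a⟧))
    ((shiftFunctorAdd' C (i - a) a i (by omega)).app N)).finrank_eq]
  exact (LinearEquiv.ofBijective ((shiftFunctor C a).mapLinearMap k (X := M) (Y := N⟦i - a⟧))
    ⟨(shiftFunctor C a).map_injective, (shiftFunctor C a).map_surjective⟩).finrank_eq.symm

theorem FormHypothesis.homPoly_shift_left (h : FormHypothesis k C) (M N : C) (a : ℤ) :
    homPoly k (M⟦a⟧) N = LaurentPolynomial.T a * homPoly k M N := by
  ext i
  rw [coeff_T_mul, h.coeff_homPoly, h.coeff_homPoly, finrank_shift_left]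

/-- The power of t that appears is the bar of the one by which the shift acts, which is why the form
must be semilinear in the second variable. -/
theorem FormHypothesis.homPoly_shift_right (h : FormHypothesis k C) (M N : C) (a : ℤ) :
    homPoly k M (N⟦a⟧) = LaurentPolynomial.T (-a) * homPoly k M N := by
  ext i
  rw [coeff_T_mul, h.coeff_homPoly, h.coeff_homPoly, (Linear.homCongr k (Iso.refl M)
    ((shiftFunctorAdd' C a i (i - -a) (by omega)).app N)).finrank_eq]
  rfl

/-- The isomorphism class of an indecomposable object. -/
def indecClass (X : C) (hX : Indecomposable X) : IndecClass C :=
  Quotient.mk (indecSetoid C) ⟨X, hX⟩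

/-- The class of an object is the sum of the classes of the summands in some decomposition. -/
theorem FormHypothesis.exists_decomposition (h : FormHypothesis k C) (X : C) : ∃ d : Decomposition
    X,
    cls X = ∑ i, Finsupp.single (indecClass (d.summand i) (d.indec i)) (1 : ℤ) := by
  obtain ⟨d, -⟩ := h.krullSchmidt X
  have hX : Nonempty (Decomposition X) := ⟨d⟩
  exact ⟨hX.some, by rw [cls, dif_pos hX]; rfl⟩

/-- Whichever decomposition `cls` has chosen, for an indecomposable object it has exactly one
summand: splitting off the first leaves zero. -/
theorem FormHypothesis.cls_indec (h : FormHypothesis k C) {X : C} (hX : Indecomposable X) :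
    cls X = Finsupp.single (indecClass X hX) (1 : ℤ) := by
  obtain ⟨d, hd⟩ := h.exists_decomposition X
  rw [hd]
  obtain ⟨n, s, hs, e⟩ := d
  dsimp only
  cases n with
  | zero => exact (hX.1 ((isZero_biproduct_fin_zero s).of_iso e)).elim
  | succ n =>
    have e' := e ≪≫ biproductFinSuccIso s
    have hr : IsZero (⨁ fun j : Fin n => s j.succ) :=
      (hX.2 _ _ e').resolve_left (hs 0).1
    cases n with
    | succ n => exact ((hs (Fin.succ 0)).1 (isZero_of_isZero_biproduct hr 0)).elim
    | zero =>
      rw [Fin.sum_univ_one]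
      congr 1
      refine Quotient.sound ⟨(e' ≪≫ ?_).symm⟩
      exact
        { hom := biprod.fst
          inv := biprod.inl
          hom_inv_id := biprod.hom_ext' _ _ (by simp) (hr.eq_of_src _ _)
          inv_hom_id := by simp }

variable (k) in
/-- The matrix of the form on indecomposable objects. -/
def homPolyClass (c d : IndecClass C) : Zt :=
  Quotient.liftOn₂ c d (fun M N => homPoly k M.1 N.1)
    fun _ _ _ _ ⟨e⟩ ⟨e'⟩ => homPoly_congr e e'

/-- The Hom polynomial is additive along any decomposition, so the choice made in `cls` is harmless
and uniqueness of decompositions is not needed. -/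
theorem FormHypothesis.sesqOfMatrix_cls (h : FormHypothesis k C) (M N : C) :
    sesqOfMatrix (homPolyClass k) (1 ⊗ₜ cls M) (1 ⊗ₜ cls N) = homPoly k M N := by
  obtain ⟨d, hd⟩ := h.exists_decomposition M
  obtain ⟨d', hd'⟩ := h.exists_decomposition N
  rw [hd, hd', TensorProduct.tmul_sum, TensorProduct.tmul_sum, map_sum,
    homPoly_congr d.iso d'.iso, h.homPoly_biproduct_right]
  refine Finset.sum_congr rfl fun j _ => ?_
  rw [h.homPoly_biproduct_left, map_sum, LinearMap.sum_apply]
  exact Finset.sum_congr rfl fun i _ => sesqOfMatrix_single _ _ _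

/-- The classes of indecomposable objects generate `ℤ[t, t⁻¹] ⊗ A(C)`. -/
theorem FormHypothesis.span_cls (h : FormHypothesis k C) :
    Submodule.span Zt {x : Zt ⊗[ℤ] A C | ∃ M : C, Indecomposable M ∧ x = 1 ⊗ₜ cls M} = ⊤ := by
  rw [eq_top_iff]
  rintro x -
  induction x with
  | zero => exact zero_mem _
  | add x y hx hy => exact add_mem hx hy
  | tmul p a =>
    rw [show p ⊗ₜ[ℤ] a = p • ((1 : Zt) ⊗ₜ[ℤ] a) by simp [TensorProduct.smul_tmul']]
    refine Submodule.smul_mem _ _ ?_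
    induction a using Finsupp.induction_linear with
    | zero => simp
    | add a b ha hb => rw [TensorProduct.tmul_add]; exact add_mem ha hb
    | single c n =>
      rw [← mul_one n, ← smul_eq_mul, ← Finsupp.smul_single, TensorProduct.tmul_smul]
      refine zsmul_mem (Submodule.subset_span ?_) n
      obtain ⟨⟨M, hM⟩, rfl⟩ := Quotient.exists_rep c
      exact ⟨M, hM, by rw [h.cls_indec hM]; rfl⟩

/-- The classes of indecomposable objects generate `A(C)^t`. -/
theorem FormHypothesis.span_clsT (h : FormHypothesis k C) :
    Submodule.span Zt {x : At C | ∃ M : C, Indecomposable M ∧ x = clsT M} = ⊤ := by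
  have := congrArg (Submodule.map (shiftRelations C).mkQ) h.span_cls
  rw [Submodule.map_span, Submodule.map_top, Submodule.range_mkQ] at this
  rw [← this]
  congr 1
  ext x
  constructor
  · rintro ⟨M, hM, rfl⟩
    exact ⟨_, ⟨M, hM, rfl⟩, rfl⟩
  · rintro ⟨_, ⟨M, hM, rfl⟩, rfl⟩
    exact ⟨M, hM, rfl⟩

theorem FormHypothesis.sesq_ext (h : FormHypothesis k C) {σ : Zt →+* Zt}
    {B B' : At C →ₗ[Zt] At C →ₛₗ[σ] Zt}
    (hB : ∀ M N : C, Indecomposable M → Indecomposable N →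
      B (clsT M) (clsT N) = B' (clsT M) (clsT N)) : B = B' := by
  refine LinearMap.ext_on h.span_clsT ?_
  rintro _ ⟨M, hM, rfl⟩
  refine LinearMap.ext_on h.span_clsT ?_
  rintro _ ⟨N, hN, rfl⟩
  exact hB M N hM hN

/-- The sesquilinear form on `A(C)^t`. -/
theorem FormHypothesis.exists_sesqT (h : FormHypothesis k C) :
    ∃ B : SesqT C, ∀ M N : C, B (clsT M) (clsT N) = homPoly k M N := by
  have hT : ∀ (i : ℤ) (a : A C), (LaurentPolynomial.T i : Zt) ⊗ₜ[ℤ] a =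
      (LaurentPolynomial.T i : Zt) • ((1 : Zt) ⊗ₜ[ℤ] a) := fun i a => by
    simp [TensorProduct.smul_tmul']
  refine ⟨sesqDescend (shiftRelations C) (sesqOfMatrix (homPolyClass k)) ?_ ?_,
    fun M N => h.sesqOfMatrix_cls M N⟩
  -- The relations lie in the left radical: on generators, shifting the first variable multiplies
  -- the value by `T i`.
  · intro x hx y
    have : sesqOfMatrix (homPolyClass k) x = 0 := by
      induction hx using Submodule.span_induction with
      | zero => simp
      | add x y _ _ hx hy => rw [map_add, hx, hy, add_zero]
      | smul a x _ hx => rw [map_smul, hx, smul_zero]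
      | mem x hx =>
        obtain ⟨M, i, rfl⟩ := hx
        refine LinearMap.ext_on h.span_cls ?_
        rintro _ ⟨N, -, rfl⟩
        rw [hT, map_sub, map_smul, LinearMap.sub_apply, LinearMap.smul_apply,
          h.sesqOfMatrix_cls, h.sesqOfMatrix_cls, h.homPoly_shift_left]
        simp
    rw [this, LinearMap.zero_apply]
  -- In the second variable the factor from the shift is `T (-i)`, and semilinearity turns the
  -- coefficient `T i` of the relation into the same factor.
  · intro x y hy
    induction hy using Submodule.span_induction with
    | zero => simp
    | add x y _ _ hx hy => rw [map_add, hx, hy, add_zero]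
    | smul a x _ hx => rw [LinearMap.map_smulₛₗ, hx, smul_zero]
    | mem y hy =>
      obtain ⟨N, i, rfl⟩ := hy
      have hx : x ∈ Submodule.span Zt
        {x : Zt ⊗[ℤ] A C | ∃ M : C, Indecomposable M ∧ x = 1 ⊗ₜ cls M} := by
        rw [h.span_cls]; trivial
      induction hx using Submodule.span_induction with
      | zero => simp
      | add x y _ _ hx hy => rw [map_add, LinearMap.add_apply, hx, hy, add_zero]
      | smul a x _ hx => rw [map_smul, LinearMap.smul_apply, hx, smul_zero]
      | mem x hx =>
        obtain ⟨M, -, rfl⟩ := hx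
        rw [hT, map_sub, LinearMap.map_smulₛₗ, barZ_t,
          h.sesqOfMatrix_cls, h.sesqOfMatrix_cls, h.homPoly_shift_right]
        simp

theorem FormHypothesis.existsUnique_isFormT (h : FormHypothesis k C) : ∃! B : SesqT C, IsFormT k B
    := by
  obtain ⟨B, hB⟩ := h.exists_sesqT
  exact ⟨B, fun M N _ _ => hB M N, fun B' hB' =>
    h.sesq_ext fun M N hM hN => (hB' M N hM hN).trans (hB M N).symm⟩

/-- By uniqueness `B` is the form constructed before, for which the formula was proved for all
objects. -/
theorem FormHypothesis.isFormT_apply (h : FormHypothesis k C) {B : SesqT C} (hB : IsFormT k B)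
    (M N : C) :
    B (clsT M) (clsT N) = homPoly k M N := by
  obtain ⟨B₀, hB₀⟩ := h.exists_sesqT
  rw [← hB₀]
  exact congrArg (fun B : SesqT C => B (clsT M) (clsT N))
    (h.sesq_ext fun M N hM hN => (hB M N hM hN).trans (hB₀ M N).symm)

/-- This settles at once the uniqueness over ℚ(t) and the fact that the form there extends the
integral one. -/
theorem FormHypothesis.eq_sesqBaseChange (h : FormHypothesis k C) {B : SesqT C} (hB : IsFormT k B)
    {BQ : SesqQ C}
    (hBQ : IsFormQ k BQ) : BQ = sesqBaseChange B := by
  refine sesqQ_ext fun x y => ?_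
  rw [sesqBaseChange_tmul]
  have hx : x ∈ Submodule.span Zt {x : At C | ∃ M : C, Indecomposable M ∧ x = clsT M} := by
    rw [h.span_clsT]; trivial
  have hy : y ∈ Submodule.span Zt {x : At C | ∃ M : C, Indecomposable M ∧ x = clsT M} := by
    rw [h.span_clsT]; trivial
  have hs : ∀ (p : Zt) (z : At C), (1 : Qt) ⊗ₜ[Zt] (p • z) =
      algebraMap Zt Qt p • ((1 : Qt) ⊗ₜ[Zt] z) := fun p z => by
    rw [TensorProduct.tmul_smul, algebraMap_smul]
  induction hx using Submodule.span_induction with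
  | zero => simp
  | add x y _ _ hx hy =>
    rw [TensorProduct.tmul_add, map_add, map_add, LinearMap.add_apply, hx, hy,
      LinearMap.add_apply, map_add]
  | smul a x _ hx =>
    rw [hs, map_smul, map_smul, LinearMap.smul_apply, LinearMap.smul_apply, hx, smul_eq_mul,
      smul_eq_mul, map_mul]
  | mem x hx =>
    obtain ⟨M, hM, rfl⟩ := hx
    induction hy using Submodule.span_induction with
    | zero => simp
    | add x y _ _ hx hy => rw [TensorProduct.tmul_add, map_add, map_add, hx, hy, map_add]
    | smul a x _ hx =>
      rw [hs, LinearMap.map_smulₛₗ, LinearMap.map_smulₛₗ, hx, smul_eq_mul,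
        smul_eq_mul, map_mul, barQ_algebraMap]
    | mem y hy =>
      obtain ⟨N, hN, rfl⟩ := hy
      rw [hB M N hM hN]
      exact hBQ M N hM hN

theorem FormHypothesis.isFormQ_tmul (h : FormHypothesis k C) {B : SesqT C} (hB : IsFormT k B)
    {BQ : SesqQ C}
    (hBQ : IsFormQ k BQ) (x y : At C) :
    BQ (1 ⊗ₜ[Zt] x) (1 ⊗ₜ[Zt] y) = algebraMap Zt Qt (B x y) := by
  rw [h.eq_sesqBaseChange hB hBQ, sesqBaseChange_tmul]

theorem FormHypothesis.existsUnique_isFormQ (h : FormHypothesis k C) : ∃! BQ : SesqQ C, IsFormQ k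
    BQ := by
  obtain ⟨B, hB, -⟩ := h.existsUnique_isFormT
  refine ⟨sesqBaseChange B, fun M N hM hN => ?_, fun BQ hBQ => h.eq_sesqBaseChange hB hBQ⟩
  rw [clsQ, clsQ, sesqBaseChange_tmul, hB M N hM hN]

/-- If `∑ tⁱ dim Hom(M, N[i])` is Hermitian then so is the form on `A(C)^t`. -/
theorem FormHypothesis.hermitianT (h : FormHypothesis k C)
    (hs : ∀ M N : C, homPoly k M N = barZ (homPoly k N M))
    {B : SesqT C} (hB : IsFormT k B) (a b : At C) : B a b = barZ (B b a) := by
  have ha : a ∈ Submodule.span Zt {x : At C | ∃ M : C, Indecomposable M ∧ x = clsT M} := by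
    rw [h.span_clsT]; trivial
  have hb : b ∈ Submodule.span Zt {x : At C | ∃ M : C, Indecomposable M ∧ x = clsT M} := by
    rw [h.span_clsT]; trivial
  induction ha using Submodule.span_induction with
  | zero => simp
  | add x y _ _ hx hy => rw [map_add, map_add, LinearMap.add_apply, hx, hy, map_add]
  | smul a x _ hx =>
    rw [LinearMap.map_smul, LinearMap.smul_apply, LinearMap.map_smulₛₗ, hx, smul_eq_mul,
      smul_eq_mul, map_mul, barZ_barZ]
  | mem x hx =>
    obtain ⟨M, hM, rfl⟩ := hx
    induction hb using Submodule.span_induction with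
    | zero => simp
    | add x y _ _ hx hy => rw [map_add, map_add, LinearMap.add_apply, hx, hy, map_add]
    | smul a x _ hx =>
      rw [LinearMap.map_smulₛₗ, LinearMap.map_smul, LinearMap.smul_apply, hx, smul_eq_mul,
        smul_eq_mul, map_mul]
    | mem y hy =>
      obtain ⟨N, hN, rfl⟩ := hy
      rw [hB M N hM hN, hB N M hN hM, hs]

theorem FormHypothesis.hermitianQ (h : FormHypothesis k C)
    (hs : ∀ M N : C, homPoly k M N = barZ (homPoly k N M))
    {BQ : SesqQ C} (hBQ : IsFormQ k BQ) (a b : AQt C) : BQ a b = barQ (BQ b a) := by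
  obtain ⟨B, hB, -⟩ := h.existsUnique_isFormT
  have hq : ∀ (q : Qt) (m : At C), q ⊗ₜ[Zt] m = q • ((1 : Qt) ⊗ₜ[Zt] m) := fun q m => by
    simp [TensorProduct.smul_tmul']
  induction a using TensorProduct.induction_on with
  | zero => simp
  | add u v hu hv => rw [map_add, map_add, LinearMap.add_apply, hu, hv, map_add]
  | tmul q m =>
    induction b using TensorProduct.induction_on with
    | zero => simp
    | add u v hu hv => rw [map_add, map_add, LinearMap.add_apply, hu, hv, map_add]
    | tmul q' m' =>
      rw [hq q m, hq q' m', LinearMap.map_smul, LinearMap.map_smul, LinearMap.smul_apply,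
        LinearMap.smul_apply, LinearMap.map_smulₛₗ, LinearMap.map_smulₛₗ,
        h.isFormQ_tmul hB hBQ, h.isFormQ_tmul hB hBQ, h.hermitianT hs hB]
      simp only [smul_eq_mul, map_mul, barQ_barQ, barQ_algebraMap]
      ring

end HomPoly

/-! ### Auslander–Reiten triangles and dual elements. -/

section AuslanderReiten

variable {k : Type*} [Field k]
variable {C : Type*} [Category* C] [Preadditive C] [HasZeroObject C] [HasShift C ℤ]
  [∀ n : ℤ, (shiftFunctor C n).Additive] [Pretriangulated C] [Linear k C]
  [∀ n : ℤ, (shiftFunctor C n).Linear k]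

variable (k) in
/-- The map `Hom(W, Z) → Hom(W, X[1])` given by a triangle `X → Y → Z → X[1]`. -/
abbrev connectingTo (T : Triangle C) (W : C) : (W ⟶ T.obj₃) →ₗ[k] (W ⟶ T.obj₁⟦(1 : ℤ)⟧) :=
  Linear.rightComp k W T.mor₃

variable (k) in
/-- The map `Hom(X, W) → Hom(Z, W[1])` given by a triangle `X → Y → Z → X[1]`. -/
abbrev connectingFrom (T : Triangle C) (W : C) : (T.obj₁ ⟶ W) →ₗ[k] (T.obj₃ ⟶ W⟦(1 : ℤ)⟧) :=
  (Linear.leftComp k _ T.mor₃).comp ((shiftFunctor C (1 : ℤ)).mapLinearMap k)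

theorem FormHypothesis.indecomposable_shift (h : FormHypothesis k C) {M : C}
    (hM : Indecomposable M) (a : ℤ) : Indecomposable (M⟦a⟧) := by
  refine indecomposable_of_isLocalRing_end (isLocalRing_of_ringEquiv (R := End M) ?_
    (h.isLocalRing_end hM))
  exact
    { Equiv.ofBijective (fun f : M ⟶ M => f⟦a⟧')
        ⟨(shiftFunctor C a).map_injective, (shiftFunctor C a).map_surjective⟩ with
      map_add' := fun f g => Functor.map_add _
      map_mul' := fun f g => Functor.map_comp _ _ _ }

/-- The idempotent `f ≫ section_ f` of the local ring End(W) is 0 or 1, and 0 would make Z zero. -/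
theorem FormHypothesis.isIso_of_isSplitEpi (h : FormHypothesis k C) {W Z : C}
    (hW : Indecomposable W)
    (hZ : Indecomposable Z) (f : W ⟶ Z) [IsSplitEpi f] : IsIso f := by
  have := h.isLocalRing_end hW
  have he : IsIdempotentElem (M := End W) (f ≫ section_ f) := by
    change (f ≫ section_ f) ≫ (f ≫ section_ f) = f ≫ section_ f
    simp
  rcases eq_zero_or_eq_one_of_isIdempotentElem he with h0 | h1
  · have h0 : f ≫ section_ f = 0 := h0
    refine (hZ.1 ?_).elim
    rw [IsZero.iff_id_eq_zero]
    simpa using congrArg (fun g => section_ f ≫ g ≫ f) h0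
  · exact ⟨section_ f, h1, IsSplitEpi.id f⟩

theorem FormHypothesis.isIso_of_isSplitMono (h : FormHypothesis k C) {X W : C}
    (hX : Indecomposable X)
    (hW : Indecomposable W) (f : X ⟶ W) [IsSplitMono f] : IsIso f := by
  have := h.isIso_of_isSplitEpi hW hX (retraction f)
  have h1 : f = inv (retraction f) := by
    rw [← cancel_mono (retraction f)]
    simp
  rw [h1]
  infer_instance

/-- Over an algebraically closed field an endomorphism of an indecomposable object is the sum of a
scalar and a non-isomorphism. -/
theorem FormHypothesis.exists_not_isIso_sub (h : FormHypothesis k C) [IsAlgClosed k] {X : C}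
    (hX : Indecomposable X)
    (f : X ⟶ X) : ∃ c : k, ¬ IsIso (f - c • 𝟙 X) := by
  have := h.isLocalRing_end hX
  have := h.homFinite X X
  have : FiniteDimensional k (End X) := h.homFinite X X
  -- The scalar is an eigenvalue: it exists because End(X) is a nonzero finite dimensional algebra
  -- over an algebraically closed field.
  obtain ⟨c, hc⟩ := spectrum.nonempty_of_isAlgClosed_of_finiteDimensional k (A := End X) f
  refine ⟨c, fun hi => hc ?_⟩
  have hu : IsUnit (M := End X) (f - c • 𝟙 X) := (isUnit_iff_isIso _).2 hi
  have := hu.neg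
  rw [neg_sub] at this
  rw [spectrum.mem_resolventSet_iff, Algebra.algebraMap_eq_smul_one]
  exact this

/-- Rank-nullity along the long exact sequence of Hom(W, -). The two correction terms measure the
failure of Hom(W, X) → Hom(W, Y) to be injective and of Hom(W, Y) → Hom(W, Z) to be surjective. -/
theorem FormHypothesis.finrank_to_obj₂ (h : FormHypothesis k C) {T : Triangle C}
    (hT : T ∈ distTriang C) (W : C) :
    Module.finrank k (W ⟶ T.obj₂) + Module.finrank k (connectingTo k T W).range +
      Module.finrank k (connectingTo k T (W⟦(1 : ℤ)⟧)).range =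
      Module.finrank k (W ⟶ T.obj₁) + Module.finrank k (W ⟶ T.obj₃) := by
  have := fun M N : C => h.homFinite M N
  have e₁ := LinearMap.finrank_range_add_finrank_ker (Linear.rightComp k W T.mor₁)
  have e₂ := LinearMap.finrank_range_add_finrank_ker (Linear.rightComp k W T.mor₂)
  have e₃ := LinearMap.finrank_range_add_finrank_ker (connectingTo k T W)
  have k₂ : (Linear.rightComp k W T.mor₂).ker = (Linear.rightComp k W T.mor₁).range := by
    ext f
    constructor
    · intro hf
      obtain ⟨g, hg⟩ := T.coyoneda_exact₂ hT f hf
      exact ⟨g, hg.symm⟩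
    · rintro ⟨g, rfl⟩
      simp [comp_distTriang_mor_zero₁₂ _ hT]
  have k₃ : (connectingTo k T W).ker = (Linear.rightComp k W T.mor₂).range := by
    ext f
    constructor
    · intro hf
      obtain ⟨g, hg⟩ := T.coyoneda_exact₃ hT f hf
      exact ⟨g, hg.symm⟩
    · rintro ⟨g, rfl⟩
      simp [comp_distTriang_mor_zero₂₃ _ hT]
  let S : (W ⟶ T.obj₁) →ₗ[k] (W⟦(1 : ℤ)⟧ ⟶ T.obj₁⟦(1 : ℤ)⟧) :=
    (shiftFunctor C (1 : ℤ)).mapLinearMap k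
  -- Exactness one place further to the left: after shifting, a map W → X killed by `mor₁` is one
  -- that comes from W[1] → Z.
  have hS : (connectingTo k T (W⟦(1 : ℤ)⟧)).range =
      (Linear.rightComp k W T.mor₁).ker.map S := by
    ext f
    constructor
    · rintro ⟨g, rfl⟩
      obtain ⟨f, hf⟩ := (shiftFunctor C (1 : ℤ)).map_surjective (g ≫ T.mor₃)
      refine ⟨f, ?_, hf⟩
      refine (shiftFunctor C (1 : ℤ)).map_injective ?_
      change (f ≫ T.mor₁)⟦(1 : ℤ)⟧' = (0 : W ⟶ T.obj₂)⟦(1 : ℤ)⟧'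
      rw [Functor.map_comp, hf, Category.assoc, comp_distTriang_mor_zero₃₁ _ hT, comp_zero,
        Functor.map_zero]
    · rintro ⟨f, hf, rfl⟩
      obtain ⟨g, hg⟩ := T.coyoneda_exact₁ hT (S f) (by
        change f⟦(1 : ℤ)⟧' ≫ T.mor₁⟦(1 : ℤ)⟧' = 0
        rw [← Functor.map_comp]
        have hf : f ≫ T.mor₁ = 0 := hf
        rw [hf, Functor.map_zero])
      exact ⟨g, hg.symm⟩
  rw [hS, ← (Submodule.equivMapOfInjective S (shiftFunctor C (1 : ℤ)).map_injective _).finrank_eq]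
  rw [k₂] at e₂
  rw [k₃] at e₃
  omega

/-- The same count for Hom(-, W[1]); the target is W[1] because `connectingFrom` raises the shift of
W by one. -/
theorem FormHypothesis.finrank_from_obj₂ (h : FormHypothesis k C) {T : Triangle C}
    (hT : T ∈ distTriang C) (W : C) :
    Module.finrank k (T.obj₂ ⟶ W⟦(1 : ℤ)⟧) + Module.finrank k (connectingFrom k T W).range +
      Module.finrank k (connectingFrom k T (W⟦(1 : ℤ)⟧)).range =
      Module.finrank k (T.obj₁ ⟶ W⟦(1 : ℤ)⟧) + Module.finrank k (T.obj₃ ⟶ W⟦(1 : ℤ)⟧) := by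
  have := fun M N : C => h.homFinite M N
  have e₁ := LinearMap.finrank_range_add_finrank_ker (connectingFrom k T (W⟦(1 : ℤ)⟧))
  have e₂ := LinearMap.finrank_range_add_finrank_ker (Linear.leftComp k (W⟦(1 : ℤ)⟧) T.mor₁)
  have e₃ := LinearMap.finrank_range_add_finrank_ker (Linear.leftComp k (W⟦(1 : ℤ)⟧) T.mor₂)
  have k₁ : (connectingFrom k T (W⟦(1 : ℤ)⟧)).ker =
      (Linear.leftComp k (W⟦(1 : ℤ)⟧) T.mor₁).range := by
    ext f
    constructor
    · intro hf
      obtain ⟨g, hg⟩ : ∃ g : T.obj₂ ⟶ W⟦(1 : ℤ)⟧,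
          f⟦(1 : ℤ)⟧' = (-T.mor₁⟦(1 : ℤ)⟧') ≫ g⟦(1 : ℤ)⟧' := by
        obtain ⟨g, hg⟩ := Triangle.yoneda_exact₃ _ (rot_of_distTriang _ hT) (f⟦(1 : ℤ)⟧') hf
        obtain ⟨g, rfl⟩ := (shiftFunctor C (1 : ℤ)).map_surjective g
        exact ⟨g, hg⟩
      -- The sign undoes the one that rotating the triangle puts on `mor₁`.
      refine ⟨-g, (shiftFunctor C (1 : ℤ)).map_injective ?_⟩
      rw [hg]
      change (T.mor₁ ≫ (-g))⟦(1 : ℤ)⟧' = (-T.mor₁⟦(1 : ℤ)⟧') ≫ g⟦(1 : ℤ)⟧'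
      simp
    · rintro ⟨g, rfl⟩
      change T.mor₃ ≫ (T.mor₁ ≫ g)⟦(1 : ℤ)⟧' = 0
      rw [Functor.map_comp, comp_distTriang_mor_zero₃₁_assoc _ hT, zero_comp]
  have k₂ : (Linear.leftComp k (W⟦(1 : ℤ)⟧) T.mor₁).ker =
      (Linear.leftComp k (W⟦(1 : ℤ)⟧) T.mor₂).range := by
    ext f
    constructor
    · intro hf
      obtain ⟨g, hg⟩ := T.yoneda_exact₂ hT f hf
      exact ⟨g, hg.symm⟩
    · rintro ⟨g, rfl⟩
      simp [comp_distTriang_mor_zero₁₂_assoc _ hT]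
  have k₃ : (Linear.leftComp k (W⟦(1 : ℤ)⟧) T.mor₂).ker = (connectingFrom k T W).range := by
    ext f
    constructor
    · intro hf
      obtain ⟨g, hg⟩ := T.yoneda_exact₃ hT f hf
      obtain ⟨g, rfl⟩ := (shiftFunctor C (1 : ℤ)).map_surjective g
      exact ⟨g, hg.symm⟩
    · rintro ⟨g, rfl⟩
      change T.mor₂ ≫ T.mor₃ ≫ g⟦(1 : ℤ)⟧' = 0
      rw [comp_distTriang_mor_zero₂₃_assoc _ hT, zero_comp]
  rw [k₁] at e₁
  rw [k₂] at e₂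
  rw [k₃] at e₃
  omega

/-- In an Auslander-Reiten triangle every map from the first object that is not a split
monomorphism is killed by the connecting map. -/
theorem FormHypothesis.connectingFrom_eq_zero (h : FormHypothesis k C) {T : Triangle C}
    (hT : IsARTriangle T) {W : C}
    (f : T.obj₁ ⟶ W) (hf : ¬ IsSplitMono f) : T.mor₃ ≫ f⟦(1 : ℤ)⟧' = 0 := by
  by_contra h0
  -- Push the triangle out along f. If the new connecting map is nonzero then E → Z is not a split
  -- epimorphism, so it lifts to Y; this gives a morphism of triangles back to T, with some g : W →
  -- X.
  obtain ⟨E, a, b, hE⟩ := distinguished_cocone_triangle₂ (T.mor₃ ≫ f⟦(1 : ℤ)⟧')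
  have hb : ¬ IsSplitEpi b := fun hb => h0 (by
    have : b ≫ T.mor₃ ≫ f⟦(1 : ℤ)⟧' = 0 := comp_distTriang_mor_zero₂₃ _ hE
    rw [← cancel_epi b, this, comp_zero])
  obtain ⟨c, hc⟩ := hT.factors E b hb
  obtain ⟨g, hg⟩ : ∃ g : W ⟶ T.obj₁, (T.mor₃ ≫ f⟦(1 : ℤ)⟧') ≫ g⟦(1 : ℤ)⟧' = 𝟙 _ ≫ T.mor₃ := by
    obtain ⟨g, -, hg⟩ := complete_distinguished_triangle_morphism₁ _ T hE hT.distinguished c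
      (𝟙 T.obj₃) ((Category.comp_id b).trans hc.symm)
    exact ⟨g, hg⟩
  rw [Category.id_comp, Category.assoc, ← Functor.map_comp] at hg
  have := h.isLocalRing_end hT.indec₁
  -- Since `f ≫ g` fixes `mor₃`, the difference `1 - f ≫ g` kills it. Invertibility of `f ≫ g` would
  -- make f a split monomorphism, and invertibility of the difference would make `mor₃` zero.
  rcases IsLocalRing.isUnit_or_isUnit_of_add_one (R := End T.obj₁) (a := f ≫ g)
    (b := 1 - (show End T.obj₁ from f ≫ g)) (add_sub_cancel _ _) with hu | hu
  · have hi : IsIso (f ≫ g) := (isUnit_iff_isIso _).1 hu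
    exact hf ⟨⟨g ≫ inv (f ≫ g), by rw [← Category.assoc, IsIso.hom_inv_id]⟩⟩
  · have hi : IsIso (𝟙 T.obj₁ - f ≫ g) := (isUnit_iff_isIso _).1 hu
    refine hT.mor₃_ne_zero ?_
    rw [← cancel_mono ((𝟙 T.obj₁ - f ≫ g)⟦(1 : ℤ)⟧'), Functor.map_sub, Preadditive.comp_sub,
      hg]
    simp

theorem connectingTo_eq_zero {T : Triangle C} (hT : IsARTriangle T) {W : C}
    (f : W ⟶ T.obj₃) (hf : ¬ IsSplitEpi f) : f ≫ T.mor₃ = 0 := by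
  obtain ⟨g, rfl⟩ := hT.factors W f hf
  rw [Category.assoc, comp_distTriang_mor_zero₂₃ _ hT.distinguished, comp_zero]

theorem FormHypothesis.finrank_range_connectingTo_eq_zero (h : FormHypothesis k C)
    {T : Triangle C} (hT : IsARTriangle T)
    {W : C} (hW : Indecomposable W) (hWT : ¬ Nonempty (W ≅ T.obj₃)) :
    Module.finrank k (connectingTo k T W).range = 0 := by
  have : connectingTo k T W = 0 := by
    refine LinearMap.ext fun f => connectingTo_eq_zero hT f fun hf => hWT ?_
    have := h.isIso_of_isSplitEpi hW hT.indec₃ f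
    exact ⟨asIso f⟩
  rw [this, LinearMap.range_zero, finrank_bot]

/-- Every endomorphism of Z is a scalar plus a non-isomorphism, and the connecting map kills the
latter, so its image is the line spanned by `e.hom ≫ T.mor₃`. -/
theorem FormHypothesis.finrank_range_connectingTo_eq_one (h : FormHypothesis k C) [IsAlgClosed k]
    {T : Triangle C}
    (hT : IsARTriangle T) {W : C} (e : W ≅ T.obj₃) :
    Module.finrank k (connectingTo k T W).range = 1 := by
  have : (connectingTo k T W).range = Submodule.span k {e.hom ≫ T.mor₃} := by
    refine le_antisymm ?_ (by
      rw [Submodule.span_singleton_le_iff_mem]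
      exact ⟨e.hom, rfl⟩)
    rintro _ ⟨f, rfl⟩
    obtain ⟨c, hc⟩ := h.exists_not_isIso_sub hT.indec₃ (e.inv ≫ f)
    have h0 := connectingTo_eq_zero hT (e.inv ≫ f - c • 𝟙 _) fun _ =>
      hc (h.isIso_of_isSplitEpi hT.indec₃ hT.indec₃ _)
    rw [Preadditive.sub_comp, sub_eq_zero, Linear.smul_comp, Category.id_comp,
      Category.assoc, Iso.inv_comp_eq, Linear.comp_smul] at h0
    exact Submodule.mem_span_singleton.2 ⟨c, h0.symm⟩
  rw [this, finrank_span_singleton]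
  exact fun h0 => hT.mor₃_ne_zero (by rwa [← cancel_epi e.hom, comp_zero])

theorem FormHypothesis.finrank_range_connectingFrom_eq_zero (h : FormHypothesis k C)
    {T : Triangle C}
    (hT : IsARTriangle T) {W : C} (hW : Indecomposable W) (hWT : ¬ Nonempty (W ≅ T.obj₁)) :
    Module.finrank k (connectingFrom k T W).range = 0 := by
  have : connectingFrom k T W = 0 := by
    refine LinearMap.ext fun f => h.connectingFrom_eq_zero hT f fun hf => hWT ?_
    have := h.isIso_of_isSplitMono hT.indec₁ hW f
    exact ⟨(asIso f).symm⟩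
  rw [this, LinearMap.range_zero, finrank_bot]

theorem FormHypothesis.finrank_range_connectingFrom_eq_one (h : FormHypothesis k C)
    [IsAlgClosed k] {T : Triangle C}
    (hT : IsARTriangle T) {W : C} (e : W ≅ T.obj₁) :
    Module.finrank k (connectingFrom k T W).range = 1 := by
  have : (connectingFrom k T W).range = Submodule.span k {T.mor₃ ≫ e.inv⟦(1 : ℤ)⟧'} := by
    refine le_antisymm ?_ (by
      rw [Submodule.span_singleton_le_iff_mem]
      exact ⟨e.inv, rfl⟩)
    rintro _ ⟨f, rfl⟩
    obtain ⟨c, hc⟩ := h.exists_not_isIso_sub hT.indec₁ (f ≫ e.hom)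
    have h0 := h.connectingFrom_eq_zero hT (f ≫ e.hom - c • 𝟙 _) fun _ =>
      hc (h.isIso_of_isSplitMono hT.indec₁ hT.indec₁ _)
    rw [Functor.map_sub, Preadditive.comp_sub, sub_eq_zero, Functor.map_smul, CategoryTheory.Functor.map_id,
      Linear.comp_smul, Category.comp_id] at h0
    refine Submodule.mem_span_singleton.2 ⟨c, ?_⟩
    rw [← Linear.smul_comp, ← h0, Functor.map_comp, Category.assoc, Category.assoc,
      ← Functor.map_comp, e.hom_inv_id]
    simp
  rw [this, finrank_span_singleton]
  exact fun h0 => hT.mor₃_ne_zero (by rwa [← cancel_mono (e.inv⟦(1 : ℤ)⟧'), zero_comp])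

/-- The degrees `i` with `M[-i] ≅ Z`, for a nonzero object `M ≅ Z`. -/
theorem FormHypothesis.eq_zero_of_iso_shift (h : FormHypothesis k C) {M : C}
    (hM : Indecomposable M) {a : ℤ}
    (e : M ≅ M⟦a⟧) : a = 0 := by
  by_contra ha
  -- Iterating the isomorphism would produce infinitely many shifts of M with nonzero maps from M.
  have hn : ∀ n : ℕ, Nonempty (M ≅ M⟦n * a⟧) := by
    intro n
    induction n with
    | zero => exact ⟨((shiftFunctorZero' C _ (by simp)).app M).symm⟩
    | succ n ih =>
      obtain ⟨f⟩ := ih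
      exact ⟨e ≪≫ (shiftFunctor C a).mapIso f ≪≫
        ((shiftFunctorAdd' C (n * a) a (((n + 1 : ℕ) : ℤ) * a) (by push_cast; ring)).app M).symm⟩
  refine (Set.infinite_range_of_injective (f := fun n : ℕ => (n : ℤ) * a)
    fun n m hnm => ?_) ((h.finite_shifts M M).subset ?_)
  · exact_mod_cast mul_right_cancel₀ ha hnm
  · rintro _ ⟨n, rfl⟩
    obtain ⟨f⟩ := hn n
    refine ⟨f.hom, 0, fun h0 => hM.1 ?_⟩
    rw [IsZero.iff_id_eq_zero, ← f.hom_inv_id, h0, zero_comp]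

/-- Moving the shift to the source allows the exact sequence of the unshifted triangle to be used,
with W = M[-i]. -/
theorem FormHypothesis.coeff_homPoly_eq_finrank_shift_left (h : FormHypothesis k C) (M N : C)
    (i : ℤ) :
    (homPoly k M N).coeff i = Module.finrank k (M⟦-i⟧ ⟶ N) := by
  have h₁ := finrank_shift_left (k := k) M N (-i) 0
  have h₂ : Module.finrank k (M⟦-i⟧ ⟶ N) = Module.finrank k (M⟦-i⟧ ⟶ N⟦(0 : ℤ)⟧) :=
    (Linear.homCongr k (Iso.refl (M⟦-i⟧)) ((shiftFunctorZero C ℤ).app N).symm).finrank_eq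
  rw [zero_sub, neg_neg] at h₁
  rw [h.coeff_homPoly, h₂, h₁]

theorem FormHypothesis.coeff_homPoly_hat_right (h : FormHypothesis k C) {T : Triangle C}
    (hT : T ∈ distTriang C) (M : C)
    (i : ℤ) : (homPoly k M T.obj₁ + homPoly k M T.obj₃ - homPoly k M T.obj₂).coeff i =
      Module.finrank k (connectingTo k T (M⟦-i⟧)).range +
        Module.finrank k (connectingTo k T (M⟦-i⟧⟦(1 : ℤ)⟧)).range := by
  have := h.finrank_to_obj₂ hT (M⟦-i⟧)
  simp only [AddMonoidAlgebra.coeff_sub, AddMonoidAlgebra.coeff_add, Finsupp.sub_apply,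
    Finsupp.add_apply, h.coeff_homPoly_eq_finrank_shift_left]
  omega

/-- The index is i - 1 because `finrank_from_obj₂` counts maps into W[1], which has to be M[i]. -/
theorem FormHypothesis.coeff_homPoly_hat_left (h : FormHypothesis k C) {T : Triangle C}
    (hT : T ∈ distTriang C) (M : C)
    (i : ℤ) : (homPoly k T.obj₁ M + homPoly k T.obj₃ M - homPoly k T.obj₂ M).coeff i =
      Module.finrank k (connectingFrom k T (M⟦i - 1⟧)).range +
        Module.finrank k (connectingFrom k T (M⟦i - 1⟧⟦(1 : ℤ)⟧)).range := by
  have := h.finrank_from_obj₂ hT (M⟦i - 1⟧)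
  have e : ∀ N : C, (homPoly k N M).coeff i = Module.finrank k (N ⟶ M⟦i - 1⟧⟦(1 : ℤ)⟧) := by
    intro N
    rw [h.coeff_homPoly, (Linear.homCongr k (Iso.refl N)
      ((shiftFunctorAdd' C (i - 1) 1 i (by omega)).app M)).finrank_eq]
    rfl
  simp only [AddMonoidAlgebra.coeff_sub, AddMonoidAlgebra.coeff_add, Finsupp.sub_apply,
    Finsupp.add_apply, e]
  omega

theorem isoShift_of_shift_iso {M Z : C} {a : ℤ} (e : M⟦a⟧ ≅ Z) : Nonempty (M ≅ Z⟦-a⟧) :=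
  ⟨((shiftFunctorCompIsoId C a (-a) (add_neg_cancel a)).app M).symm ≪≫
    (shiftFunctor C (-a)).mapIso e⟩

theorem shift_one_iso (M : C) (a b : ℤ) (hab : a + 1 = b) : Nonempty (M⟦a⟧⟦(1 : ℤ)⟧ ≅ M⟦b⟧) :=
  ⟨((shiftFunctorAdd' C a 1 b hab).app M).symm⟩

theorem coeff_one_add_tZ (i : ℤ) :
    (1 + tZ : Zt).coeff i = (if i = 0 then 1 else 0) + (if i = 1 then 1 else 0) := by
  rw [AddMonoidAlgebra.coeff_add, Finsupp.add_apply, ← LaurentPolynomial.T_zero,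
    LaurentPolynomial.T_apply, LaurentPolynomial.T_apply]
  simp only [eq_comm]

theorem FormHypothesis.homPoly_hat_right_eq_zero (h : FormHypothesis k C) {T : Triangle C}
    (hT : IsARTriangle T) {M : C}
    (hM : Indecomposable M) (hMT : ¬ ∃ i : ℤ, Nonempty (M ≅ T.obj₃⟦i⟧)) :
    homPoly k M T.obj₁ + homPoly k M T.obj₃ - homPoly k M T.obj₂ = 0 := by
  have hn : ∀ a : ℤ, ¬ Nonempty (M⟦a⟧ ≅ T.obj₃) := fun a ⟨e⟩ => hMT ⟨-a, isoShift_of_shift_iso e⟩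
  ext i
  rw [h.coeff_homPoly_hat_right hT.distinguished,
    h.finrank_range_connectingTo_eq_zero hT (h.indecomposable_shift hM _) (hn _),
    h.finrank_range_connectingTo_eq_zero hT
      (h.indecomposable_shift (h.indecomposable_shift hM _) _) fun ⟨e⟩ =>
        hn (-i + 1) ⟨(shift_one_iso M (-i) _ rfl).some.symm ≪≫ e⟩]
  simp

theorem FormHypothesis.homPoly_hat_left_eq_zero (h : FormHypothesis k C) {T : Triangle C}
    (hT : IsARTriangle T) {M : C}
    (hM : Indecomposable M) (hMT : ¬ ∃ i : ℤ, Nonempty (M ≅ T.obj₁⟦i⟧)) :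
    homPoly k T.obj₁ M + homPoly k T.obj₃ M - homPoly k T.obj₂ M = 0 := by
  have hn : ∀ a : ℤ, ¬ Nonempty (M⟦a⟧ ≅ T.obj₁) := fun a ⟨e⟩ => hMT ⟨-a, isoShift_of_shift_iso e⟩
  ext i
  rw [h.coeff_homPoly_hat_left hT.distinguished,
    h.finrank_range_connectingFrom_eq_zero hT (h.indecomposable_shift hM _) (hn _),
    h.finrank_range_connectingFrom_eq_zero hT
      (h.indecomposable_shift (h.indecomposable_shift hM _) _) fun ⟨e⟩ =>
        hn i ⟨(shift_one_iso M (i - 1) i (by omega)).some.symm ≪≫ e⟩]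
  simp

variable [IsAlgClosed k]

theorem FormHypothesis.finrank_range_connectingTo_shift (h : FormHypothesis k C) {T : Triangle C}
    (hT : IsARTriangle T)
    {M : C} (hM : Indecomposable M) (e : M ≅ T.obj₃) {W : C} {a : ℤ} (f : W ≅ M⟦a⟧) :
    Module.finrank k (connectingTo k T W).range = if a = 0 then 1 else 0 := by
  split_ifs with ha
  · exact h.finrank_range_connectingTo_eq_one hT (f ≪≫ (shiftFunctorZero' C a ha).app M ≪≫ e)
  · refine h.finrank_range_connectingTo_eq_zero hT (indecomposable_of_isLocalRing_end
      (isLocalRing_end_of_iso f.symm (h.isLocalRing_end (h.indecomposable_shift hM a)))) ?_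
    rintro ⟨g⟩
    exact ha (h.eq_zero_of_iso_shift hM (e ≪≫ g.symm ≪≫ f))

theorem FormHypothesis.finrank_range_connectingFrom_shift (h : FormHypothesis k C)
    {T : Triangle C} (hT : IsARTriangle T)
    {M : C} (hM : Indecomposable M) (e : M ≅ T.obj₁) {W : C} {a : ℤ} (f : W ≅ M⟦a⟧) :
    Module.finrank k (connectingFrom k T W).range = if a = 0 then 1 else 0 := by
  split_ifs with ha
  · exact h.finrank_range_connectingFrom_eq_one hT (f ≪≫ (shiftFunctorZero' C a ha).app M ≪≫ e)
  · refine h.finrank_range_connectingFrom_eq_zero hT (indecomposable_of_isLocalRing_end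
      (isLocalRing_end_of_iso f.symm (h.isLocalRing_end (h.indecomposable_shift hM a)))) ?_
    rintro ⟨g⟩
    exact ha (h.eq_zero_of_iso_shift hM (e ≪≫ g.symm ≪≫ f))

theorem FormHypothesis.homPoly_hat_right_eq (h : FormHypothesis k C) {T : Triangle C}
    (hT : IsARTriangle T) {M : C}
    (hM : Indecomposable M) (e : M ≅ T.obj₃) :
    homPoly k M T.obj₁ + homPoly k M T.obj₃ - homPoly k M T.obj₂ = 1 + tZ := by
  ext i
  -- The two ranks belong to the shifts -i and -i + 1 of M; they are 1 exactly for i = 0 and i = 1.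
  rw [h.coeff_homPoly_hat_right hT.distinguished, coeff_one_add_tZ,
    h.finrank_range_connectingTo_shift hT hM e (Iso.refl _),
    h.finrank_range_connectingTo_shift hT hM e (shift_one_iso M (-i) _ rfl).some]
  push_cast
  congr 2 <;> simp only [eq_iff_iff] <;> omega

theorem FormHypothesis.homPoly_hat_left_eq (h : FormHypothesis k C) {T : Triangle C}
    (hT : IsARTriangle T) {M : C}
    (hM : Indecomposable M) (e : M ≅ T.obj₁) :
    homPoly k T.obj₁ M + homPoly k T.obj₃ M - homPoly k T.obj₂ M = 1 + tZ := by
  ext i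
  rw [h.coeff_homPoly_hat_left hT.distinguished, coeff_one_add_tZ,
    h.finrank_range_connectingFrom_shift hT hM e (Iso.refl _),
    h.finrank_range_connectingFrom_shift hT hM e (shift_one_iso M (i - 1) i (by omega)).some,
    add_comm]
  push_cast
  congr 2
  simp only [eq_iff_iff]
  omega

/-- The values of the two forms on the classes attached to an Auslander-Reiten triangle. -/
theorem FormHypothesis.arTriangle_duality (h : FormHypothesis k C) {B : SesqT C} {BQ : SesqQ C}
    (hB : IsFormT k B) (hBQ : IsFormQ k BQ) {T : Triangle C} (hT : IsARTriangle T) {M : C}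
    (hM : Indecomposable M) :
    ((¬ ∃ i : ℤ, Nonempty (M ≅ T.obj₃⟦i⟧)) →
      B (clsT M) (hatT T) = 0 ∧ BQ (clsQ M) ((1 + tQ⁻¹)⁻¹ • hatQ T) = 0) ∧
    (Nonempty (M ≅ T.obj₃) →
      B (clsT M) (hatT T) = 1 + tZ ∧ BQ (clsQ M) ((1 + tQ⁻¹)⁻¹ • hatQ T) = 1) ∧
    ((¬ ∃ i : ℤ, Nonempty (M ≅ T.obj₁⟦i⟧)) →
      B (hatT T) (clsT M) = 0 ∧ BQ ((1 + tQ)⁻¹ • hatQ T) (clsQ M) = 0) ∧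
    (Nonempty (M ≅ T.obj₁) →
      B (hatT T) (clsT M) = 1 + tZ ∧ BQ ((1 + tQ)⁻¹ • hatQ T) (clsQ M) = 1) := by
  have hr : B (clsT M) (hatT T) =
      homPoly k M T.obj₁ + homPoly k M T.obj₃ - homPoly k M T.obj₂ := by
    rw [hatT, map_sub, map_add, h.isFormT_apply hB, h.isFormT_apply hB, h.isFormT_apply hB]
  have hl : B (hatT T) (clsT M) =
      homPoly k T.obj₁ M + homPoly k T.obj₃ M - homPoly k T.obj₂ M := by
    rw [hatT, map_sub, map_add, LinearMap.sub_apply, LinearMap.add_apply,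
      h.isFormT_apply hB, h.isFormT_apply hB, h.isFormT_apply hB]
  have hh : hatQ T = 1 ⊗ₜ[Zt] hatT T := by
    rw [hatQ, hatT, TensorProduct.tmul_sub, TensorProduct.tmul_add]
    rfl
  have h1 : (1 + tQ : Qt) ≠ 0 := by
    intro h0
    have : (1 + Polynomial.X : Polynomial ℚ) = 0 := by
      apply RatFunc.algebraMap_injective ℚ
      rw [map_add, map_one, RatFunc.algebraMap_X, h0, map_zero]
    have := congrArg (Polynomial.eval 0) this
    simp at this
  -- Semilinearity in the second variable turns the factor `(1 + tQ⁻¹)⁻¹` into `(1 + tQ)⁻¹`.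
  have hQr : BQ (clsQ M) ((1 + tQ⁻¹)⁻¹ • hatQ T) =
      (1 + tQ)⁻¹ * algebraMap Zt Qt (B (clsT M) (hatT T)) := by
    rw [LinearMap.map_smulₛₗ, hh, clsQ, h.isFormQ_tmul hB hBQ, map_inv₀, map_add, map_one,
      map_inv₀, barQ_t, inv_inv, smul_eq_mul]
  have hQl : BQ ((1 + tQ)⁻¹ • hatQ T) (clsQ M) =
      (1 + tQ)⁻¹ * algebraMap Zt Qt (B (hatT T) (clsT M)) := by
    rw [LinearMap.map_smul, LinearMap.smul_apply, hh, clsQ, h.isFormQ_tmul hB hBQ, smul_eq_mul]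
  have hone : (1 + tQ)⁻¹ * algebraMap Zt Qt (1 + tZ) = 1 := by
    rw [map_add, map_one, algebraMap_t, inv_mul_cancel₀ h1]
  refine ⟨fun hi => ?_, fun ⟨e⟩ => ?_, fun hi => ?_, fun ⟨e⟩ => ?_⟩
  · rw [hQr, hr, h.homPoly_hat_right_eq_zero hT hM hi]
    simp
  · rw [hQr, hr, h.homPoly_hat_right_eq hT hM e]
    exact ⟨rfl, hone⟩
  · rw [hQl, hl, h.homPoly_hat_left_eq_zero hT hM hi]
    simp
  · rw [hQl, hl, h.homPoly_hat_left_eq hT hM e]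
    exact ⟨rfl, hone⟩

end AuslanderReiten

/-! ### Finite dimensional local algebras and decompositions with local endomorphism rings. -/

/-- A finite dimensional algebra without nontrivial idempotents is local. -/
theorem isLocalRing_of_forall_isIdempotentElem (k : Type*) [Field k] {R : Type*} [Ring R]
    [Algebra k R] [FiniteDimensional k R] [Nontrivial R]
    (hR : ∀ e : R, IsIdempotentElem e → e = 0 ∨ e = 1) : IsLocalRing R where
  isUnit_or_isUnit_of_add_one {a b} hab := by
    obtain rfl : b = 1 - a := (sub_eq_of_eq_add' hab.symm).symm
    -- Fitting decomposition: write the minimal polynomial as X^n q with X not dividing q. A Bézout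
    -- relation gives an idempotent polynomial in a; if it is 0 then a is nilpotent, if it is 1 then
    -- a is invertible.
    obtain ⟨q, hq, hXq⟩ := Polynomial.exists_eq_pow_rootMultiplicity_mul_and_not_dvd (minpoly k a)
      (minpoly.ne_zero (Algebra.IsIntegral.isIntegral a)) 0
    rw [map_zero, sub_zero] at hq hXq
    set n := Polynomial.rootMultiplicity 0 (minpoly k a)
    -- The exponent n + 1 leaves a factor X to split off, even when n = 0; this yields the inverse
    -- of a below.
    have hc : IsCoprime ((Polynomial.X : Polynomial k) ^ (n + 1)) q :=
      IsCoprime.pow_left ((Polynomial.irreducible_X.coprime_iff_not_dvd).2 hXq)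
    obtain ⟨u, v, huv⟩ := hc
    have h0 : Polynomial.aeval a (Polynomial.X ^ n * q) = 0 := by
      rw [← hq]
      exact minpoly.aeval k a
    have hvq : v * q = 1 - u * Polynomial.X ^ (n + 1) := by
      rw [← huv]
      ring
    have he : IsIdempotentElem (Polynomial.aeval a (u * Polynomial.X ^ (n + 1))) := by
      have h1 : u * Polynomial.X ^ (n + 1) * (u * Polynomial.X ^ (n + 1)) =
          u * Polynomial.X ^ (n + 1) - u * Polynomial.X * v * (Polynomial.X ^ n * q) := by
        linear_combination (u * Polynomial.X ^ (n + 1)) * hvq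
      rw [IsIdempotentElem, ← map_mul, h1, map_sub, map_mul _ _ (Polynomial.X ^ n * q), h0,
        mul_zero, sub_zero]
    rcases hR _ he with h | h
    · right
      have hn : a ^ n = 0 := by
        have : Polynomial.aeval a (v * (Polynomial.X ^ n * q)) = a ^ n := by
          rw [show v * (Polynomial.X ^ n * q) =
            Polynomial.X ^ n * (1 - u * Polynomial.X ^ (n + 1)) by rw [← hvq]; ring, map_mul,
            map_sub, h]
          simp
        rw [← this, map_mul, h0, mul_zero]
      exact IsNilpotent.isUnit_one_sub ⟨n, hn⟩
    · left
      have h1 : Polynomial.aeval a (u * Polynomial.X ^ n) * a = 1 := by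
        rw [← h, pow_succ, ← mul_assoc, map_mul _ (u * Polynomial.X ^ n), Polynomial.aeval_X]
      have h2 : a * Polynomial.aeval a (u * Polynomial.X ^ n) = 1 := by
        rw [← h, show u * Polynomial.X ^ (n + 1) = Polynomial.X * (u * Polynomial.X ^ n) by ring,
          map_mul _ Polynomial.X, Polynomial.aeval_X]
      exact ⟨⟨a, _, h2, h1⟩, rfl⟩

section Decompositions

variable {C : Type*} [Category* C] [Preadditive C] [HasZeroObject C] [HasShift C ℤ]
  [∀ n : ℤ, (shiftFunctor C n).Additive] [Pretriangulated C]

/-- The object is a finite direct sum of objects with local endomorphism rings. -/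
def HasLocalDecomposition (X : C) : Prop :=
  ∃ (n : ℕ) (f : Fin n → C), (∀ i, IsLocalRing (End (f i))) ∧ Nonempty (X ≅ ⨁ f)

theorem isKrullSchmidt_of_hasLocalDecomposition (h : ∀ X : C, HasLocalDecomposition X) :
    IsKrullSchmidt C := fun X => by
  obtain ⟨n, f, hf, ⟨e⟩⟩ := h X
  exact ⟨⟨n, f, fun i => indecomposable_of_isLocalRing_end (hf i), e⟩, hf⟩

theorem HasLocalDecomposition.of_iso {X Y : C} (h : HasLocalDecomposition X) (e : Y ≅ X) :
    HasLocalDecomposition Y := by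
  obtain ⟨n, f, hf, ⟨e'⟩⟩ := h
  exact ⟨n, f, hf, ⟨e ≪≫ e'⟩⟩

theorem HasLocalDecomposition.of_isZero {X : C} (hX : IsZero X) : HasLocalDecomposition X :=
  ⟨0, Fin.elim0, fun i => i.elim0, ⟨hX.iso (isZero_biproduct_fin_zero _)⟩⟩

theorem HasLocalDecomposition.cons {S X : C} (hS : IsLocalRing (End S))
    (h : HasLocalDecomposition X) : HasLocalDecomposition (S ⊞ X) := by
  obtain ⟨n, f, hf, ⟨e⟩⟩ := h
  exact ⟨n + 1, Fin.cons S f, Fin.cases hS hf,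
    ⟨biprod.mapIso (Iso.refl S) e ≪≫ (biproductFinSuccIso (Fin.cons S f)).symm⟩⟩

theorem isZero_biprod_iso {X Y : C} (hX : IsZero X) : Nonempty (X ⊞ Y ≅ Y) :=
  ⟨{hom := biprod.snd
    inv := biprod.inr
    hom_inv_id := biprod.hom_ext' _ _ (hX.eq_of_src _ _) (by simp)
    inv_hom_id := by simp }⟩

theorem HasLocalDecomposition.of_isLocalRing {S : C} (hS : IsLocalRing (End S)) :
    HasLocalDecomposition S := by
  obtain ⟨e⟩ := isZero_biprod_iso (Y := S) (isZero_zero C)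
  exact ((HasLocalDecomposition.of_isZero (isZero_zero C)).cons hS).of_iso
    (e.symm ≪≫ biprod.braiding _ _)

theorem HasLocalDecomposition.biprod {X Y : C} (hX : HasLocalDecomposition X)
    (hY : HasLocalDecomposition Y) : HasLocalDecomposition (X ⊞ Y) := by
  obtain ⟨n, f, hf, ⟨e⟩⟩ := hX
  induction n generalizing X with
  | zero =>
    obtain ⟨e'⟩ := isZero_biprod_iso (Y := Y) ((isZero_biproduct_fin_zero f).of_iso e)
    exact hY.of_iso e'
  | succ n ih =>
    have := ih (X := ⨁ fun j : Fin n => f j.succ) (fun j => f j.succ) (fun j => hf _) (Iso.refl _)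
    exact (this.cons (hf 0)).of_iso
      (biprod.mapIso (e ≪≫ biproductFinSuccIso f) (Iso.refl Y) ≪≫ biprod.associator _ _ _)

end Decompositions

/-! ### Perfect complexes: finiteness and retracts. -/

section Perfect

variable {k : Type*} [Field k] {Λ : Type w} [Ring Λ] [Algebra k Λ]

open ModuleCat in
theorem finiteDimensional_of_moduleFinite [FiniteDimensional k Λ] (M : ModuleCat.{x} Λ)
    [Module.Finite Λ M] : FiniteDimensional k M :=
  Module.Finite.trans Λ M

open ModuleCat in
theorem finiteDimensional_moduleCat_hom [FiniteDimensional k Λ] (M N : ModuleCat.{x} Λ)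
    [Module.Finite Λ M] [Module.Finite Λ N] : FiniteDimensional k (M ⟶ N) := by
  have := finiteDimensional_of_moduleFinite (k := k) M
  have := finiteDimensional_of_moduleFinite (k := k) N
  let f : (M ⟶ N) →ₗ[k] (M →ₗ[k] N) :=
    { toFun := fun g => g.hom.restrictScalars k
      map_add' := fun _ _ => rfl
      map_smul' := fun _ _ => rfl }
  refine FiniteDimensional.of_injective f fun g g' h => ?_
  ext m
  exact LinearMap.congr_fun h m

/-- Cochains between bounded complexes are determined by finitely many components. -/
theorem IsPerfectComplex.finiteDimensional_cochain [FiniteDimensional k Λ]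
    {K L : CochainComplex (ModuleCat.{x} Λ) ℤ} (hK : IsPerfectComplex Λ K)
    (hL : IsPerfectComplex Λ L) (n : ℤ) :
    FiniteDimensional k (CochainComplex.HomComplex.Cochain K L n) := by
  obtain ⟨a, b, hab⟩ := hK.bounded
  have := fun i => hK.finite i
  have := fun i => hL.finite i
  have := fun i j => finiteDimensional_moduleCat_hom (k := k) (K.X i) (L.X j)
  let f : CochainComplex.HomComplex.Cochain K L n →ₗ[k]
      (∀ i : Finset.Icc a b, K.X i.1 ⟶ L.X (i.1 + n)) :=
    { toFun := fun z i => z.v i.1 (i.1 + n) rfl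
      map_add' := fun _ _ => rfl
      map_smul' := fun _ _ => rfl }
  refine FiniteDimensional.of_injective f fun z z' h => ?_
  ext p q hpq : 1
  subst hpq
  by_cases hp : p ∈ Finset.Icc a b
  · exact congrFun h ⟨p, hp⟩
  · rw [Finset.mem_Icc] at hp
    exact (hab p (by omega)).eq_of_src _ _

theorem IsPerfectComplex.finiteDimensional_hom [FiniteDimensional k Λ]
    {K L : CochainComplex (ModuleCat.{x} Λ) ℤ} (hK : IsPerfectComplex Λ K)
    (hL : IsPerfectComplex Λ L) : FiniteDimensional k (K ⟶ L) := by
  have := hK.finiteDimensional_cochain (k := k) hL 0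
  let f : (K ⟶ L) →ₗ[k] CochainComplex.HomComplex.Cochain K L 0 :=
    { toFun := fun g => CochainComplex.HomComplex.Cochain.ofHom g
      map_add' := fun _ _ => by simp
      map_smul' := fun a g => by
        ext p
        simp }
  exact FiniteDimensional.of_injective f fun z z' h =>
    CochainComplex.HomComplex.Cochain.ofHom_injective h

theorem IsPerfectComplex.of_retract {K L : CochainComplex (ModuleCat.{x} Λ) ℤ}
    (hK : IsPerfectComplex Λ K) (i : L ⟶ K) (p : K ⟶ L) (hip : i ≫ p = 𝟙 L) :
    IsPerfectComplex Λ L := by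
  have hn : ∀ n, i.f n ≫ p.f n = 𝟙 _ := fun n => by
    rw [← HomologicalComplex.comp_f, hip, HomologicalComplex.id_f]
  have hn' : ∀ n (y : L.X n), p.f n (i.f n y) = y := fun n y =>
    ConcreteCategory.congr_hom (hn n) y
  obtain ⟨a, b, hab⟩ := hK.bounded
  refine ⟨fun n => ?_, fun n => ?_, a, b, fun n h => ?_⟩
  · have := hK.finite n
    exact Module.Finite.of_surjective (p.f n).hom fun y => ⟨i.f n y, hn' n y⟩
  · have := hK.projective n
    exact Module.Projective.of_split (i.f n).hom (p.f n).hom (LinearMap.ext (hn' n))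
  · rw [IsZero.iff_id_eq_zero, ← hn n, (hab n h).eq_zero_of_tgt (i.f n), zero_comp]

/-- The morphism of `D^b(Λ-proj)` given by a chain map. -/
def Perf.map {K L : CochainComplex (ModuleCat.{x} Λ) ℤ} {hK : IsPerfectComplex Λ K}
    {hL : IsPerfectComplex Λ L} (f : K ⟶ L) : Perf.of K hK ⟶ Perf.of L hL :=
  ObjectProperty.homMk ((HomotopyCategory.quotient _ _).map f)

end Perfect

/-- Nonzero quotients of local rings are local. -/
theorem isLocalRing_of_surjective_ringHom {R S : Type*} [Ring R] [Ring S] [Nontrivial S]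
    (f : R →+* S) (hf : Function.Surjective f) (h : IsLocalRing R) : IsLocalRing S where
  isUnit_or_isUnit_of_add_one {a b} hab := by
    obtain ⟨a, rfl⟩ := hf a
    obtain rfl : b = f (1 - a) := by
      rw [map_sub, map_one, ← hab, add_sub_cancel_left]
    exact (h.isUnit_or_isUnit_of_add_one (add_sub_cancel a 1)).imp (fun h => h.map f)
      (fun h => h.map f)

/-- A proper retract has a smaller endomorphism ring. -/
theorem finrank_end_retract_lt {k : Type*} [Field k] {C : Type*} [Category* C] [Preadditive C]
    [Linear k C] {X Y : C} [FiniteDimensional k (X ⟶ X)] (i : Y ⟶ X) (p : X ⟶ Y)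
    (hip : i ≫ p = 𝟙 Y) (hpi : p ≫ i ≠ 𝟙 X) :
    Module.finrank k (Y ⟶ Y) < Module.finrank k (X ⟶ X) := by
  let f : (Y ⟶ Y) →ₗ[k] (X ⟶ X) := (Linear.leftComp k X p).comp (Linear.rightComp k Y i)
  have hf : Function.Injective f := fun g g' h => by
    have : i ≫ (p ≫ g ≫ i) ≫ p = i ≫ (p ≫ g' ≫ i) ≫ p := congrArg (fun u => i ≫ u ≫ p) h
    simpa [hip, reassoc_of% hip] using this
  have := FiniteDimensional.of_injective f hf
  refine lt_of_le_of_ne (LinearMap.finrank_le_finrank_of_injective hf) fun heq => hpi ?_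
  -- Equal dimensions would make the embedding `g ↦ p ≫ g ≫ i` surjective; writing the identity in
  -- this form forces `p ≫ i` to be the identity.
  obtain ⟨g, hg⟩ := (LinearMap.injective_iff_surjective_of_finrank_eq_finrank heq).1 hf (𝟙 X)
  have hg : p ≫ g ≫ i = 𝟙 X := hg
  calc p ≫ i = p ≫ i ≫ p ≫ g ≫ i := by rw [hg, Category.comp_id]
    _ = 𝟙 X := by rw [reassoc_of% hip, hg]

/-! ### Krull–Schmidt property of perfect complexes, and dimensions of Hom spaces. -/

section Perfect

variable {k : Type*} [Field k] {Λ : Type w} [Ring Λ] [Algebra k Λ]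

namespace Perf

variable {K L M : CochainComplex (ModuleCat.{x} Λ) ℤ} {hK : IsPerfectComplex Λ K}
    {hL : IsPerfectComplex Λ L} {hM : IsPerfectComplex Λ M}

theorem map_id : Perf.map (hK := hK) (hL := hK) (𝟙 K) = 𝟙 _ := by
  ext1
  exact (HomotopyCategory.quotient _ _).map_id K

theorem map_comp (f : K ⟶ L) (g : L ⟶ M) :
    Perf.map (hK := hK) (hL := hM) (f ≫ g) =
      Perf.map (hK := hK) (hL := hL) f ≫ Perf.map (hK := hL) (hL := hM) g := by
  ext1
  exact (HomotopyCategory.quotient _ _).map_comp f g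

theorem map_add (f g : K ⟶ L) :
    Perf.map (hK := hK) (hL := hL) (f + g) =
      Perf.map (hK := hK) (hL := hL) f + Perf.map (hK := hK) (hL := hL) g := by
  ext1
  exact (HomotopyCategory.quotient _ _).map_add

theorem map_surjective (f : Perf.of K hK ⟶ Perf.of L hL) : ∃ g : K ⟶ L, Perf.map g = f := by
  obtain ⟨g, hg⟩ := (HomotopyCategory.quotient _ _).map_surjective f.hom
  exact ⟨g, by ext1; exact hg⟩

/-- Every object is given by a perfect complex. -/
theorem exists_of (X : Perf.{x} Λ) : ∃ K hK, X = Perf.of K hK :=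
  ⟨X.obj.as, X.property, rfl⟩

theorem map_smul (a : k) (f : K ⟶ L) :
    Perf.map (hK := hK) (hL := hL) (a • f) = a • Perf.map (hK := hK) (hL := hL) f := by
  ext1
  exact (HomotopyCategory.quotient _ _).map_smul a f

/-- Shifts in `D^b(Λ-proj)` are given by shifts of complexes. -/
def shiftIso (hL : IsPerfectComplex Λ L) (i : ℤ) :
    (Perf.of L hL)⟦i⟧ ≅ Perf.of (L⟦i⟧) (hL.shift i) :=
  (perfectProp.{x} Λ).ι.preimageIso
    (((perfectProp.{x} Λ).ι.commShiftIso i).app (Perf.of L hL) ≪≫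
      (((HomotopyCategory.quotient (ModuleCat.{x} Λ) (ComplexShape.up ℤ)).commShiftIso i).app
        L).symm)

/-- The ring homomorphism from chain endomorphisms to endomorphisms up to homotopy. -/
def endRingHom (hK : IsPerfectComplex Λ K) : End K →+* End (Perf.of K hK) where
  toFun f := Perf.map (hK := hK) (hL := hK) f
  map_one' := map_id
  map_mul' f g := map_comp (hL := hK) g f
  map_zero' := by
    have : Perf.map (hK := hK) (hL := hK) ((0 : K ⟶ K) + 0) = _ := map_add _ _
    rwa [add_zero, left_eq_add] at this
  map_add' f g := map_add f g

variable (k) in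
/-- Perfect complexes decompose into perfect complexes whose endomorphism rings up to homotopy are
local. -/
theorem hasLocalDecomposition [FiniteDimensional k Λ] (hK : IsPerfectComplex Λ K) :
    HasLocalDecomposition (Perf.of K hK) := by
  -- The induction is on chain endomorphisms rather than homotopy classes: idempotent chain maps
  -- split degreewise, and a proper retract has strictly fewer chain endomorphisms.
  induction hn : Module.finrank k (K ⟶ K) using Nat.strong_induction_on generalizing K with
  | _ n ih =>
    subst hn
    have hfin : FiniteDimensional k (K ⟶ K) := hK.finiteDimensional_hom hK
    have hfin' : FiniteDimensional k (End K) := hfin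
    by_cases h : ∀ e : End K, IsIdempotentElem e → e = 0 ∨ e = 1
    -- K may be contractible without being zero; then the decomposition is empty.
    · by_cases hz : IsZero (Perf.of K hK)
      · exact .of_isZero hz
      · have hz' : Nontrivial (End (Perf.of K hK)) := by
          rw [← not_subsingleton_iff_nontrivial, ← isZero_iff_subsingleton_end]
          exact hz
        have : Nontrivial (End K) := (endRingHom hK).domain_nontrivial
        exact .of_isLocalRing (isLocalRing_of_surjective_ringHom (endRingHom hK) map_surjective
          (isLocalRing_of_forall_isIdempotentElem k h))
    · push Not at h
      obtain ⟨e, he, h0, h1⟩ := h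
      have he : e ≫ e = e := he
      have h0 : e ≠ (0 : K ⟶ K) := h0
      have h1 : e ≠ 𝟙 K := h1
      obtain ⟨Y, i, p, hip, hpi⟩ := IsIdempotentComplete.idempotents_split K e he
      obtain ⟨Z, j, q, hjq, hqj⟩ := IsIdempotentComplete.idempotents_split K (𝟙 K - (show K ⟶ K from e))
        (by simp only [Preadditive.sub_comp, Preadditive.comp_sub, he, Category.id_comp,
          Category.comp_id, sub_self, sub_zero])
      have hY := hK.of_retract i p hip
      have hZ := hK.of_retract j q hjq
      have hYd := ih _ (finrank_end_retract_lt (k := k) i p hip (by rwa [hpi])) hY rfl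
      have hZd := ih _ (finrank_end_retract_lt (k := k) j q hjq
        (by rw [hqj]; exact fun h => h0 (by simpa using h))) hZ rfl
      refine (hYd.biprod hZd).of_iso (isoBiprodOfTotal (Perf.map i) (Perf.map p) (Perf.map j)
        (Perf.map q) ?_ ?_ ?_)
      · rw [← map_comp, hip, map_id]
      · rw [← map_comp, hjq, map_id]
      · rw [← map_comp, ← map_comp, ← map_add, hpi, hqj, add_sub_cancel, map_id]

variable (k) in
/-- Chain maps modulo homotopy. -/
def mapLinear (hK : IsPerfectComplex Λ K) (hL : IsPerfectComplex Λ L) :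
    (K ⟶ L) →ₗ[k] (Perf.of K hK ⟶ Perf.of L hL) where
  toFun := Perf.map
  map_add' := map_add
  map_smul' := map_smul

variable (k) in
theorem formHypothesis [FiniteDimensional k Λ] : FormHypothesis k (Perf.{x} Λ) where
  krullSchmidt := isKrullSchmidt_of_hasLocalDecomposition fun X => by
    obtain ⟨K, hK, rfl⟩ := exists_of X
    exact hasLocalDecomposition k hK
  homFinite X Y := by
    obtain ⟨K, hK, rfl⟩ := exists_of X
    obtain ⟨L, hL, rfl⟩ := exists_of Y
    have := hK.finiteDimensional_hom (k := k) hL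
    exact Module.Finite.of_surjective (mapLinear k hK hL) map_surjective
  finite_shifts X Y := by
    obtain ⟨K, hK, rfl⟩ := exists_of X
    obtain ⟨L, hL, rfl⟩ := exists_of Y
    obtain ⟨a, b, hab⟩ := hK.bounded
    obtain ⟨a', b', hab'⟩ := hL.bounded
    -- Outside this range the degrees occupied by K and by L[i] are disjoint, so even the chain maps
    -- vanish.
    refine (Set.finite_Icc (a' - b) (b' - a)).subset fun i hi => ?_
    by_contra hi'
    rw [Set.mem_Icc] at hi'
    have h0 : ∀ f : K ⟶ L⟦i⟧, f = 0 := fun f => by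
      ext n : 1
      by_cases hn : n < a ∨ b < n
      · exact (hab n hn).eq_of_src _ _
      · exact (hab' (n + i) (by omega)).eq_of_tgt _ _
    obtain ⟨f, g, hfg⟩ := hi
    refine hfg ?_
    rw [← cancel_mono (shiftIso hL i).hom]
    obtain ⟨f', hf'⟩ := map_surjective (f ≫ (shiftIso hL i).hom)
    obtain ⟨g', hg'⟩ := map_surjective (g ≫ (shiftIso hL i).hom)
    rw [← hf', ← hg', h0 f', h0 g']

open CochainComplex.HomComplex

/-- The map from cocycles to morphisms up to homotopy. -/
def ofCocycle (hK : IsPerfectComplex Λ K) (hL : IsPerfectComplex Λ L) (i : ℤ) :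
    (δ_hom k K L i (i + 1)).ker →ₗ[k] (Perf.of K hK ⟶ Perf.of (L⟦i⟧) (hL.shift i)) where
  toFun z := Perf.map (Cocycle.equivHomShift.symm (Cocycle.mk z.1 (i + 1) rfl z.2))
  map_add' z z' := by
    rw [← map_add, ← _root_.map_add]
    rfl
  map_smul' a z := by
    rw [← map_smul]
    congr 1

theorem ofCocycle_surjective (hK : IsPerfectComplex Λ K) (hL : IsPerfectComplex Λ L) (i : ℤ) :
    Function.Surjective (ofCocycle (k := k) hK hL i) := fun f => by
  obtain ⟨g, rfl⟩ := map_surjective f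
  let z := Cocycle.equivHomShift g
  refine ⟨⟨z.1, z.δ_eq_zero _⟩, ?_⟩
  exact congrArg Perf.map (Cocycle.equivHomShift.symm_apply_apply g)

/-- A cocycle becomes zero up to homotopy exactly when it is a coboundary. -/
theorem ker_ofCocycle (hK : IsPerfectComplex Λ K) (hL : IsPerfectComplex Λ L) (i : ℤ) :
    (ofCocycle (k := k) hK hL i).ker =
      ((δ_hom k K L (i - 1) i).range).submoduleOf (δ_hom k K L i (i + 1)).ker := by
  ext z
  have := CohomologyClass.toHom_mk_eq_zero_iff (Cocycle.mk z.1 (i + 1) rfl z.2)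
  rw [mem_coboundaries_iff _ (i - 1) (by omega)] at this
  refine Iff.trans ⟨fun h => ?_, fun h => ?_⟩ this
  · exact congrArg (perfectProp.{x} Λ).ι.map h
  · exact ObjectProperty.hom_ext _ h

/-- Hom(K, L[i]) is the i-th cohomology of the Hom complex. Every later comparison of Hom
polynomials is reduced by this formula to comparing cochain dimensions and ranks of differentials.
-/
theorem finrank_hom_shift [FiniteDimensional k Λ] (hK : IsPerfectComplex Λ K)
    (hL : IsPerfectComplex Λ L) (i : ℤ) :
    Module.finrank k (Perf.of K hK ⟶ (Perf.of L hL)⟦i⟧) +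
      Module.finrank k (δ_hom k K L i (i + 1)).range +
      Module.finrank k (δ_hom k K L (i - 1) i).range = Module.finrank k (Cochain K L i) := by
  have := fun n => hK.finiteDimensional_cochain (k := k) hL n
  have e₁ := LinearMap.finrank_range_add_finrank_ker (δ_hom k K L i (i + 1))
  have e₂ := LinearMap.finrank_range_add_finrank_ker (ofCocycle (k := k) hK hL i)
  have hle : (δ_hom k K L (i - 1) i).range ≤ (δ_hom k K L i (i + 1)).ker := by
    rintro _ ⟨z, rfl⟩
    exact δ_δ _ _ _ _
  rw [LinearMap.range_eq_top.2 (ofCocycle_surjective hK hL i), finrank_top, ker_ofCocycle,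
    (Submodule.submoduleOfEquivOfLe hle).finrank_eq] at e₂
  rw [(Linear.homCongr k (Iso.refl (Perf.of K hK)) (shiftIso hL i)).finrank_eq]
  omega

end Perf

end Perfect

/-! ### Traces on projective modules over a symmetric algebra. -/

section SymmetricTrace

/-- A finite family of vectors and coordinate functions of a finitely generated projective
module. -/
structure CoordSystem (Λ P : Type*) [Ring Λ] [AddCommGroup P] [Module Λ P] where
  n : ℕ
  vec : Fin n → P
  coord : Fin n → (P →ₗ[Λ] Λ)
  sum_smul : ∀ p, ∑ j, coord j p • vec j = p

/-- The dual basis lemma: a surjection Λ^n → P splits, and the coordinates of the splitting serve.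
-/
theorem nonempty_coordSystem (Λ P : Type*) [Ring Λ] [AddCommGroup P] [Module Λ P]
    [Module.Finite Λ P] [Module.Projective Λ P] : Nonempty (CoordSystem Λ P) := by
  obtain ⟨n, f, hf⟩ := Module.Finite.exists_fin' Λ P
  obtain ⟨g, hg⟩ := Module.projective_lifting_property f LinearMap.id hf
  refine ⟨⟨n, fun j => f (Pi.single j 1), fun j => (LinearMap.proj j).comp g, fun p => ?_⟩⟩
  conv_rhs => rw [← LinearMap.id_apply (R := Λ) p, ← hg, LinearMap.comp_apply,
    ← Finset.univ_sum_single (g p)]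
  rw [map_sum]
  refine Finset.sum_congr rfl fun j _ => ?_
  rw [← map_smul, ← Pi.single_smul, smul_eq_mul, mul_one]
  rfl

/-- Coordinates on a finitely generated projective module. -/
def coordSystem (Λ P : Type*) [Ring Λ] [AddCommGroup P] [Module Λ P]
    [Module.Finite Λ P] [Module.Projective Λ P] : CoordSystem Λ P :=
  (nonempty_coordSystem Λ P).some

variable {k : Type*} [Field k] {Λ : Type w} [Ring Λ] [Algebra k Λ]

/-- The trace form on endomorphisms of a finitely generated projective module over an algebra with
a linear form. -/
def formTrace (l : Λ →ₗ[k] k) (P : ModuleCat.{x} Λ) [Module.Finite Λ P] [Module.Projective Λ P] :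
    (P ⟶ P) →ₗ[k] k where
  toFun f := ∑ j, l ((coordSystem Λ P).coord j (f ((coordSystem Λ P).vec j)))
  map_add' f g := by
    simp [Finset.sum_add_distrib]
  map_smul' a f := by
    rw [RingHom.id_apply, smul_eq_mul, Finset.mul_sum]
    refine Finset.sum_congr rfl fun j _ => ?_
    change l ((coordSystem Λ P).coord j (algebraMap k Λ a • f ((coordSystem Λ P).vec j))) = _
    rw [map_smul, smul_eq_mul, ← Algebra.smul_def, map_smul, smul_eq_mul]

theorem formTrace_apply (l : Λ →ₗ[k] k) (P : ModuleCat.{x} Λ) [Module.Finite Λ P]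
    [Module.Projective Λ P] (f : P ⟶ P) : formTrace l P f =
      ∑ j, l ((coordSystem Λ P).coord j (f ((coordSystem Λ P).vec j))) := rfl

variable {l : Λ →ₗ[k] k}

/-- In coordinates of both modules each side is a double sum of values of l on products of matrix
entries, and l does not see the order of the factors. -/
theorem formTrace_comp (hl : ∀ a b, l (a * b) = l (b * a)) {P Q : ModuleCat.{x} Λ}
    [Module.Finite Λ P] [Module.Projective Λ P]
    [Module.Finite Λ Q] [Module.Projective Λ Q] (f : P ⟶ Q) (g : Q ⟶ P) :
    formTrace l P (f ≫ g) = formTrace l Q (g ≫ f) := by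
  have key : ∀ {P Q : ModuleCat.{x} Λ} [Module.Finite Λ P] [Module.Projective Λ P]
      [Module.Finite Λ Q] [Module.Projective Λ Q] (f : P ⟶ Q) (g : Q ⟶ P),
      formTrace l P (f ≫ g) = ∑ i, ∑ j,
        l ((coordSystem Λ Q).coord j (f ((coordSystem Λ P).vec i)) *
          (coordSystem Λ P).coord i (g ((coordSystem Λ Q).vec j))) := by
    intro P Q _ _ _ _ f g
    rw [formTrace_apply]
    refine Finset.sum_congr rfl fun i _ => ?_
    rw [ModuleCat.comp_apply]
    conv_lhs => rw [← (coordSystem Λ Q).sum_smul (f ((coordSystem Λ P).vec i))]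
    simp
  rw [key, key, Finset.sum_comm]
  exact Finset.sum_congr rfl fun j _ => Finset.sum_congr rfl fun i _ => hl _ _

theorem exists_formTrace_ne_zero (hl : ∀ a b, l (a * b) = l (b * a))
    (hl' : ∀ a, (∀ b, l (a * b) = 0) → a = 0)
    {P Q : ModuleCat.{x} Λ} [Module.Finite Λ P] [Module.Projective Λ P]
    [Module.Finite Λ Q] [Module.Projective Λ Q] {f : P ⟶ Q} (hf : f ≠ 0) :
    ∃ g : Q ⟶ P, formTrace l P (f ≫ g) ≠ 0 := by
  obtain ⟨p, hp⟩ : ∃ p, f p ≠ 0 := by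
    by_contra! h
    exact hf (by ext p; exact h p)
  obtain ⟨j, hj⟩ : ∃ j, (coordSystem Λ Q).coord j (f p) ≠ 0 := by
    by_contra! h
    refine hp ?_
    rw [← (coordSystem Λ Q).sum_smul (f p)]
    simp [h]
  obtain ⟨b, hb⟩ : ∃ b, l ((coordSystem Λ Q).coord j (f p) * b) ≠ 0 := by
    by_contra! h
    exact hj (hl' _ h)
  -- The map sending q to its j-th coordinate times bp; composing it with f gives the trace
  -- l(coord_j(f p) b), which is nonzero by the choice of b.
  refine ⟨ModuleCat.ofHom ((LinearMap.toSpanSingleton Λ P (b • p)).comp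
    ((coordSystem Λ Q).coord j)), ?_⟩
  convert! hb using 1
  rw [hl, formTrace_apply]
  conv_rhs => rw [← (coordSystem Λ P).sum_smul p]
  rw [map_sum, map_sum, Finset.mul_sum, map_sum]
  refine Finset.sum_congr rfl fun i _ => ?_
  change l ((coordSystem Λ P).coord i ((coordSystem Λ Q).coord j (f ((coordSystem Λ P).vec i)) •
    (b • p))) = _
  have hf' : f ((coordSystem Λ P).coord i p • (coordSystem Λ P).vec i) =
      (coordSystem Λ P).coord i p • f ((coordSystem Λ P).vec i) := f.hom.map_smul _ _
  rw [LinearMap.map_smul, LinearMap.map_smul, hf', LinearMap.map_smul, smul_eq_mul, smul_eq_mul,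
    smul_eq_mul, hl, mul_assoc]

end SymmetricTrace

/-- Adjoint maps with respect to nondegenerate pairings have the same rank. -/
theorem finrank_range_eq_of_adjoint {k V V' W W' : Type*} [Field k] [AddCommGroup V] [Module k V]
    [AddCommGroup V'] [Module k V'] [AddCommGroup W] [Module k W] [AddCommGroup W'] [Module k W']
    [FiniteDimensional k V] [FiniteDimensional k V'] [FiniteDimensional k W]
    [FiniteDimensional k W']
    (Φ : V →ₗ[k] Module.Dual k W) (Φ' : V' →ₗ[k] Module.Dual k W') (hΦ : Function.Surjective Φ)
    (hΦ' : Function.Injective Φ') (f : V →ₗ[k] V') (g : W' →ₗ[k] W) (c : kˣ)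
    (h : ∀ v w, Φ' (f v) w = c • Φ v (g w)) :
    Module.finrank k f.range = Module.finrank k g.range := by
  -- Injectivity of Φ' preserves the rank of f, surjectivity of Φ preserves the rank of the
  -- transpose of g, and transposing does not change the rank.
  have h₁ : Φ' ∘ₗ f = c • (g.dualMap ∘ₗ Φ) := by
    ext v w
    exact h v w
  have h₂ : Module.finrank k (Φ' ∘ₗ f).range = Module.finrank k f.range := by
    rw [LinearMap.range_comp]
    exact ((Submodule.equivMapOfInjective Φ' hΦ' _).finrank_eq).symm
  have h₃ : (c • (g.dualMap ∘ₗ Φ)).range = g.dualMap.range := by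
    ext y
    constructor
    · rintro ⟨v, rfl⟩
      exact ⟨c • Φ v, by simp [Units.smul_def]⟩
    · rintro ⟨w, rfl⟩
      obtain ⟨v, hv⟩ := hΦ (c⁻¹ • w)
      refine ⟨v, ?_⟩
      simp [hv]
  rw [← h₂, h₁, h₃, LinearMap.finrank_range_dualMap_eq_finrank_range]

/-! ### The supertrace pairing on Hom complexes. -/

section SuperTrace

open CochainComplex.HomComplex

variable {k : Type*} [Field k] {Λ : Type w} [Ring Λ] [Algebra k Λ]
variable {K L : CochainComplex (ModuleCat.{x} Λ) ℤ}

variable (k K L) in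
/-- A component of a cochain, as a linear map. -/
def cochainComponent {n : ℤ} (p q : ℤ) (hpq : p + n = q) :
    Cochain K L n →ₗ[k] (K.X p ⟶ L.X q) where
  toFun z := z.v p q hpq
  map_add' _ _ := rfl
  map_smul' _ _ := rfl

/-- The alternating sum of the traces of the components of a cochain of degree `0`. -/
def superTrace (l : Λ →ₗ[k] k) (hK : IsPerfectComplex Λ K) : Cochain K K 0 →ₗ[k] k :=
  haveI := hK.finite
  haveI := hK.projective
  ∑ p ∈ Finset.Icc hK.bounded.choose hK.bounded.choose_spec.choose,
    (p.negOnePow : ℤ) • (formTrace l (K.X p)).comp (cochainComponent k K K p p (add_zero p))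

/-- A sum over all integers is free of the chosen bounds and may be reindexed by a translation. -/
theorem superTrace_apply (l : Λ →ₗ[k] k) (hK : IsPerfectComplex Λ K) (z : Cochain K K 0) :
    haveI := hK.finite
    haveI := hK.projective
    superTrace l hK z =
      ∑ᶠ p : ℤ, (p.negOnePow : ℤ) • formTrace l (K.X p) (z.v p p (add_zero p)) := by
  have := hK.finite
  have := hK.projective
  rw [finsum_eq_sum_of_support_subset (s := Finset.Icc hK.bounded.choose
    hK.bounded.choose_spec.choose)]
  · rw [superTrace, LinearMap.sum_apply]
    rfl
  · intro p hp
    by_contra h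
    rw [Finset.coe_Icc, Set.mem_Icc] at h
    refine hp ?_
    dsimp only
    rw [(hK.bounded.choose_spec.choose_spec p (by omega)).eq_of_src (z.v p p (add_zero p)) 0,
      map_zero, smul_zero]

variable {l : Λ →ₗ[k] k}

/-- A coboundary is a supercommutator with the differential: by cyclicity of the trace, the terms of
the alternating sum telescope. -/
theorem superTrace_δ (hl : ∀ a b, l (a * b) = l (b * a)) (hK : IsPerfectComplex Λ K)
    (z : Cochain K K (-1)) :
    superTrace l hK (δ (-1) 0 z) = 0 := by
  have := hK.finite
  have := hK.projective
  rw [superTrace_apply]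
  let s : ℤ → k := fun p => formTrace l (K.X p) (z.v p (p - 1) (by omega) ≫ K.d (p - 1) p)
  have hs : ∀ p, (p.negOnePow : ℤ) • formTrace l (K.X p) ((δ (-1) 0 z).v p p (add_zero p)) =
      (p.negOnePow : ℤ) • s p - ((p + 1).negOnePow : ℤ) • s (p + 1) := by
    intro p
    have e : s (p + 1) = formTrace l (K.X p) (K.d p (p + 1) ≫ z.v (p + 1) p (by omega)) := by
      rw [formTrace_comp hl]
      have : ∀ q (hq : p + 1 - 1 = q), s (p + 1) = formTrace l (K.X (p + 1))
          (z.v (p + 1) q (by omega) ≫ K.d q (p + 1)) := by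
        rintro _ rfl
        rfl
      exact this p (by omega)
    rw [δ_v (-1) 0 (by omega) z p p (add_zero p) (p - 1) (p + 1) rfl rfl, map_add, e,
      Int.negOnePow_succ]
    simp [s]
  have hfin : (Function.support fun p : ℤ => (p.negOnePow : ℤ) • s p).Finite := by
    obtain ⟨a, b, hab⟩ := hK.bounded
    refine (Set.finite_Icc a b).subset fun p hp => ?_
    by_contra h
    rw [Set.mem_Icc] at h
    refine hp ?_
    change (p.negOnePow : ℤ) • formTrace l (K.X p) _ = 0
    rw [(hab p (by omega)).eq_of_src (z.v p (p - 1) (by omega) ≫ K.d (p - 1) p) 0,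
      map_zero, smul_zero]
  have hfin' : (Function.support fun p : ℤ => ((p + 1).negOnePow : ℤ) • s (p + 1)).Finite :=
    hfin.preimage (f := fun p : ℤ => p + 1) (add_left_injective 1).injOn
  simp_rw [hs]
  rw [finsum_sub_distrib hfin hfin', sub_eq_zero]
  exact (finsum_comp_equiv (Equiv.addRight (1 : ℤ))).symm

/-- The pairing of cochains given by the trace of the composition. -/
def tracePairing (l : Λ →ₗ[k] k) (hK : IsPerfectComplex Λ K) (L : CochainComplex (ModuleCat.{x} Λ) ℤ)
    (i j : ℤ) (hij : i + j = 0) : Cochain K L i →ₗ[k] Module.Dual k (Cochain L K j) :=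
  LinearMap.mk₂ k (fun z w => superTrace l hK (z.comp w hij))
    (fun _ _ _ => by rw [Cochain.add_comp, map_add])
    (fun _ _ _ => by rw [Cochain.smul_comp, map_smul])
    (fun _ _ _ => by rw [Cochain.comp_add, map_add])
    (fun _ _ _ => by rw [Cochain.comp_smul, map_smul])

/-- Leibniz rule for the composite, which has degree -1, together with the vanishing of the
supertrace on coboundaries. -/
theorem tracePairing_δ (hl : ∀ a b, l (a * b) = l (b * a)) (hK : IsPerfectComplex Λ K)
    (i j i' j' : ℤ) (hi : i + 1 = i')
    (hj : j + 1 = j') (hij : i' + j = 0) (hij' : i + j' = 0) (z : Cochain K L i)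
    (w : Cochain L K j) :
    tracePairing l hK L i' j hij (δ i i' z) w =
      (-j.negOnePow : ℤˣ) • tracePairing l hK L i j' hij' z (δ j j' w) := by
  have h := superTrace_δ hl hK (z.comp w (show i + j = -1 by omega))
  rw [δ_comp z w (show i + j = -1 by omega) i' j' 0 (by omega) hi hj, map_add] at h
  change superTrace l hK _ = (-j.negOnePow : ℤˣ) • superTrace l hK _
  have h' : superTrace l hK (z.comp (δ j j' w) hij') =
      -(j.negOnePow • superTrace l hK ((δ i i' z).comp w hij)) := by
    rw [eq_neg_iff_add_eq_zero, ← h, Units.smul_def, Units.smul_def, map_zsmul]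
  rw [h', Units.neg_smul, smul_neg, neg_neg, smul_smul, Int.units_mul_self, one_smul]

/-- The trace of the composition with a cochain having a single component. -/
theorem superTrace_comp_single (hK : IsPerfectComplex Λ K) {i j : ℤ} (z : Cochain K L i)
    {p q : ℤ} (g : L.X q ⟶ K.X p) (hij : i + j = 0) (hpq : p + i = q) :
    haveI := hK.finite
    haveI := hK.projective
    superTrace l hK (z.comp (Cochain.single g j) hij) =
      (p.negOnePow : ℤ) • formTrace l (K.X p) (z.v p q hpq ≫ g) := by
  have := hK.finite
  have := hK.projective
  rw [superTrace_apply, finsum_eq_single _ p]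
  · rw [Cochain.comp_v z _ hij p q p hpq (by omega), Cochain.single_v]
  · intro p' hp'
    rw [Cochain.comp_v z _ hij p' (p' + i) p' rfl (by omega),
      Cochain.single_v_eq_zero' _ _ _ _ _ hp', comp_zero, map_zero, smul_zero]

theorem superTrace_single_comp (hK : IsPerfectComplex Λ K) {i j : ℤ} (w : Cochain L K j)
    {p q : ℤ} (g : K.X p ⟶ L.X q) (hij : i + j = 0) (hqp : q + j = p) :
    haveI := hK.finite
    haveI := hK.projective
    superTrace l hK ((Cochain.single g i).comp w hij) =
      (p.negOnePow : ℤ) • formTrace l (K.X p) (g ≫ w.v q p hqp) := by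
  have := hK.finite
  have := hK.projective
  rw [superTrace_apply, finsum_eq_single _ p]
  · rw [Cochain.comp_v _ w hij p q p (by omega) hqp, Cochain.single_v]
  · intro p' hp'
    rw [Cochain.comp_v _ w hij p' (p' + i) p' rfl (by omega),
      Cochain.single_v_eq_zero _ _ _ _ _ hp', zero_comp, map_zero, smul_zero]

theorem negOnePow_zsmul_eq_zero {M : Type*} [AddCommGroup M] {p : ℤ} {m : M}
    (h : (p.negOnePow : ℤ) • m = 0) : m = 0 := by
  rwa [← Units.smul_def, smul_eq_zero_iff_eq] at h

/-- A cochain with a nonzero component is detected by a cochain with a single component, by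
nondegeneracy of the trace on modules. -/
theorem tracePairing_injective (hl : ∀ a b, l (a * b) = l (b * a))
    (hl' : ∀ a, (∀ b, l (a * b) = 0) → a = 0)
    (hK : IsPerfectComplex Λ K) (hL : IsPerfectComplex Λ L) (i j : ℤ) (hij : i + j = 0) :
    Function.Injective (tracePairing l hK L i j hij) := by
  have := hK.finite
  have := hK.projective
  have := hL.finite
  have := hL.projective
  rw [← LinearMap.ker_eq_bot, LinearMap.ker_eq_bot']
  intro z hz
  ext p q hpq : 1
  by_contra h
  obtain ⟨g, hg⟩ := exists_formTrace_ne_zero hl hl' h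
  have h0 : superTrace l hK (z.comp (Cochain.single g j) hij) = 0 :=
    LinearMap.congr_fun hz (Cochain.single g j)
  rw [superTrace_comp_single hK z g hij hpq] at h0
  exact hg (negOnePow_zsmul_eq_zero h0)

/-- The pairing is nondegenerate on both sides, so the two finite dimensions agree and injectivity
becomes bijectivity. -/
theorem tracePairing_surjective (hl : ∀ a b, l (a * b) = l (b * a)) [FiniteDimensional k Λ]
    (hl' : ∀ a, (∀ b, l (a * b) = 0) → a = 0)
    (hK : IsPerfectComplex Λ K) (hL : IsPerfectComplex Λ L) (i j : ℤ) (hij : i + j = 0) :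
    Function.Surjective (tracePairing l hK L i j hij) := by
  have := hK.finite
  have := hK.projective
  have := hL.finite
  have := hL.projective
  have := hK.finiteDimensional_cochain (k := k) hL i
  have := hL.finiteDimensional_cochain (k := k) hK j
  have hinj := tracePairing_injective hl hl' hK hL i j hij
  have hinj' : Function.Injective (tracePairing l hK L i j hij).flip := by
    rw [← LinearMap.ker_eq_bot, LinearMap.ker_eq_bot']
    intro w hw
    ext q p hqp : 1
    by_contra h
    obtain ⟨g, hg⟩ := exists_formTrace_ne_zero hl hl' h
    rw [formTrace_comp hl] at hg
    have h0 : superTrace l hK ((Cochain.single g i).comp w hij) = 0 :=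
      LinearMap.congr_fun hw (Cochain.single g i)
    rw [superTrace_single_comp hK w g hij hqp] at h0
    exact hg (negOnePow_zsmul_eq_zero h0)
  have h₁ := LinearMap.finrank_le_finrank_of_injective hinj
  have h₂ := LinearMap.finrank_le_finrank_of_injective hinj'
  rw [Subspace.dual_finrank_eq] at h₁ h₂
  refine (LinearMap.injective_iff_surjective_of_finrank_eq_finrank ?_).1 hinj
  rw [Subspace.dual_finrank_eq]
  omega

theorem finrank_range_δ_eq (hl : ∀ a b, l (a * b) = l (b * a)) [FiniteDimensional k Λ]
    (hl' : ∀ a, (∀ b, l (a * b) = 0) → a = 0) (hK : IsPerfectComplex Λ K)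
    (hL : IsPerfectComplex Λ L) (i j i' j' : ℤ) (hi : i + 1 = i') (hj : j + 1 = j')
    (hij : i' + j = 0) :
    Module.finrank k (δ_hom k K L i i').range = Module.finrank k (δ_hom k L K j j').range := by
  have := fun n => hK.finiteDimensional_cochain (k := k) hL n
  have := fun n => hL.finiteDimensional_cochain (k := k) hK n
  have hij' : i + j' = 0 := by omega
  refine finrank_range_eq_of_adjoint (tracePairing l hK L i j' hij')
    (tracePairing l hK L i' j hij) (tracePairing_surjective hl hl' hK hL i j' hij')
    (tracePairing_injective hl hl' hK hL i' j hij) _ _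
    (Units.map (Int.castRingHom k).toMonoidHom (-j.negOnePow)) fun z w => ?_
  refine (tracePairing_δ hl hK i j i' j' hi hj hij hij' z w).trans ?_
  simp [Units.smul_def]

theorem finrank_cochain_eq (hl : ∀ a b, l (a * b) = l (b * a)) [FiniteDimensional k Λ]
    (hl' : ∀ a, (∀ b, l (a * b) = 0) → a = 0) (hK : IsPerfectComplex Λ K)
    (hL : IsPerfectComplex Λ L) (i j : ℤ) (hij : i + j = 0) :
    Module.finrank k (Cochain K L i) = Module.finrank k (Cochain L K j) := by
  have := fun n => hK.finiteDimensional_cochain (k := k) hL n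
  have := fun n => hL.finiteDimensional_cochain (k := k) hK n
  rw [← Subspace.dual_finrank_eq (V := Cochain L K j)]
  exact (LinearEquiv.ofBijective _ ⟨tracePairing_injective hl hl' hK hL i j hij,
    tracePairing_surjective hl hl' hK hL i j hij⟩).finrank_eq

end SuperTrace

/-- Over a symmetric algebra `∑ tⁱ dim Hom(M, N[i])` is Hermitian. -/
theorem homPoly_perf_hermitian {k : Type*} [Field k] {Λ : Type w} [Ring Λ] [Algebra k Λ]
    (hΛ : IsSymmetricAlgebra k Λ) (M N : Perf.{x} Λ) :
    homPoly k M N = barZ (homPoly k N M) := by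
  have := hΛ.finiteDimensional
  obtain ⟨l, hl, hl'⟩ := hΛ.exists_form
  obtain ⟨K, hK, rfl⟩ := Perf.exists_of M
  obtain ⟨L, hL, rfl⟩ := Perf.exists_of N
  have h := Perf.formHypothesis.{w, x} k (Λ := Λ)
  ext i
  have hb : ∀ p : Zt, (barZ p).coeff i = p.coeff (-i) := fun p =>
    LaurentPolynomial.invert_apply p i
  rw [hb, h.coeff_homPoly, h.coeff_homPoly]
  have e₁ := Perf.finrank_hom_shift (k := k) hK hL i
  have e₂ := Perf.finrank_hom_shift (k := k) hL hK (-i)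
  have e₃ := finrank_cochain_eq hl hl' hK hL i (-i) (by omega)
  -- Duality exchanges roles: the differential leaving degree i is adjoint to the one entering
  -- degree -i, and conversely.
  have e₄ := finrank_range_δ_eq hl hl' hK hL i (-i - 1) (i + 1) (-i) (by omega) (by omega)
    (by omega)
  have e₅ := finrank_range_δ_eq hl hl' hK hL (i - 1) (-i) i (-i + 1) (by omega) (by omega)
    (by omega)
  omega

/-! ### Group algebras and Higman's criterion. -/

section GroupAlgebra

/-- The form is the coefficient at 1; multiplying by `g⁻¹` brings the coefficient at g there, whence
nondegeneracy. -/
theorem isSymmetricAlgebra_monoidAlgebra (k : Type*) [Field k] (G : Type*) [Group G] [Finite G] :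
    IsSymmetricAlgebra k (MonoidAlgebra k G) where
  finiteDimensional := inferInstance
  exists_form := by
    have hs : ∀ (a b : MonoidAlgebra k G), (a * b).coeff 1 = (b * a).coeff 1 := by
      intro a b
      induction a using MonoidAlgebra.induction_linear with
      | zero => simp
      | add x y hx hy => simp [add_mul, mul_add, hx, hy]
      | single g r =>
        rw [MonoidAlgebra.coeff_mul_single_apply, MonoidAlgebra.coeff_single_mul_apply, mul_comm]
        simp
    refine ⟨{ toFun := fun a => a.coeff 1, map_add' := fun _ _ => rfl, map_smul' := fun _ _ => rfl },
      hs, fun a ha => ?_⟩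
    ext g
    have h : (a * MonoidAlgebra.single g⁻¹ 1).coeff 1 = 0 := ha _
    rw [MonoidAlgebra.coeff_mul_single_apply] at h
    simpa using h

variable {k : Type*} [Field k] {G : Type*} [Group G] [Fintype G]

/-- On kG the conjugates of the projection to the coefficient at 1 add up to the identity. This
passes to free modules, and to P through a splitting. -/
theorem exists_averaging_of_projective (P : Type*) [AddCommGroup P] [Module k P]
    [Module (MonoidAlgebra k G) P] [IsScalarTower k (MonoidAlgebra k G) P]
    [Module.Projective (MonoidAlgebra k G) P] :
    ∃ θ : P →ₗ[k] P, ∀ x, ∑ g : G, MonoidAlgebra.single g (1 : k) •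
      θ (MonoidAlgebra.single g⁻¹ (1 : k) • x) = x := by
  obtain ⟨s, hs⟩ := Module.projective_def.mp ‹Module.Projective (MonoidAlgebra k G) P›
  let c : MonoidAlgebra k G →ₗ[k] k :=
    { toFun := fun a => a.coeff 1, map_add' := fun _ _ => rfl, map_smul' := fun _ _ => rfl }
  refine ⟨(Finsupp.linearCombination k (id : P → P)) ∘ₗ (Finsupp.mapRange.linearMap c) ∘ₗ
    s.restrictScalars k, fun x => ?_⟩
  have key : ∀ f : P →₀ MonoidAlgebra k G,
      ∑ g : G, MonoidAlgebra.single g (1 : k) • Finsupp.linearCombination k (id : P → P)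
        (Finsupp.mapRange.linearMap c (MonoidAlgebra.single g⁻¹ (1 : k) • f)) =
      Finsupp.linearCombination (MonoidAlgebra k G) (id : P → P) f := by
    intro f
    induction f using Finsupp.induction_linear with
    | zero => simp
    | add f g hf hg => simp only [smul_add, map_add, Finset.sum_add_distrib, hf, hg]
    | single p a =>
      simp only [Finsupp.smul_single, Finsupp.mapRange.linearMap_apply, Finsupp.mapRange_single,
        Finsupp.linearCombination_single, id]
      have : ∀ g : G, MonoidAlgebra.single g (1 : k) • c (MonoidAlgebra.single g⁻¹ (1 : k) • a) • p =
          MonoidAlgebra.single g (a.coeff g) • p := by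
        intro g
        have : c (MonoidAlgebra.single g⁻¹ (1 : k) • a) = a.coeff g := by
          change (MonoidAlgebra.single g⁻¹ (1 : k) * a).coeff 1 = _
          rw [MonoidAlgebra.coeff_single_mul_apply]; simp
        rw [this, ← algebraMap_smul (MonoidAlgebra k G) (a.coeff g) p, smul_smul]
        simp [MonoidAlgebra.single_mul_single]
      simp only [this]
      rw [← Finset.sum_smul]
      congr 1
      ext h
      classical
      simp [MonoidAlgebra.coeff_sum]
  have h2 : ∀ g : G, s (MonoidAlgebra.single g⁻¹ (1 : k) • x) =
    MonoidAlgebra.single g⁻¹ (1 : k) • s x := fun g => s.map_smul _ _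
  simp only [LinearMap.comp_apply, LinearMap.coe_restrictScalars, h2]
  rw [key, hs x]

/-- Summing the conjugates of a k-linear section precomposed with θ makes it kG-linear, and the
hypothesis on θ says that it remains a section. -/
theorem projective_of_averaging (P : Type*) [AddCommGroup P] [Module k P]
    [Module (MonoidAlgebra k G) P] [IsScalarTower k (MonoidAlgebra k G) P]
    (θ : P →ₗ[k] P) (hθ : ∀ x, ∑ g : G, MonoidAlgebra.single g (1 : k) •
      θ (MonoidAlgebra.single g⁻¹ (1 : k) • x) = x) :
    Module.Projective (MonoidAlgebra k G) P := by
  let p := Finsupp.linearCombination (MonoidAlgebra k G) (id : P → P)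
  have hp : Function.Surjective p := Finsupp.linearCombination_id_surjective _ _
  obtain ⟨σ, hσ⟩ := (p.restrictScalars k).exists_rightInverse_of_surjective
    (LinearMap.range_eq_top.mpr hp)
  have hsm : ∀ (g : G) (c : k) (y : P), MonoidAlgebra.single g (1 : k) • c • y =
      c • MonoidAlgebra.single g (1 : k) • y := fun g c y => by
    rw [smul_algebra_smul_comm]
  let s₀ : P →ₗ[k] (P →₀ MonoidAlgebra k G) :=
    { toFun := fun x => ∑ g : G, MonoidAlgebra.single g (1 : k) •
        σ (θ (MonoidAlgebra.single g⁻¹ (1 : k) • x))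
      map_add' := fun x y => by simp only [smul_add, map_add, Finset.sum_add_distrib]
      map_smul' := fun c x => by
        simp only [hsm, map_smul, RingHom.id_apply, Finset.smul_sum]
        refine Finset.sum_congr rfl fun g _ => ?_
        rw [smul_algebra_smul_comm] }
  have hs₀ : ∀ (h : G) (x : P), s₀ (MonoidAlgebra.single h (1 : k) • x) =
      MonoidAlgebra.single h (1 : k) • s₀ x := by
    intro h x
    simp only [s₀, LinearMap.coe_mk, AddHom.coe_mk, Finset.smul_sum, smul_smul,
      MonoidAlgebra.single_mul_single, one_mul]
    refine Fintype.sum_equiv (Equiv.mulLeft h⁻¹) _ _ fun g => ?_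
    simp
  refine Module.Projective.of_split (MonoidAlgebra.equivariantOfLinearOfComm s₀ hs₀) p ?_
  ext x
  simp only [LinearMap.comp_apply, MonoidAlgebra.equivariantOfLinearOfComm_apply, s₀,
    LinearMap.coe_mk, AddHom.coe_mk, map_sum, map_smul, LinearMap.id_apply]
  have : ∀ y, p (σ y) = y := fun y => LinearMap.congr_fun hσ y
  simp only [this, hθ]

end GroupAlgebra

section RepAveraging

variable {k : Type u} [Field k] {G : Type y} [Group G]

theorem finite_asModule_iff [Finite G] (V : Rep.{u} k G) :
    Module.Finite (MonoidAlgebra k G) V.ρ.asModule ↔ FiniteDimensional k V := by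
  have e : FiniteDimensional k V.ρ.asModule ↔ FiniteDimensional k V := Iff.rfl
  rw [← e]
  refine ⟨fun h => ?_, fun h => Module.Finite.of_restrictScalars_finite k (MonoidAlgebra k G) _⟩
  exact Module.Finite.trans (MonoidAlgebra k G) _

variable [Fintype G]

/-- The identity of `V` is the sum of the conjugates of a linear endomorphism. -/
def HasAveraging (V : Rep.{u} k G) : Prop :=
  ∃ θ : V →ₗ[k] V, ∀ x, ∑ g : G, V.ρ g (θ (V.ρ g⁻¹ x)) = x

/-- Higman's criterion. -/
theorem projective_asModule_iff (V : Rep.{u} k G) :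
    Module.Projective (MonoidAlgebra k G) V.ρ.asModule ↔ HasAveraging V := by
  have e : ∀ (g : G) (x : V.ρ.asModule), MonoidAlgebra.single g (1 : k) • x =
      V.ρ.asModuleEquiv.symm (V.ρ g (V.ρ.asModuleEquiv x)) := by
    intro g x
    rw [Representation.asModuleEquiv_symm_map_rho]; rfl
  constructor
  · intro h
    obtain ⟨θ, hθ⟩ := exists_averaging_of_projective (k := k) (G := G) V.ρ.asModule
    simp only [e] at hθ
    exact ⟨θ, hθ⟩
  · rintro ⟨θ, hθ⟩
    refine projective_of_averaging (k := k) (G := G) V.ρ.asModule θ ?_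
    simp only [e]
    exact hθ

end RepAveraging

/-! ### Tensor products of complexes through inclusions and projections of summands. -/

section TensorComplex

open MonoidalCategory HomologicalComplex

variable {k : Type u} [Field k] {G : Type y} [Group G]
variable (K L : CochainComplex (Rep.{u} k G) ℤ)

/-- The inclusion of a summand of the tensor product of complexes. -/
def tensorι (a b m : ℤ) (h : a + b = m) : K.X a ⊗ L.X b ⟶ (tensorComplex K L).X m :=
  ιTensorObj K L a b m h

variable {K L} in
theorem tensorComplex_hom_ext {m : ℤ} {Y : Rep.{u} k G} {f g : (tensorComplex K L).X m ⟶ Y}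
    (h : ∀ a b hab, tensorι K L a b m hab ≫ f = tensorι K L a b m hab ≫ g) : f = g :=
  mapBifunctor.hom_ext h

variable {K L} in
/-- The morphism from the tensor product given by its restrictions to the summands. -/
def tensorDesc {m : ℤ} {Y : Rep.{u} k G} (f : ∀ a b, a + b = m → (K.X a ⊗ L.X b ⟶ Y)) :
    (tensorComplex K L).X m ⟶ Y :=
  mapBifunctorDesc (K₁ := K) (K₂ := L) (F := curriedTensor (Rep.{u} k G))
    (c := ComplexShape.up ℤ) f

@[simp]
theorem tensorι_desc {m : ℤ} {Y : Rep.{u} k G} (f : ∀ a b, a + b = m → (K.X a ⊗ L.X b ⟶ Y))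
    (a b : ℤ) (h : a + b = m) : tensorι K L a b m h ≫ tensorDesc f = f a b h :=
  ι_mapBifunctorDesc (K₁ := K) (K₂ := L) (F := curriedTensor (Rep.{u} k G))
    (c := ComplexShape.up ℤ) f a b h

theorem tensorι_d (a b m m' a' b' : ℤ) (h : a + b = m) (hm : m + 1 = m') (ha : a + 1 = a')
    (hb : b + 1 = b') :
    tensorι K L a b m h ≫ (tensorComplex K L).d m m' =
      (K.d a a' ▷ L.X b) ≫ tensorι K L a' b m' (by omega) +
        a.negOnePow • (K.X a ◁ L.d b b') ≫ tensorι K L a b' m' (by omega) := by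
  subst hm ha hb
  change ιTensorObj K L a b m h ≫ (HomologicalComplex.tensorObj K L).d m (m + 1) = _
  rw [mapBifunctor.d_eq, Preadditive.comp_add, mapBifunctor.ι_D₁, mapBifunctor.ι_D₂,
    mapBifunctor.d₁_eq _ _ _ _ (show (ComplexShape.up ℤ).Rel a (a + 1) from rfl) _ _
      (show a + 1 + b = m + 1 by omega),
    mapBifunctor.d₂_eq _ _ _ _ _ (show (ComplexShape.up ℤ).Rel b (b + 1) from rfl) _
      (show a + (b + 1) = m + 1 by omega)]
  simp only [ComplexShape.ε₁_def, ComplexShape.ε₂_def, ComplexShape.ε_up_ℤ, one_smul]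
  rfl

theorem tensorι_d_assoc (a b m m' a' b' : ℤ) (h : a + b = m) (hm : m + 1 = m') (ha : a + 1 = a')
    (hb : b + 1 = b') {Z : Rep.{u} k G} (f : (tensorComplex K L).X m' ⟶ Z) :
    tensorι K L a b m h ≫ (tensorComplex K L).d m m' ≫ f =
      ((K.d a a' ▷ L.X b) ≫ tensorι K L a' b m' (by omega) +
        a.negOnePow • (K.X a ◁ L.d b b') ≫ tensorι K L a b' m' (by omega)) ≫ f := by
  rw [← tensorι_d K L a b m m' a' b' h hm ha hb, Category.assoc]

/-- The projection to a summand of the tensor product of complexes. -/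
def tensorπ (a b m : ℤ) (h : a + b = m) : (tensorComplex K L).X m ⟶ K.X a ⊗ L.X b :=
  tensorDesc fun a' b' h' => if ha : a' = a then
    (K.XIsoOfEq ha).hom ⊗ₘ (L.XIsoOfEq (show b' = b by omega)).hom else 0

@[simp]
theorem tensorι_π (a b m : ℤ) (h : a + b = m) :
    tensorι K L a b m h ≫ tensorπ K L a b m h = 𝟙 _ := by
  simp [tensorπ]

theorem tensorι_π_of_ne (a b a' b' m : ℤ) (h : a + b = m) (h' : a' + b' = m) (hne : a ≠ a') :
    tensorι K L a b m h ≫ tensorπ K L a' b' m h' = 0 := by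
  simp [tensorπ, hne]

@[simp]
theorem tensorι_π_assoc (a b m : ℤ) (h : a + b = m) {Z : Rep.{u} k G} (f : K.X a ⊗ L.X b ⟶ Z) :
    tensorι K L a b m h ≫ tensorπ K L a b m h ≫ f = f := by
  rw [← Category.assoc, tensorι_π, Category.id_comp]

theorem tensorι_π_of_ne_assoc (a b a' b' m : ℤ) (h : a + b = m) (h' : a' + b' = m) (hne : a ≠ a')
    {Z : Rep.{u} k G} (f : K.X a' ⊗ L.X b' ⟶ Z) :
    tensorι K L a b m h ≫ tensorπ K L a' b' m h' ≫ f = 0 := by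
  rw [← Category.assoc, tensorι_π_of_ne _ _ _ _ _ _ _ _ _ hne, zero_comp]

theorem d_tensorπ (a b m m' a₀ b₀ : ℤ) (h : a + b = m') (hm : m + 1 = m') (ha : a₀ + 1 = a)
    (hb : b₀ + 1 = b) :
    (tensorComplex K L).d m m' ≫ tensorπ K L a b m' h =
      tensorπ K L a₀ b m (by omega) ≫ (K.d a₀ a ▷ L.X b) +
        a.negOnePow • tensorπ K L a b₀ m (by omega) ≫ (K.X a ◁ L.d b₀ b) := by
  refine tensorComplex_hom_ext fun p q hpq => ?_
  rw [tensorι_d_assoc K L p q m m' (p + 1) (q + 1) hpq hm rfl rfl]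
  simp only [Preadditive.add_comp, Preadditive.comp_add, Category.assoc, Linear.units_smul_comp,
    Linear.comp_units_smul]
  congr 1
  · by_cases hp : p = a₀
    · subst hp ha
      obtain rfl : q = b := by omega
      simp
    · rw [tensorι_π_of_ne_assoc _ _ _ _ _ _ _ _ _ hp, tensorι_π_of_ne _ _ _ _ _ _ _ _ _ (by omega)]
      simp
  · by_cases hp : p = a
    · subst hp hb
      obtain rfl : q = b₀ := by omega
      simp
    · rw [tensorι_π_of_ne_assoc _ _ _ _ _ _ _ _ _ hp, tensorι_π_of_ne _ _ _ _ _ _ _ _ _ hp]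
      simp

theorem isZero_tensor_of_left {V W : Rep.{u} k G} (h : IsZero V) : IsZero (V ⊗ W) :=
  (tensorRight W).map_isZero h

theorem isZero_tensor_of_right {V W : Rep.{u} k G} (h : IsZero W) : IsZero (V ⊗ W) :=
  (tensorLeft V).map_isZero h

/-- If K is bounded, each term of the tensor product is a finite biproduct, so termwise properties
can be checked on the summands. -/
theorem sum_tensorπ_ι (s : Finset ℤ) (hs : ∀ a ∉ s, IsZero (K.X a)) (m : ℤ) :
    ∑ a ∈ s, tensorπ K L a (m - a) m (by omega) ≫ tensorι K L a (m - a) m (by omega) =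
      𝟙 ((tensorComplex K L).X m) := by
  refine tensorComplex_hom_ext fun p q hpq => ?_
  by_cases hp : p ∈ s
  · rw [Preadditive.comp_sum, Finset.sum_eq_single_of_mem p hp]
    · obtain rfl : q = m - p := by omega
      simp
    · intro b _ hb
      rw [tensorι_π_of_ne_assoc _ _ _ _ _ _ _ _ _ hb.symm]
  · exact (isZero_tensor_of_left (hs p hp)).eq_of_src _ _

theorem tensorComplex_bounded
    (hK : ∃ a b : ℤ, ∀ n, (n < a ∨ b < n) → IsZero (K.X n))
    (hL : ∃ a b : ℤ, ∀ n, (n < a ∨ b < n) → IsZero (L.X n)) :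
    ∃ a b : ℤ, ∀ n, (n < a ∨ b < n) → IsZero ((tensorComplex K L).X n) := by
  obtain ⟨a, b, hab⟩ := hK
  obtain ⟨a', b', hab'⟩ := hL
  refine ⟨a + a', b + b', fun n hn => ?_⟩
  rw [IsZero.iff_id_eq_zero]
  refine tensorComplex_hom_ext fun p q hpq => IsZero.eq_of_src ?_ _ _
  by_cases hp : p < a ∨ b < p
  · exact isZero_tensor_of_left (hab p hp)
  · exact isZero_tensor_of_right (hab' q (by omega))

end TensorComplex

/-! ### Perfectness of tensor products and duals. -/

section RepPerfect

open MonoidalCategory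

variable {k : Type u} [Field k] {G : Type y} [Group G]

theorem finiteDimensional_of_sum_eq_id {V : Rep.{u} k G} {ι : Type*} (s : Finset ι)
    (W : ι → Rep.{u} k G) (hW : ∀ i, FiniteDimensional k (W i)) (p : ∀ i, V ⟶ W i)
    (j : ∀ i, W i ⟶ V) (h : ∑ i ∈ s, p i ≫ j i = 𝟙 V) : FiniteDimensional k V := by
  have h1 : (LinearMap.id : V →ₗ[k] V) =
      ∑ i ∈ s, (j i).hom.toLinearMap ∘ₗ (p i).hom.toLinearMap := by
    have h2 : ∀ t : Finset ι, (∑ i ∈ t, p i ≫ j i).hom.toLinearMap =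
        ∑ i ∈ t, (j i).hom.toLinearMap ∘ₗ (p i).hom.toLinearMap := by
      classical
      intro t
      induction t using Finset.induction_on with
      | empty => rfl
      | insert a t ha ih => rw [Finset.sum_insert ha, Finset.sum_insert ha, ← ih]; rfl
    rw [← h2, h]; rfl
  have h3 : FiniteDimensional k (LinearMap.range (LinearMap.id : V →ₗ[k] V)) := by
    rw [h1]
    have : ∀ i, FiniteDimensional k
        (LinearMap.range ((j i).hom.toLinearMap ∘ₗ (p i).hom.toLinearMap)) := fun i => by
      have := hW i
      exact Submodule.finiteDimensional_of_le (LinearMap.range_comp_le_range _ _)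
    have h4 : FiniteDimensional k (s.sup fun i =>
        LinearMap.range ((j i).hom.toLinearMap ∘ₗ (p i).hom.toLinearMap) : Submodule k V) :=
      Submodule.finiteDimensional_finset_sup _ _
    refine Submodule.finiteDimensional_of_le (S₂ := s.sup fun i =>
        LinearMap.range ((j i).hom.toLinearMap ∘ₗ (p i).hom.toLinearMap)) ?_
    rintro _ ⟨x, rfl⟩
    rw [LinearMap.sum_apply]
    exact Submodule.sum_mem _ fun i hi => Finset.le_sup (f := fun i =>
      LinearMap.range ((j i).hom.toLinearMap ∘ₗ (p i).hom.toLinearMap)) hi ⟨x, rfl⟩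
  rw [LinearMap.range_id] at h3
  exact Module.Finite.equiv Submodule.topEquiv

section

variable [Fintype G]

/-- Conjugation by g commutes with composing with the equivariant maps `p i` and `j i`, so the
endomorphisms of the pieces can be transported and summed. -/
theorem HasAveraging.of_sum_eq_id {V : Rep.{u} k G} {ι : Type*} (s : Finset ι)
    (W : ι → Rep.{u} k G) (hW : ∀ i, HasAveraging (W i)) (p : ∀ i, V ⟶ W i)
    (j : ∀ i, W i ⟶ V) (h : ∑ i ∈ s, p i ≫ j i = 𝟙 V) : HasAveraging V := by
  choose θ hθ using hW
  refine ⟨∑ i ∈ s, (j i).hom.toLinearMap ∘ₗ θ i ∘ₗ (p i).hom.toLinearMap, fun x => ?_⟩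
  have h2 : ∀ t : Finset ι, (∑ i ∈ t, p i ≫ j i).hom x =
      ∑ i ∈ t, (j i).hom ((p i).hom x) := by
    classical
    intro t
    induction t using Finset.induction_on with
    | empty => rfl
    | insert a t ha ih => rw [Finset.sum_insert ha, Finset.sum_insert ha, ← ih]; rfl
  have hx : ∑ i ∈ s, (j i).hom ((p i).hom x) = x := by rw [← h2, h]; rfl
  simp only [LinearMap.sum_apply, map_sum]
  rw [Finset.sum_comm]
  conv_rhs => rw [← hx]
  refine Finset.sum_congr rfl fun i _ => ?_
  conv_rhs => rw [← hθ i ((p i).hom x), map_sum]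
  refine Finset.sum_congr rfl fun g _ => ?_
  change V.ρ g ((j i).hom (θ i ((p i).hom (V.ρ g⁻¹ x)))) = _
  rw [Rep.hom_comm_apply, Rep.hom_comm_apply]

/-- The identity of W is fixed by conjugation, so θ tensored with it averages to the identity. -/
theorem HasAveraging.tensor_left {V : Rep.{u} k G} (h : HasAveraging V) (W : Rep.{u} k G) :
    HasAveraging (V ⊗ W) := by
  obtain ⟨θ, hθ⟩ := h
  refine ⟨TensorProduct.map θ LinearMap.id, fun x => ?_⟩
  induction x using TensorProduct.induction_on with
  | zero => simp
  | add a b ha hb => simp only [map_add, Finset.sum_add_distrib, ha, hb]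
  | tmul v w =>
    have : ∀ g : G, (V ⊗ W).ρ g (TensorProduct.map θ LinearMap.id ((V ⊗ W).ρ g⁻¹ (v ⊗ₜ w))) =
        (V.ρ g (θ (V.ρ g⁻¹ v))) ⊗ₜ w := fun g => by
      simp [Rep.tensor_ρ, Representation.tprod_apply]
    simp only [this]
    rw [← TensorProduct.sum_tmul, hθ]

theorem HasAveraging.tensor_right {W : Rep.{u} k G} (h : HasAveraging W) (V : Rep.{u} k G) :
    HasAveraging (V ⊗ W) := by
  obtain ⟨θ, hθ⟩ := h
  refine ⟨TensorProduct.map LinearMap.id θ, fun x => ?_⟩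
  induction x using TensorProduct.induction_on with
  | zero => simp
  | add a b ha hb => simp only [map_add, Finset.sum_add_distrib, ha, hb]
  | tmul v w =>
    have : ∀ g : G, (V ⊗ W).ρ g (TensorProduct.map LinearMap.id θ ((V ⊗ W).ρ g⁻¹ (v ⊗ₜ w))) =
        v ⊗ₜ (W.ρ g (θ (W.ρ g⁻¹ w))) := fun g => by
      simp [Rep.tensor_ρ, Representation.tprod_apply]
    simp only [this]
    rw [← TensorProduct.tmul_sum, hθ]

theorem HasAveraging.dual {V : Rep.{u} k G} (h : HasAveraging V) :
    HasAveraging (Rep.of V.ρ.dual) := by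
  obtain ⟨θ, hθ⟩ := h
  refine ⟨θ.dualMap, fun φ => LinearMap.ext fun x => ?_⟩
  conv_rhs => rw [← hθ x, map_sum]
  change (∑ g : G, V.ρ.dual g (θ.dualMap (V.ρ.dual g⁻¹ φ))) x = _
  rw [LinearMap.sum_apply]
  refine Finset.sum_congr rfl fun g _ => ?_
  simp [Representation.dual_apply, Module.Dual.transpose_apply]

theorem isPerfectRepComplex_iff (K : CochainComplex (Rep.{u} k G) ℤ) :
    IsPerfectRepComplex K ↔ (∀ n, FiniteDimensional k (K.X n)) ∧ (∀ n, HasAveraging (K.X n)) ∧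
      ∃ a b : ℤ, ∀ n, (n < a ∨ b < n) → IsZero (K.X n) := by
  have hz : ∀ n, IsZero ((toModuleComplex K).X n) ↔ IsZero (K.X n) := fun n => by
    rw [Rep.isZero_iff, ModuleCat.isZero_iff_subsingleton]; rfl
  constructor
  · rintro ⟨h1, h2, h3⟩
    exact ⟨fun n => (finite_asModule_iff _).mp (h1 n),
      fun n => (projective_asModule_iff _).mp (h2 n), by simpa only [hz] using h3⟩
  · rintro ⟨h1, h2, h3⟩
    exact ⟨fun n => (finite_asModule_iff _).mpr (h1 n),
      fun n => (projective_asModule_iff _).mpr (h2 n), by simpa only [hz] using h3⟩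

end

theorem dualComplex_bounded {K : CochainComplex (Rep.{u} k G) ℤ}
    (hK : ∃ a b : ℤ, ∀ n, (n < a ∨ b < n) → IsZero (K.X n)) :
    ∃ a b : ℤ, ∀ n, (n < a ∨ b < n) → IsZero ((dualComplex K).X n) := by
  obtain ⟨a, b, hab⟩ := hK
  refine ⟨-b, -a, fun n hn => ?_⟩
  have : Subsingleton (K.X (-n)) := (Rep.isZero_iff _ _ _).mp (hab (-n) (by omega))
  rw [Rep.isZero_iff]
  exact inferInstanceAs (Subsingleton (Module.Dual k (K.X (-n))))

theorem IsFiniteRepComplex.dual {K : CochainComplex (Rep.{u} k G) ℤ} (hK : IsFiniteRepComplex K) :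
    IsFiniteRepComplex (dualComplex K) where
  finite n := by
    have := hK.finite (-n)
    exact inferInstanceAs (FiniteDimensional k (Module.Dual k (K.X (-n))))
  bounded := dualComplex_bounded hK.bounded

theorem IsFiniteRepComplex.tensor {K L : CochainComplex (Rep.{u} k G) ℤ}
    (hK : IsFiniteRepComplex K) (hL : IsFiniteRepComplex L) :
    IsFiniteRepComplex (tensorComplex K L) where
  finite n := by
    obtain ⟨a, b, hab⟩ := hK.bounded
    refine finiteDimensional_of_sum_eq_id _ _ (fun i => ?_) _ _
      (sum_tensorπ_ι K L (Finset.Icc a b) (fun i hi => hab i ?_) n)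
    · have := hK.finite i
      have := hL.finite (n - i)
      exact inferInstanceAs (FiniteDimensional k (TensorProduct k (K.X i) (L.X (n - i))))
    · rw [Finset.mem_Icc] at hi; omega
  bounded := tensorComplex_bounded K L hK.bounded hL.bounded

theorem IsPerfectRepComplex.isFiniteRepComplex [Finite G] {K : CochainComplex (Rep.{u} k G) ℤ}
    (hK : IsPerfectRepComplex K) : IsFiniteRepComplex K := by
  cases nonempty_fintype G
  have h := (isPerfectRepComplex_iff K).mp hK
  exact ⟨h.1, h.2.2⟩

theorem IsPerfectRepComplex.dual [Finite G] {K : CochainComplex (Rep.{u} k G) ℤ}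
    (hK : IsPerfectRepComplex K) : IsPerfectRepComplex (dualComplex K) := by
  cases nonempty_fintype G
  have h := (isPerfectRepComplex_iff K).mp hK
  have hf := hK.isFiniteRepComplex.dual
  exact (isPerfectRepComplex_iff _).mpr ⟨hf.finite, fun n => (h.2.1 (-n)).dual, hf.bounded⟩

theorem IsPerfectRepComplex.tensor_left [Finite G] {K L : CochainComplex (Rep.{u} k G) ℤ}
    (hK : IsPerfectRepComplex K) (hL : IsFiniteRepComplex L) :
    IsPerfectRepComplex (tensorComplex K L) := by
  cases nonempty_fintype G
  have h := (isPerfectRepComplex_iff K).mp hK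
  have hf := hK.isFiniteRepComplex.tensor hL
  obtain ⟨a, b, hab⟩ := h.2.2
  refine (isPerfectRepComplex_iff _).mpr ⟨hf.finite, fun n => ?_, hf.bounded⟩
  refine HasAveraging.of_sum_eq_id _ _ (fun i => (h.2.1 i).tensor_left _) _ _
      (sum_tensorπ_ι K L (Finset.Icc a b) (fun i hi => hab i ?_) n)
  rw [Finset.mem_Icc] at hi; omega

theorem IsPerfectRepComplex.tensor_right [Finite G] {K L : CochainComplex (Rep.{u} k G) ℤ}
    (hL : IsPerfectRepComplex L) (hK : IsFiniteRepComplex K) :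
    IsPerfectRepComplex (tensorComplex K L) := by
  cases nonempty_fintype G
  have h := (isPerfectRepComplex_iff L).mp hL
  have hf := hK.tensor hL.isFiniteRepComplex
  obtain ⟨a, b, hab⟩ := hK.bounded
  refine (isPerfectRepComplex_iff _).mpr ⟨hf.finite, fun n => ?_, hf.bounded⟩
  refine HasAveraging.of_sum_eq_id _ _ (fun i => (h.2.1 (n - i)).tensor_right _) _ _
      (sum_tensorπ_ι K L (Finset.Icc a b) (fun i hi => hab i ?_) n)
  rw [Finset.mem_Icc] at hi; omega

end RepPerfect

/-! ### Comparing Hom polynomials through Hom complexes. -/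

section RepCochains

open CochainComplex CochainComplex.HomComplex

variable {k : Type u} [Field k] {G : Type y} [Group G]

instance : (Rep.toModuleMonoidAlgebra.{u} (k := k) (G := G)).Linear k where
  map_smul {V W} f r := by
    ext x
    change (show W.ρ.asModule from r • f.hom x) =
      algebraMap k (MonoidAlgebra k G) r • (show W.ρ.asModule from f.hom x)
    rw [algebraMap_smul]
    rfl

/-- Cochains of complexes of representations are cochains of the complexes of `kG`-modules. -/
def repCochainEquiv (K L : CochainComplex (Rep.{u} k G) ℤ) (n : ℤ) :
    Cochain K L n ≃ₗ[k] Cochain (toModuleComplex K) (toModuleComplex L) n where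
  toFun z := z.map Rep.toModuleMonoidAlgebra
  map_add' z z' := Cochain.map_add z z' _
  map_smul' r z := by
    ext1 p q hpq
    exact Functor.map_smul (Rep.toModuleMonoidAlgebra.{u} (k := k) (G := G)) r (z.v p q hpq)
  invFun z := Cochain.mk fun p q hpq =>
    (Rep.toModuleMonoidAlgebra.{u} (k := k) (G := G)).preimage (z.v p q hpq)
  left_inv z := by
    ext1 p q hpq
    exact (Rep.toModuleMonoidAlgebra.{u} (k := k) (G := G)).preimage_map _
  right_inv z := by
    ext1 p q hpq
    exact (Rep.toModuleMonoidAlgebra.{u} (k := k) (G := G)).map_preimage _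

theorem repCochainEquiv_δ (K L : CochainComplex (Rep.{u} k G) ℤ) (n m : ℤ) (z : Cochain K L n) :
    repCochainEquiv K L m (δ n m z) = δ n m (repCochainEquiv K L n z) :=
  (δ_map n m z (Rep.toModuleMonoidAlgebra.{u} (k := k) (G := G))).symm

theorem finrank_range_δ_eq_of_equiv {A : Type*} [Category* A] [Preadditive A] [Linear k A]
    {B : Type*} [Category* B] [Preadditive B] [Linear k B]
    {K L : CochainComplex A ℤ} {K' L' : CochainComplex B ℤ}
    (e : ∀ n, Cochain K L n ≃ₗ[k] Cochain K' L' n)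
    (he : ∀ n m (_ : n + 1 = m) z, e m (δ n m z) = δ n m (e n z)) (n m : ℤ) (hnm : n + 1 = m) :
    Module.finrank k (δ_hom k K L n m).range = Module.finrank k (δ_hom k K' L' n m).range := by
  have h : (δ_hom k K' L' n m).range = (δ_hom k K L n m).range.map (e m).toLinearMap := by
    ext z
    constructor
    · rintro ⟨w, rfl⟩
      refine ⟨_, ⟨(e n).symm w, rfl⟩, ?_⟩
      exact (he n m hnm _).trans (by rw [LinearEquiv.apply_symm_apply]; rfl)
    · rintro ⟨_, ⟨w, rfl⟩, rfl⟩
      exact ⟨e n w, (he n m hnm w).symm⟩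
  rw [h]
  exact (LinearEquiv.finrank_map_eq (e m) _).symm

/-- An isomorphism of Hom complexes matches all terms of `Perf.finrank_hom_shift`, so no functor
between the homotopy categories is required. -/
theorem homPoly_eq_of_cochainEquiv {Λ : Type*} [Ring Λ] [Algebra k Λ] [FiniteDimensional k Λ]
    {K L K' L' : CochainComplex (ModuleCat.{x} Λ) ℤ} (hK : IsPerfectComplex Λ K)
    (hL : IsPerfectComplex Λ L) (hK' : IsPerfectComplex Λ K') (hL' : IsPerfectComplex Λ L')
    (e : ∀ n, Cochain K L n ≃ₗ[k] Cochain K' L' n)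
    (he : ∀ n m (_ : n + 1 = m) z, e m (δ n m z) = δ n m (e n z)) :
    homPoly k (Perf.of K hK) (Perf.of L hL) = homPoly k (Perf.of K' hK') (Perf.of L' hL') := by
  have h := Perf.formHypothesis.{_, x} k (Λ := Λ)
  ext i
  rw [h.coeff_homPoly, h.coeff_homPoly]
  have e₁ := Perf.finrank_hom_shift (k := k) hK hL i
  have e₂ := Perf.finrank_hom_shift (k := k) hK' hL' i
  have e₃ := finrank_range_δ_eq_of_equiv e he i (i + 1) rfl
  have e₄ := finrank_range_δ_eq_of_equiv e he (i - 1) i (by omega)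
  have e₅ := (e i).finrank_eq
  omega

theorem homPoly_perfOfRep_eq [Finite G] {K L K' L' : CochainComplex (Rep.{u} k G) ℤ}
    (hK : IsPerfectRepComplex K) (hL : IsPerfectRepComplex L)
    (hK' : IsPerfectRepComplex K') (hL' : IsPerfectRepComplex L')
    (e : ∀ n, Cochain K L n ≃ₗ[k] Cochain K' L' n)
    (he : ∀ n m (_ : n + 1 = m) z, e m (δ n m z) = δ n m (e n z)) :
    homPoly k (perfOfRep K hK) (perfOfRep L hL) =
      homPoly k (perfOfRep K' hK') (perfOfRep L' hL') := by
  refine homPoly_eq_of_cochainEquiv hK hL hK' hL'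
    (fun n => (repCochainEquiv K L n).symm.trans ((e n).trans (repCochainEquiv K' L' n))) ?_
  intro n m hnm z
  obtain ⟨z, rfl⟩ := (repCochainEquiv K L n).surjective z
  simp only [LinearEquiv.trans_apply, LinearEquiv.symm_apply_apply]
  rw [← repCochainEquiv_δ, LinearEquiv.symm_apply_apply, he n m hnm, repCochainEquiv_δ]

end RepCochains

/-! ### Transposition of cochains. -/

section DualCochains

open CochainComplex CochainComplex.HomComplex

variable {k : Type u} [Field k] {G : Type y} [Group G]

theorem dualMap_add {V W : Rep.{u} k G} (f g : V ⟶ W) : dualMap (f + g) = dualMap f + dualMap g :=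
    by
  ext φ x
  exact map_add φ _ _

theorem dualMap_smul {V W : Rep.{u} k G} (r : k) (f : V ⟶ W) : dualMap (r • f) = r • dualMap f := by
  ext φ x
  exact map_smul φ _ _

theorem dualMap_bijective (V W : Rep.{u} k G) [FiniteDimensional k V] [FiniteDimensional k W] :
    Function.Bijective (dualMap : (V ⟶ W) → _) := by
  constructor
  · intro f g h
    ext x
    refine sub_eq_zero.mp ((Module.forall_dual_apply_eq_zero_iff k _).mp fun φ => ?_)
    have := LinearMap.congr_fun (congrArg (fun h => (Rep.Hom.hom h).toLinearMap φ) h) x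
    rw [map_sub]
    exact sub_eq_zero.mpr this
  · intro f
    -- Finite dimensionality lets the transpose of f be read as a map V → W through the double
    -- duals.
    let f₀ : V →ₗ[k] W := (Module.evalEquiv k W).symm.toLinearMap ∘ₗ f.hom.toLinearMap.dualMap ∘ₗ
      (Module.evalEquiv k V).toLinearMap
    have hf₀ : ∀ φ x, φ (f₀ x) = f.hom φ x := by
      intro φ x
      have : ∀ ψ : Module.Dual k (Module.Dual k W), φ ((Module.evalEquiv k W).symm ψ) = ψ φ := by
        intro ψ
        obtain ⟨w, rfl⟩ := (Module.evalEquiv k W).surjective ψ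
        simp
      exact this _
    refine ⟨Rep.ofHom ⟨f₀, fun g => ?_⟩, ?_⟩
    · ext x
      refine sub_eq_zero.mp ((Module.forall_dual_apply_eq_zero_iff k _).mp fun φ => ?_)
      rw [map_sub, sub_eq_zero]
      change φ (f₀ (V.ρ g x)) = φ (W.ρ g (f₀ x))
      have h1 : φ (W.ρ g (f₀ x)) = (W.ρ.dual g⁻¹ φ) (f₀ x) := by
        simp [Representation.dual_apply, Module.Dual.transpose_apply]
      rw [h1, hf₀, hf₀, Rep.hom_comm_apply f g⁻¹ φ]
      change _ = (V.ρ.dual g⁻¹ (f.hom φ)) x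
      simp [Representation.dual_apply, Module.Dual.transpose_apply]
    · ext φ x
      exact hf₀ φ x

/-- Transposition of morphisms, with values in morphisms between terms of dual complexes. -/
def dualHom (K L : CochainComplex (Rep.{u} k G) ℤ) (p q : ℤ) :
    (K.X (-q) ⟶ L.X (-p)) →ₗ[k] ((dualComplex L).X p ⟶ (dualComplex K).X q) where
  toFun f := dualMap f
  map_add' := dualMap_add
  map_smul' := dualMap_smul

theorem dualHom_units_smul (K L : CochainComplex (Rep.{u} k G) ℤ) (p q : ℤ) (r : ℤˣ)
    (f : K.X (-q) ⟶ L.X (-p)) : dualHom K L p q (r • f) = r • dualHom K L p q f := by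
  rw [Units.smul_def, Units.smul_def, map_zsmul]

theorem dualHom_comp (K L M : CochainComplex (Rep.{u} k G) ℤ) (p q r : ℤ)
    (f : K.X (-r) ⟶ L.X (-q)) (g : L.X (-q) ⟶ M.X (-p)) :
    dualHom K M p r (f ≫ g) = dualHom L M p q g ≫ dualHom K L q r f := rfl

theorem dualComplex_d (K : CochainComplex (Rep.{u} k G) ℤ) (p q : ℤ) :
    (dualComplex K).d p q = (p + 1).negOnePow • dualHom K K p q (K.d (-q) (-p)) := rfl

theorem dualHom_bijective (K L : CochainComplex (Rep.{u} k G) ℤ) (p q : ℤ)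
    (hK : FiniteDimensional k (K.X (-q))) (hL : FiniteDimensional k (L.X (-p))) :
    Function.Bijective (dualHom K L p q) :=
  dualMap_bijective _ _

/-- The transpose of a cochain. -/
def dualCochain (K L : CochainComplex (Rep.{u} k G) ℤ) (n : ℤ) :
    Cochain K L n →ₗ[k] Cochain (dualComplex L) (dualComplex K) n where
  toFun z := Cochain.mk fun p q hpq =>
    -- With the sign in the differential of `dualComplex`, this is a sign for which transposition
    -- commutes with δ.
    (p * n).negOnePow • dualHom K L p q (z.v (-q) (-p) (by omega))
  map_add' z z' := by
    ext1 p q hpq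
    simp
  map_smul' r z := by
    ext1 p q hpq
    simp only [Cochain.mk_v, Cochain.smul_v, map_smul, RingHom.id_apply]
    rw [smul_comm]

theorem dualCochain_v {K L : CochainComplex (Rep.{u} k G) ℤ} {n : ℤ} (z : Cochain K L n)
    (p q : ℤ) (hpq : p + n = q) : (dualCochain K L n z).v p q hpq =
      (p * n).negOnePow • dualHom K L p q (z.v (-q) (-p) (by omega)) := rfl

theorem dualCochain_bijective (K L : CochainComplex (Rep.{u} k G) ℤ)
    (hK : ∀ n, FiniteDimensional k (K.X n)) (hL : ∀ n, FiniteDimensional k (L.X n)) (n : ℤ) :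
    Function.Bijective (dualCochain K L n) := by
  have hb : ∀ p q, Function.Bijective (dualHom K L p q) := fun p q =>
    dualHom_bijective K L p q (hK _) (hL _)
  constructor
  · intro z z' h
    ext1 p q hpq
    have key : ∀ p q (hpq : p + n = q), z.v (-q) (-p) (by omega) = z'.v (-q) (-p) (by omega) := by
      intro p q hpq
      have := Cochain.congr_v h p q hpq
      rw [dualCochain_v, dualCochain_v, smul_left_cancel_iff] at this
      exact (hb _ _).1 this
    have e : ∀ a b (hab : a + n = b), a = p → b = q → z.v a b hab = z'.v a b hab →
        z.v p q hpq = z'.v p q hpq := by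
      rintro a b hab rfl rfl h
      exact h
    exact e _ _ _ (neg_neg p) (neg_neg q) (key (-q) (-p) (by omega))
  · intro w
    choose f hf using fun p q (hpq : p + n = q) =>
      (hb p q).2 ((p * n).negOnePow • w.v p q hpq)
    refine ⟨Cochain.mk fun a b hab => (K.XIsoOfEq (neg_neg a).symm).hom ≫
      f (-b) (-a) (by omega) ≫ (L.XIsoOfEq (neg_neg b)).hom, ?_⟩
    ext1 p q hpq
    have e : ∀ p' q' (hp : p' = p) (hq : q' = q) (h : p' + n = q') (h₁ : -q = -q')
        (h₂ : -p' = -p), (K.XIsoOfEq h₁).hom ≫ f p' q' h ≫ (L.XIsoOfEq h₂).hom = f p q hpq := by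
      rintro p' q' rfl rfl h h₁ h₂
      simp
    rw [dualCochain_v, Cochain.mk_v, e _ _ (neg_neg p) (neg_neg q), hf, smul_smul,
      Int.units_mul_self, one_smul]

theorem negOnePow_eq_of_two_mul {a b : ℤ} (c : ℤ) (h : a - b = 2 * c) :
    a.negOnePow = b.negOnePow :=
  (Int.negOnePow_eq_iff _ _).mpr ⟨c, by rw [h, two_mul]⟩

/-- Transposition reverses composition and so exchanges the two terms of δ; what remains is that the
signs agree modulo 2. -/
theorem dualCochain_δ (K L : CochainComplex (Rep.{u} k G) ℤ) (n m : ℤ) (hnm : n + 1 = m)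
    (z : Cochain K L n) : dualCochain K L m (δ n m z) = δ n m (dualCochain K L n z) := by
  ext1 p q hpq
  obtain rfl : m = n + 1 := hnm.symm
  rw [dualCochain_v, δ_v n (n + 1) rfl z _ _ _ (-(p + 1)) (-(q - 1)) (by omega) (by omega),
    δ_v n (n + 1) rfl _ _ _ _ (q - 1) (p + 1) rfl rfl, dualCochain_v, dualCochain_v,
    map_add, dualHom_units_smul, dualHom_comp _ _ _ p (p + 1) q,
    dualHom_comp _ _ _ p (q - 1) q, smul_add, add_comm, dualComplex_d, dualComplex_d]
  simp only [Linear.units_smul_comp, Linear.comp_units_smul, smul_smul,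
    ← Int.negOnePow_add]
  congr 1
  · congr 1
    exact negOnePow_eq_of_two_mul 0 (by subst hpq; ring)
  · congr 1
    exact negOnePow_eq_of_two_mul (-1 - n) (by ring)

theorem homPoly_dual [Finite G] {M N : CochainComplex (Rep.{u} k G) ℤ}
    (hM : IsPerfectRepComplex M) (hN : IsPerfectRepComplex N) :
    homPoly k (perfOfRep M hM) (perfOfRep N hN) =
      homPoly k (perfOfRep _ hN.dual) (perfOfRep _ hM.dual) :=
  homPoly_perfOfRep_eq _ _ _ _
    (fun n => LinearEquiv.ofBijective (dualCochain M N n)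
      (dualCochain_bijective M N hM.isFiniteRepComplex.finite hN.isFiniteRepComplex.finite n))
    (fun n m hnm z => dualCochain_δ M N n m hnm z)

end DualCochains

/-! ### Evaluation on the dual complex. -/

section TensorHom

open MonoidalCategory CochainComplex CochainComplex.HomComplex

variable {k : Type u} [Field k] {G : Type y} [Group G]

/-- The morphism `V* ⊗ W ⊗ V ⟶ W` given by evaluation. -/
def dualEval (V W : Rep.{u} k G) : (Rep.of V.ρ.dual ⊗ W) ⊗ V ⟶ W :=
  Rep.ofHom ⟨TensorProduct.lift (dualTensorHom k V W), fun g => by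
    refine TensorProduct.ext_threefold fun φ w v => ?_
    simp [Rep.tensor_ρ, Representation.tprod_apply, Representation.dual_apply,
      Module.Dual.transpose_apply]⟩

theorem dualEval_apply (V W : Rep.{u} k G) (φ : Module.Dual k V) (w : W) (v : V) :
    (dualEval V W).hom ((φ ⊗ₜ[k] w) ⊗ₜ[k] v) = φ v • w := by
  simp [dualEval]

theorem rep_hom_ext_threefold {A B C D : Rep.{u} k G} {f g : (A ⊗ B) ⊗ C ⟶ D}
    (h : ∀ (a : A) (b : B) (c : C), f.hom ((a ⊗ₜ[k] b) ⊗ₜ[k] c) = g.hom ((a ⊗ₜ[k] b) ⊗ₜ[k] c)) :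
    f = g := by
  refine Rep.hom_ext (Representation.IntertwiningMap.toLinearMap_injective _ _ ?_)
  exact TensorProduct.ext_threefold h

theorem dualEval_naturality_right (V : Rep.{u} k G) {W W' : Rep.{u} k G} (f : W ⟶ W') :
    ((Rep.of V.ρ.dual ◁ f) ▷ V) ≫ dualEval V W' = dualEval V W ≫ f := by
  refine rep_hom_ext_threefold fun φ w v => ?_
  change (dualEval V W').hom ((φ ⊗ₜ[k] f.hom w) ⊗ₜ[k] v) = f.hom ((dualEval V W).hom _)
  rw [dualEval_apply, dualEval_apply, map_smul]

theorem dualEval_naturality_left {V V' : Rep.{u} k G} (f : V ⟶ V') (W : Rep.{u} k G) :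
    ((dualMap f ▷ W) ▷ V) ≫ dualEval V W = (_ ◁ f) ≫ dualEval V' W := by
  refine rep_hom_ext_threefold fun φ w v => ?_
  change (dualEval V W).hom ((f.hom.toLinearMap.dualMap φ ⊗ₜ[k] w) ⊗ₜ[k] v) =
    (dualEval V' W).hom ((φ ⊗ₜ[k] w) ⊗ₜ[k] f.hom v)
  rw [dualEval_apply, dualEval_apply]
  rfl

/-- This is tensor-hom adjunction, with Hom(V, W) replaced by V* ⊗ W, which is allowed since V is
finite dimensional. -/
theorem dualEval_bijective (V W P : Rep.{u} k G) [FiniteDimensional k V] :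
    Function.Bijective fun g : P ⟶ Rep.of V.ρ.dual ⊗ W => (g ▷ V) ≫ dualEval V W := by
  have hE : ∀ (g : P ⟶ Rep.of V.ρ.dual ⊗ W) (x : P) (v : V),
      ((g ▷ V) ≫ dualEval V W).hom (x ⊗ₜ[k] v) = dualTensorHomEquiv k V W (g.hom x) v := by
    intro g x v
    change TensorProduct.lift (dualTensorHom k V W) (g.hom x ⊗ₜ[k] v) = _
    rw [TensorProduct.lift.tmul]
    rfl
  constructor
  · intro f g h
    ext x
    refine (dualTensorHomEquiv k V W).injective (LinearMap.ext fun v => ?_)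
    refine (hE f x v).symm.trans (Eq.trans ?_ (hE g x v))
    exact congrArg (fun h : P ⊗ V ⟶ W => h.hom (x ⊗ₜ[k] v)) h
  · intro c
    let g₀ : P →ₗ[k] TensorProduct k (Module.Dual k V) W :=
      (dualTensorHomEquiv k V W).symm.toLinearMap ∘ₗ TensorProduct.curry c.hom.toLinearMap
    have hg₀ : ∀ x v, dualTensorHomEquiv k V W (g₀ x) v = c.hom (x ⊗ₜ[k] v) := fun x v => by
      simp [g₀]
    refine ⟨Rep.ofHom ⟨g₀, fun g => ?_⟩, ?_⟩
    · ext x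
      refine (dualTensorHomEquiv k V W).injective (LinearMap.ext fun v => ?_)
      change dualTensorHomEquiv k V W (g₀ (P.ρ g x)) v =
        (dualTensorHom k V W ∘ₗ TensorProduct.map (V.ρ.dual g) (W.ρ g)) (g₀ x) v
      rw [Representation.dualTensorHom_comm, hg₀]
      change _ = W.ρ g (dualTensorHomEquiv k V W (g₀ x) (V.ρ g⁻¹ v))
      rw [hg₀, ← Rep.hom_comm_apply]
      congr 1
      simp [Rep.tensor_ρ, Representation.tprod_apply]
    · refine Rep.hom_ext (Representation.IntertwiningMap.toLinearMap_injective _ _ ?_)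
      exact TensorProduct.ext' fun x v => (hE _ x v).trans (hg₀ x v)

theorem units_smul_whiskerRight (ε : ℤˣ) {V W : Rep.{u} k G} (f : V ⟶ W) (Z : Rep.{u} k G) :
    (ε • f) ▷ Z = ε • (f ▷ Z) := by
  rcases Int.units_eq_one_or ε with rfl | rfl
  · rw [one_smul, one_smul]
  · rw [Units.neg_smul, Units.neg_smul, one_smul, one_smul]
    exact (tensorRight Z).map_neg

variable (U N : CochainComplex (Rep.{u} k G) ℤ)

/-- Evaluation on a term of the dual complex. -/
def dualComplexEval (b : ℤ) (W : Rep.{u} k G) : ((dualComplex U).X b ⊗ W) ⊗ U.X (-b) ⟶ W :=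
  dualEval (U.X (-b)) W

theorem dualComplexEval_naturality (b : ℤ) {W W' : Rep.{u} k G} (f : W ⟶ W') :
    (((dualComplex U).X b ◁ f) ▷ U.X (-b)) ≫ dualComplexEval U b W' =
      dualComplexEval U b W ≫ f :=
  dualEval_naturality_right _ f

theorem dualComplexEval_d (b₀ b : ℤ) (h : b₀ + 1 = b) (W : Rep.{u} k G) :
    (((dualComplex U).d b₀ b ▷ W) ▷ U.X (-b)) ≫ dualComplexEval U b W =
      b.negOnePow • (_ ◁ U.d (-b) (-b₀)) ≫ dualComplexEval U b₀ W := by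
  subst h
  have := dualEval_naturality_left (U.d (-(b₀ + 1)) (-b₀)) W
  have h2 : ((dualHom U U b₀ (b₀ + 1) (U.d (-(b₀ + 1)) (-b₀)) ▷ W) ▷ U.X (-(b₀ + 1))) ≫
      dualComplexEval U (b₀ + 1) W = (_ ◁ U.d (-(b₀ + 1)) (-b₀)) ≫ dualComplexEval U b₀ W := this
  rw [← h2, dualComplex_d]
  rw [units_smul_whiskerRight, units_smul_whiskerRight, Linear.units_smul_comp]

/-- The components of the evaluation `(U* ⊗ N) ⊗ U ⟶ N`. -/
def tensorEval (r b q m : ℤ) (h : b + m = r) (hq : q = -b) :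
    (tensorComplex (dualComplex U) N).X r ⊗ U.X q ⟶ N.X m :=
  (q * (r + 1)).negOnePow • (tensorπ (dualComplex U) N b m r h ▷ U.X q) ≫
    (_ ◁ (U.XIsoOfEq hq).hom) ≫ dualComplexEval U b (N.X m)

/-- In components this says that evaluation (U* ⊗ N) ⊗ U → N is a chain map. Dinaturality of
evaluation moves the differential of U* to U, and the sign in `tensorEval` accounts for the Koszul
signs. -/
theorem d_tensorEval (r r' b b₀ q q' m m' : ℤ) (h : b + m' = r') (h₀ : b + m = r)
    (hr : r + 1 = r') (hb : b₀ + 1 = b) (hq : q = -b) (hq' : q' = -b₀) :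
    ((tensorComplex (dualComplex U) N).d r r' ▷ U.X q) ≫ tensorEval U N r' b q m' h hq =
      tensorEval U N r b q m h₀ hq ≫ N.d m m' +
        (r + 1).negOnePow • (_ ◁ U.d q q') ≫ tensorEval U N r b₀ q' m' (by omega) hq' := by
  subst hq hq'
  simp only [tensorEval, HomologicalComplex.XIsoOfEq_rfl, Iso.refl_hom, whiskerLeft_id,
    Category.id_comp, Linear.comp_units_smul, Linear.units_smul_comp, Category.assoc]
  rw [← comp_whiskerRight_assoc, d_tensorπ _ _ b m' r r' b₀ m h hr hb (by omega),
    ← dualComplexEval_naturality, whisker_exchange_assoc, smul_smul]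
  rw [MonoidalPreadditive.add_whiskerRight, units_smul_whiskerRight, Preadditive.add_comp,
    Linear.units_smul_comp, comp_whiskerRight, comp_whiskerRight,
    Category.assoc, Category.assoc, dualComplexEval_d _ _ _ hb, Linear.comp_units_smul, smul_add,
    smul_smul, smul_smul, add_comm]
  congr 1
  · congr 1
    rw [← Int.negOnePow_add]
    exact negOnePow_eq_of_two_mul 0 (by subst hr; ring)
  · congr 1
    rw [← Int.negOnePow_add, ← Int.negOnePow_add]
    exact negOnePow_eq_of_two_mul (-1 - r) (by subst hr hb; ring)

end TensorHom

/-! ### Tensor-hom adjunction on cochains. -/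

section TensorHomAdjunction

open MonoidalCategory CochainComplex CochainComplex.HomComplex

variable {k : Type u} [Field k] {G : Type y} [Group G]
variable (M U N : CochainComplex (Rep.{u} k G) ℤ)

theorem dualComplexEval_bijective (hU : ∀ n, FiniteDimensional k (U.X n)) (b : ℤ)
    (P W : Rep.{u} k G) : Function.Bijective fun g : P ⟶ (dualComplex U).X b ⊗ W =>
      (g ▷ U.X (-b)) ≫ dualComplexEval U b W := by
  have := hU (-b)
  exact dualEval_bijective (U.X (-b)) W P

theorem whiskerRight_tensorEval {P : Rep.{u} k G} {r : ℤ}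
    (g : P ⟶ (tensorComplex (dualComplex U) N).X r) (b m : ℤ) (h : b + m = r) :
    (g ▷ U.X (-b)) ≫ tensorEval U N r b (-b) m h rfl = (-b * (r + 1)).negOnePow •
      ((g ≫ tensorπ _ _ b m r h) ▷ U.X (-b)) ≫ dualComplexEval U b (N.X m) := by
  simp [tensorEval, Linear.comp_units_smul]

/-- As U* is bounded, a map into U* ⊗ N is determined by its projections to the summands, and each
projection by its evaluation. -/
theorem tensorEval_injective (hU : IsFiniteRepComplex U) {P : Rep.{u} k G} {r : ℤ}
    {g g' : P ⟶ (tensorComplex (dualComplex U) N).X r}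
    (h : ∀ b m hbm, (g ▷ U.X (-b)) ≫ tensorEval U N r b (-b) m hbm rfl =
      (g' ▷ U.X (-b)) ≫ tensorEval U N r b (-b) m hbm rfl) : g = g' := by
  obtain ⟨a₁, a₂, ha⟩ := hU.dual.bounded
  have e := sum_tensorπ_ι (dualComplex U) N (Finset.Icc a₁ a₂)
    (fun i hi => ha i (by rw [Finset.mem_Icc] at hi; omega)) r
  rw [← Category.comp_id g, ← Category.comp_id g', ← e, Preadditive.comp_sum, Preadditive.comp_sum]
  refine Finset.sum_congr rfl fun b _ => ?_
  rw [← Category.assoc, ← Category.assoc]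
  congr 1
  have := h b (r - b) (by omega)
  rw [whiskerRight_tensorEval, whiskerRight_tensorEval, smul_left_cancel_iff] at this
  exact (dualComplexEval_bijective U hU.finite b _ _).1 this

theorem exists_whiskerRight_tensorEval (hU : IsFiniteRepComplex U) {P : Rep.{u} k G} {r : ℤ}
    (c : ∀ b m, b + m = r → (P ⊗ U.X (-b) ⟶ N.X m)) :
    ∃ g : P ⟶ (tensorComplex (dualComplex U) N).X r, ∀ b m hbm,
      (g ▷ U.X (-b)) ≫ tensorEval U N r b (-b) m hbm rfl = c b m hbm := by
  obtain ⟨a₁, a₂, ha⟩ := hU.bounded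
  choose f hf using fun b m hbm => (dualComplexEval_bijective U hU.finite b P (N.X m)).2
    ((-b * (r + 1)).negOnePow • c b m hbm)
  refine ⟨∑ b ∈ Finset.Icc (-a₂) (-a₁), f b (r - b) (by omega) ≫ tensorι _ _ b (r - b) r (by omega),
    fun b m hbm => ?_⟩
  by_cases hb : b ∈ Finset.Icc (-a₂) (-a₁)
  · obtain rfl : m = r - b := by omega
    rw [whiskerRight_tensorEval, Preadditive.sum_comp, Finset.sum_eq_single_of_mem b hb]
    · rw [Category.assoc, tensorι_π, Category.comp_id]
      refine (congrArg _ (hf b (r - b) hbm)).trans ?_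
      rw [smul_smul, Int.units_mul_self, one_smul]
    · intro b' _ hb'
      rw [Category.assoc, tensorι_π_of_ne _ _ _ _ _ _ _ _ _ hb', comp_zero]
  -- Outside the range of summation the term of U in degree -b is zero, so both sides have zero
  -- source.
  · refine (isZero_tensor_of_right (ha (-b) ?_)).eq_of_src _ _
    rw [Finset.mem_Icc] at hb
    omega

/-- The morphism of cochains adjoint to evaluation. -/
def tensorHomCochain (n : ℤ) : Cochain M (tensorComplex (dualComplex U) N) n →ₗ[k]
    Cochain (tensorComplex M U) N n where
  toFun z := Cochain.mk fun p q hpq => tensorDesc fun a b hab =>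
    (z.v a (a + n) rfl ▷ U.X b) ≫ tensorEval U N (a + n) (-b) b q (by omega) (by omega)
  map_add' z z' := by
    ext1 p q hpq
    refine tensorComplex_hom_ext fun a b hab => ?_
    simp
  map_smul' r z := by
    ext1 p q hpq
    refine tensorComplex_hom_ext fun a b hab => ?_
    simp

theorem tensorι_tensorHomCochain {n : ℤ} (z : Cochain M (tensorComplex (dualComplex U) N) n)
    (a b b' p q r : ℤ) (hab : a + b = p) (hpq : p + n = q) (har : a + n = r) (hb : b = -b') :
    tensorι M U a b p hab ≫ (tensorHomCochain M U N n z).v p q hpq =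
      (z.v a r har ▷ U.X b) ≫ tensorEval U N r b' b q (by omega) hb := by
  subst har
  obtain rfl : b' = -b := by omega
  exact tensorι_desc _ _ _ _ _ _

theorem tensorι_tensorHomCochain_assoc {n : ℤ} (z : Cochain M (tensorComplex (dualComplex U) N) n)
    (a b b' p q r : ℤ) (hab : a + b = p) (hpq : p + n = q) (har : a + n = r) (hb : b = -b')
    {Z : Rep.{u} k G} (f : N.X q ⟶ Z) :
    tensorι M U a b p hab ≫ (tensorHomCochain M U N n z).v p q hpq ≫ f =
      (z.v a r har ▷ U.X b) ≫ tensorEval U N r b' b q (by omega) hb ≫ f := by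
  rw [← Category.assoc, tensorι_tensorHomCochain M U N z a b b' p q r hab hpq har hb, Category.assoc]

theorem tensorHomCochain_bijective (hU : IsFiniteRepComplex U) (n : ℤ) :
    Function.Bijective (tensorHomCochain M U N n) := by
  constructor
  · intro z z' h
    ext1 p r hpr
    refine tensorEval_injective U N hU fun b m hbm => ?_
    rw [← tensorι_tensorHomCochain M U N z p (-b) b (p - b) m r (by omega) (by omega) hpr rfl,
      ← tensorι_tensorHomCochain M U N z' p (-b) b (p - b) m r (by omega) (by omega) hpr rfl, h]
  · intro w
    choose f hf using fun p r (hpr : p + n = r) =>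
      exists_whiskerRight_tensorEval U N hU (P := M.X p) (r := r) fun b m hbm =>
        tensorι M U p (-b) (p - b) (by omega) ≫ w.v (p - b) m (by omega)
    refine ⟨Cochain.mk f, ?_⟩
    ext1 p q hpq
    refine tensorComplex_hom_ext fun a b hab => ?_
    obtain ⟨b', rfl⟩ : ∃ b', b = -b' := ⟨-b, by omega⟩
    obtain rfl : p = a - b' := by omega
    rw [tensorι_tensorHomCochain M U N _ a (-b') b' _ q (a + n) hab hpq rfl rfl]
    exact hf a (a + n) rfl b' q (by omega)

/-- On each summand of M ⊗ U both sides consist of three terms, one for each of the differentials of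
M, U and N; `d_tensorEval` turns the differential of U* ⊗ N into those of N and U. -/
theorem tensorHomCochain_δ (n m : ℤ) (hnm : n + 1 = m)
    (z : Cochain M (tensorComplex (dualComplex U) N) n) :
    tensorHomCochain M U N m (δ n m z) = δ n m (tensorHomCochain M U N n z) := by
  ext1 p q hpq
  refine tensorComplex_hom_ext fun a b hab => ?_
  rw [tensorι_tensorHomCochain M U N _ a b (-b) p q (a + m) hab hpq rfl (by omega),
    δ_v n m hnm _ p q hpq (q - 1) (p + 1) rfl rfl,
    δ_v n m hnm _ a (a + m) rfl (a + n) (a + 1) (by omega) rfl,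
    Preadditive.comp_add, Linear.comp_units_smul,
    tensorι_tensorHomCochain_assoc M U N z a b (-b) p (q - 1) (a + n) hab (by omega) rfl
      (by omega),
    tensorι_d_assoc M U a b p (p + 1) (a + 1) (b + 1) hab rfl rfl rfl,
    Preadditive.add_comp, Category.assoc, Linear.units_smul_comp, Category.assoc,
    tensorι_tensorHomCochain M U N z (a + 1) b (-b) (p + 1) q (a + m) (by omega) (by omega)
      (by omega) (by omega),
    tensorι_tensorHomCochain M U N z a (b + 1) (-b - 1) (p + 1) q (a + n) (by omega) (by omega)
      rfl (by omega),
    MonoidalPreadditive.add_whiskerRight, units_smul_whiskerRight, comp_whiskerRight,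
    comp_whiskerRight, Preadditive.add_comp, Linear.units_smul_comp, Category.assoc, Category.assoc,
    d_tensorEval U N (a + n) (a + m) (-b) (-b - 1) b (b + 1) (q - 1) q (by omega) (by omega)
      (by omega) (by omega) (by omega) (by omega),
    Preadditive.comp_add, Linear.comp_units_smul, whisker_exchange_assoc, smul_add, smul_smul,
    ← Int.negOnePow_add, add_assoc, add_comm (m.negOnePow • _)]
  congr 4
  omega

theorem homPoly_tensor [Finite G] {M U N : CochainComplex (Rep.{u} k G) ℤ}
    (hM : IsPerfectRepComplex M) (hN : IsPerfectRepComplex N) (hU : IsFiniteRepComplex U) :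
    homPoly k (perfOfRep _ (hM.tensor_left hU)) (perfOfRep N hN) =
      homPoly k (perfOfRep M hM) (perfOfRep _ (hN.tensor_right hU.dual)) :=
  (homPoly_perfOfRep_eq _ _ _ _
    (fun n => LinearEquiv.ofBijective (tensorHomCochain M U N n)
      (tensorHomCochain_bijective M U N hU n))
    (fun n m hnm z => tensorHomCochain_δ M U N n m hnm z)).symm

end TensorHomAdjunction

end ARForm

end

theorem theorem4p3 (k : Type u) [Field k] [IsAlgClosed k] :
    -- Hom-finite Krull-Schmidt triangulated categories with finitely many nonzero shifted Homs
    (∀ (C : Type v) [Category.{v'} C] [Preadditive C] [HasZeroObject C] [HasShift C ℤ]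
      [∀ n : ℤ, (shiftFunctor C n).Additive] [Pretriangulated C] [IsTriangulated C]
      [Linear k C] [∀ n : ℤ, (shiftFunctor C n).Linear k],
      FormHypothesis k C →
      -- the forms are well defined
      (∃! B : SesqT C, IsFormT k B) ∧
      (∃! BQ : SesqQ C, IsFormQ k BQ) ∧
      ∀ (B : SesqT C) (BQ : SesqQ C),
        IsFormT k B → IsFormQ k BQ →
        (∀ M N : C, B (clsT M) (clsT N) = homPoly k M N) ∧
        (∀ x y : At C, BQ (1 ⊗ₜ[Zt] x) (1 ⊗ₜ[Zt] y) =
          algebraMap Zt Qt (B x y)) ∧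
        -- Auslander-Reiten triangles give dual elements
        ∀ (T : Triangle C), IsARTriangle T → ∀ M : C, Indecomposable M →
          ((¬ ∃ i : ℤ, Nonempty (M ≅ T.obj₃⟦i⟧)) →
            B (clsT M) (hatT T) = 0 ∧
            BQ (clsQ M) ((1 + tQ⁻¹)⁻¹ • hatQ T) = 0) ∧
          (Nonempty (M ≅ T.obj₃) →
            B (clsT M) (hatT T) = 1 + tZ ∧
            BQ (clsQ M) ((1 + tQ⁻¹)⁻¹ • hatQ T) = 1) ∧
          ((¬ ∃ i : ℤ, Nonempty (M ≅ T.obj₁⟦i⟧)) →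
            B (hatT T) (clsT M) = 0 ∧
            BQ ((1 + tQ)⁻¹ • hatQ T) (clsQ M) = 0) ∧
          (Nonempty (M ≅ T.obj₁) →
            B (hatT T) (clsT M) = 1 + tZ ∧
            BQ ((1 + tQ)⁻¹ • hatQ T) (clsQ M) = 1)) ∧
    -- perfect complexes over a symmetric algebra
    (∀ (Λ : Type w) [Ring Λ] [Algebra k Λ], IsSymmetricAlgebra k Λ →
      FormHypothesis k (Perf.{x} Λ) ∧
      (∀ B : SesqT (Perf.{x} Λ), IsFormT k B →
        ∀ a b, B a b = barZ (B b a)) ∧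
      (∀ BQ : SesqQ (Perf.{x} Λ), IsFormQ k BQ →
        ∀ a b, BQ a b = barQ (BQ b a))) ∧
    -- perfect complexes over the group algebra of a finite group
    (∀ (G : Type y) [Group G] [Finite G],
      FormHypothesis k (Perf.{u} (MonoidAlgebra k G)) ∧
      ∀ B : SesqT (Perf.{u} (MonoidAlgebra k G)), IsFormT k B →
      ∀ BQ : SesqQ (Perf.{u} (MonoidAlgebra k G)), IsFormQ k BQ →
      ∀ (M N : CochainComplex (Rep.{u} k G) ℤ)
        (hM : IsPerfectRepComplex M) (hN : IsPerfectRepComplex N),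
        (∀ U : CochainComplex (Rep.{u} k G) ℤ, IsFiniteRepComplex U →
          ∃ (hMU : IsPerfectRepComplex (tensorComplex M U))
            (hUN : IsPerfectRepComplex
              (tensorComplex (dualComplex U) N)),
            B (clsT (perfOfRep _ hMU)) (clsT (perfOfRep N hN)) =
              B (clsT (perfOfRep M hM)) (clsT (perfOfRep _ hUN)) ∧
            BQ (clsQ (perfOfRep _ hMU)) (clsQ (perfOfRep N hN)) =
              BQ (clsQ (perfOfRep M hM)) (clsQ (perfOfRep _ hUN))) ∧
        ∃ (hM' : IsPerfectRepComplex (dualComplex M))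
          (hN' : IsPerfectRepComplex (dualComplex N)),
          B (clsT (perfOfRep M hM)) (clsT (perfOfRep N hN)) =
            B (clsT (perfOfRep _ hN')) (clsT (perfOfRep _ hM')) ∧
          B (clsT (perfOfRep M hM)) (clsT (perfOfRep N hN)) =
            barZ
              (B (clsT (perfOfRep _ hM')) (clsT (perfOfRep _ hN'))) ∧
          BQ (clsQ (perfOfRep M hM)) (clsQ (perfOfRep N hN)) =
            BQ (clsQ (perfOfRep _ hN')) (clsQ (perfOfRep _ hM')) ∧
          BQ (clsQ (perfOfRep M hM)) (clsQ (perfOfRep N hN)) =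
            barQ
              (BQ (clsQ (perfOfRep _ hM'))
                (clsQ (perfOfRep _ hN')))) := by
  refine ⟨fun C _ _ _ _ _ _ _ _ _ h => ⟨h.existsUnique_isFormT, h.existsUnique_isFormQ,
      fun B BQ hB hBQ => ⟨h.isFormT_apply hB, h.isFormQ_tmul hB hBQ,
        fun T hT M hM => h.arTriangle_duality hB hBQ hT hM⟩⟩,
    fun Λ _ _ hΛ => ?_, fun G _ _ => ?_⟩
  · have := hΛ.finiteDimensional
    have h := Perf.formHypothesis.{w, x} k (Λ := Λ)
    exact ⟨h, fun B hB a b => h.hermitianT (homPoly_perf_hermitian hΛ) hB a b,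
      fun BQ hBQ a b => h.hermitianQ (homPoly_perf_hermitian hΛ) hBQ a b⟩
  · have hG := isSymmetricAlgebra_monoidAlgebra k G
    have := hG.finiteDimensional
    have h := Perf.formHypothesis.{_, u} k (Λ := MonoidAlgebra k G)
    refine ⟨h, fun B hB BQ hBQ M N hM hN => ?_⟩
    have hQ : ∀ X Y : Perf.{u} (MonoidAlgebra k G), BQ (clsQ X) (clsQ Y) =
        algebraMap Zt Qt (B (clsT X) (clsT Y)) := fun X Y => h.isFormQ_tmul hB hBQ _ _
    -- Dualizing reverses the two arguments, and the Hermitian property over kG puts them back at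
    -- the cost of a bar.
    have hbar : B (clsT (perfOfRep M hM)) (clsT (perfOfRep N hN)) =
        barZ (B (clsT (perfOfRep _ hM.dual)) (clsT (perfOfRep _ hN.dual))) := by
      rw [h.isFormT_apply hB, h.isFormT_apply hB, homPoly_dual hM hN]
      exact homPoly_perf_hermitian hG _ _
    have hdual : B (clsT (perfOfRep M hM)) (clsT (perfOfRep N hN)) =
        B (clsT (perfOfRep _ hN.dual)) (clsT (perfOfRep _ hM.dual)) := by
      rw [h.isFormT_apply hB, h.isFormT_apply hB, homPoly_dual hM hN]
    refine ⟨fun U hU => ⟨hM.tensor_left hU, hN.tensor_right hU.dual, ?_⟩,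
      hM.dual, hN.dual, hdual, hbar, ?_, ?_⟩
    · have ht : B (clsT (perfOfRep _ (hM.tensor_left hU))) (clsT (perfOfRep N hN)) =
          B (clsT (perfOfRep M hM)) (clsT (perfOfRep _ (hN.tensor_right hU.dual))) := by
        rw [h.isFormT_apply hB, h.isFormT_apply hB, homPoly_tensor hM hN hU]
      exact ⟨ht, by rw [hQ, hQ, ht]⟩
    · rw [hQ, hQ, hdual]
    · rw [hQ, hQ, hbar, barQ_algebraMap]
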